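/- Let $\mathbb{T}=\mathbb{R}/(2\pi\mathbb{Z})$, $\widehat f(n)=\frac1{2\pi}\int_{\mathbb T} f(x)e^{-inx}\,dx$, $\langle x\rangle=(1+x^2)^{1/2}$, and let $\mathcal{F}L^{s,p}(\mathbb{T})$ be the space with norm $\|f\|_{\mathcal{F}L^{s,p}}=\|\langle n\rangle^s\widehat f(n)\|_{\ell^p_n}$. Let $X^{s,b}_{p,q}$ be the space of functions on $\mathbb{R}\times\mathbb{T}$ with norm $\|\langle n\rangle^s\langle\tau-n^3\rangle^b\,\widehat u(\tau,n)\|_{\ell^p_nL^q_\tau}$, let $Z^{s,1/2}_p=X^{s,1/2}_{p,2}\cap X^{s,0}_{p,1}$, and let $X^{s,1/2}_{p,2}(T)$, $Z^{s,1/2}_p(T)$ be the corresponding restriction spaces on $[-T,T]\times\mathbb T$ (infimum of the norm over all extensions). For either choice of sign $\pm$, consider the second renormalized complex-valued mKdV equation (mKdV2) $$\partial_t u+\partial_x^3u=\pm\,\mathcal{N}(u),\qquad \mathcal{N}(u)=|u|^2\partial_xu-\Big(\tfrac1{2\pi}\int_{\mathbb{T}}|u|^2dx\Big)\partial_xu-i\Big(\tfrac1{2\pi}\int_{\mathbb{T}}\operatorname{Im}(\overline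 u\,\partial_xu)\,dx\Big)u,\qquad u|_{t=0}=u_0 .$$ A solution on $[-T,T]$ is a function $u\in C([-T,T];\mathcal{F}L^{s,p}(\mathbb{T}))\cap X^{s,1/2}_{p,2}(T)$ with $u(0)=u_0$ that satisfies the Duhamel formula, with $\mathcal N(u)$ understood as the limit of $\mathcal N(\mathbf P_{\le N}u)$, where $\mathbf P_{\le N}$ is the projection onto the frequencies $|n|\le N$: for all $t\in[-T,T]$ and $n\in\mathbb{Z}$, $$\widehat u(t,n)=e^{itn^3}\widehat{u_0}(n)\pm\lim_{N\to\infty}\int_0^te^{i(t-t')n^3}\,\widehat{\mathcal N(\mathbf P_{\le N}u(t'))}(n)\,dt'.$$ **Theorem 1.4.** Let $(s,p)$ satisfy one of the conditions: (i) $\frac12\le s<\frac34$ and $1\le p<\frac4{3-4s}$; (ii) $s\ge\frac34$ and $1\le p<\infty$. Then mKdV2 is locally well-posed in $\mathcal{F}L^{s,p}(\mathbb{T})$, in the following sense. 1. (Existence and continuous dependence.) For every $R>0$ there are $T\in(0,1]$ and $C\ge0$ such that every $u_0\in\mathcal{F}L^{s,p}(\mathbb{T})$ with $\|u_0\|_{\mathcal{F}L^{s,p}}\le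 R$ is the initial datum of a solution $u=\Phi(u_0)$ on $[-T,T]$, with $u\in Z^{s,1/2}_p(T)$; and, for all $u_0,v_0$ in this ball, $$\|\Phi(u_0)-\Phi(v_0)\|_{Z^{s,1/2}_p(T)}\le C\|u_0-v_0\|_{\mathcal{F}L^{s,p}},\qquad \sup_{|t|\le T}\|\Phi(u_0)(t)-\Phi(v_0)(t)\|_{\mathcal{F}L^{s,p}}\le C\|u_0-v_0\|_{\mathcal{F}L^{s,p}}.$$ 2. (Uniqueness.) For every $0<T\le1$ and every $u_0\in\mathcal{F}L^{s,p}(\mathbb{T})$, any two solutions on $[-T,T]$ with initial datum $u_0$ coincide on $[-T,T]$. -/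

import Mathlib

open MeasureTheory Filter Topology
open scoped ENNReal NNReal

noncomputable section

namespace MKdV

instance fact_two_pi_pos : Fact (0 < 2 * Real.pi) := ⟨Real.two_pi_pos⟩

/-- The circle `𝕋 = ℝ / 2πℤ`. -/
abbrev Torus : Type := AddCircle (2 * Real.pi)

/-- Complex-valued square-integrable functions on the circle. -/
abbrev L2Torus : Type := Lp ℂ 2 (AddCircle.haarAddCircle : Measure Torus)

/-- The spatial Fourier coefficient `f̂(n) = (2π)⁻¹ ∫_𝕋 f(x) e^{-inx} dx`. -/
def coeff (f : L2Torus) (n : ℤ) : ℂ := fourierCoeff (f : Torus → ℂ) n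

/-- The Japanese bracket `⟨x⟩ = (1 + x²)^{1/2}`. -/
def bracket (x : ℝ) : ℝ := Real.sqrt (1 + x ^ 2)

/-- The norm `‖f‖_{FL^{s,p}} = ‖⟨n⟩^s f̂(n)‖_{ℓ^p_n}`, with values in `[0, ∞]`; the function `f`
belongs to the Fourier-Lebesgue space `FL^{s,p}(𝕋)` when it is finite. (If `p ≤ 2` and `0 ≤ s`, or
if `2 < p` and `s > 1/2 - 1/p`, every periodic distribution with finite norm is in `L²(𝕋)`.) -/
def flNorm (s p : ℝ) (f : L2Torus) : ℝ≥0∞ :=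
  (∑' n : ℤ, ENNReal.ofReal (bracket n ^ s * ‖coeff f n‖) ^ p) ^ (1 / p)

/-- The norm `‖⟨n⟩^s ⟨τ - n³⟩^b g(τ, n)‖_{ℓ^p_n L^q_τ}` of a function `g` of the frequencies
`n ∈ ℤ` and `τ ∈ ℝ` (written `g n τ`), with values in `[0, ∞]`. -/
def xNorm (s b p : ℝ) (q : ℝ≥0∞) (g : ℤ → ℝ → ℂ) : ℝ≥0∞ :=
  (∑' n : ℤ,
    eLpNorm (fun τ : ℝ => bracket n ^ s * bracket (τ - (n : ℝ) ^ 3) ^ b * ‖g n τ‖) q volume ^ p)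
      ^ (1 / p)

/-- `g` is the space-time Fourier transform of a function on `ℝ × 𝕋` that extends `u` from
`[-T, T] × 𝕋`: for each `n`, the partial inverse transforms `∫_{-A}^{A} e^{itτ} g(τ, n) dτ` converge
to `û(t, n)` in `L²_t([-T, T])` as `A → ∞` (the inverse Fourier-Plancherel transform when
`g(·, n) ∈ L²`). -/
def IsExtension (T : ℝ) (u : ℝ → L2Torus) (g : ℤ → ℝ → ℂ) : Prop :=
  ∀ n : ℤ, AEStronglyMeasurable (g n) volume ∧
    Tendsto (fun A : ℝ => eLpNorm
        (fun t : ℝ => coeff (u t) n -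
          ∫ τ in (-A)..A, Complex.exp (Complex.I * (t * τ : ℝ)) * g n τ)
        2 (volume.restrict (Set.Icc (-T) T)))
      atTop (𝓝 0)

/-- The restriction norm of `X^{s,1/2}_{p,2}(T)`: the infimum of the `X^{s,1/2}_{p,2}` norms of the
extensions. -/
def xNormOn (s p T : ℝ) (u : ℝ → L2Torus) : ℝ≥0∞ :=
  ⨅ (g : ℤ → ℝ → ℂ) (_ : IsExtension T u g), xNorm s (1 / 2) p 2 g

/-- The restriction norm of `Z^{s,1/2}_p(T)`, where `Z^{s,1/2}_p = X^{s,1/2}_{p,2} ∩ X^{s,0}_{p,1}`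
carries the sum of the two norms. -/
def zNormOn (s p T : ℝ) (u : ℝ → L2Torus) : ℝ≥0∞ :=
  ⨅ (g : ℤ → ℝ → ℂ) (_ : IsExtension T u g), (xNorm s (1 / 2) p 2 g + xNorm s 0 p 1 g)

/-- `u ∈ C([-T, T]; FL^{s,p}(𝕋))`. -/
def ContinuousFL (s p T : ℝ) (u : ℝ → L2Torus) : Prop :=
  ∀ t₀ ∈ Set.Icc (-T) T, flNorm s p (u t₀) < ∞ ∧
    Tendsto (fun t => flNorm s p (u t - u t₀)) (𝓝[Set.Icc (-T) T] t₀) (𝓝 0)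

/-- The mean `(2π)⁻¹ ∫_0^{2π} h(x) dx`. -/
def mean (h : ℝ → ℝ) : ℝ := (2 * Real.pi)⁻¹ * ∫ x in (0 : ℝ)..(2 * Real.pi), h x

/-- The nonlinearity `|f|² ∂ₓf - (⨍ |f|²) ∂ₓf - i (⨍ Im(f̄ ∂ₓf)) f` of mKdV2, for a smooth
`2π`-periodic function `f`. -/
def nonlinearity (f : ℝ → ℂ) (x : ℝ) : ℂ :=
  ((‖f x‖ ^ 2 : ℝ) : ℂ) * deriv f x
    - (mean (fun y => ‖f y‖ ^ 2) : ℂ) * deriv f x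
    - Complex.I * (mean (fun y => ((starRingEnd ℂ) (f y) * deriv f y).im) : ℂ) * f x

/-- The Dirichlet projection `P_{≤N} f(x) = ∑_{|n| ≤ N} f̂(n) e^{inx}`. -/
def truncate (N : ℕ) (f : L2Torus) (x : ℝ) : ℂ :=
  ∑ n ∈ Finset.Icc (-(N : ℤ)) N, coeff f n * Complex.exp (Complex.I * (n * x : ℝ))

/-- The `n`-th Fourier coefficient of the nonlinearity evaluated at `P_{≤N} f`. -/
def nonlinearityCoeff (N : ℕ) (f : L2Torus) (n : ℤ) : ℂ :=
  ((2 * Real.pi)⁻¹ : ℝ) * ∫ x in (0 : ℝ)..(2 * Real.pi),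
    nonlinearity (truncate N f) x * Complex.exp (-(Complex.I * (n * x : ℝ)))

/-- `u` solves `∂ₜu + ∂ₓ³u = σ 𝓝(u)`, `u(0) = u₀`, on `[-T, T]`, in integral (Duhamel) form:
for all `t ∈ [-T, T]` and all `n ∈ ℤ`,
`û(t, n) = e^{itn³} û₀(n) + σ lim_{N → ∞} ∫_0^t e^{i(t-t')n³} (𝓝(P_{≤N} u(t')))^(n) dt'`.
The nonlinearity is the limit of its values at the frequency truncations of `u`, because its
individual terms need not make sense for a function that is not in `H^{1/2}(𝕋)`. -/
def IsMildSolution (σ T : ℝ) (u₀ : L2Torus) (u : ℝ → L2Torus) : Prop :=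
  ∀ t ∈ Set.Icc (-T) T, ∀ n : ℤ,
    Tendsto (fun N : ℕ =>
        Complex.exp (Complex.I * (t * (n : ℝ) ^ 3 : ℝ)) * coeff u₀ n +
          σ * ∫ t' in (0 : ℝ)..t,
            Complex.exp (Complex.I * ((t - t') * (n : ℝ) ^ 3 : ℝ)) * nonlinearityCoeff N (u t') n)
      atTop (𝓝 (coeff (u t) n))

/-- `u` is a solution of mKdV2 with datum `u₀` in the class
`C([-T, T]; FL^{s,p}(𝕋)) ∩ X^{s,1/2}_{p,2}(T)`. -/
structure IsSolution (σ s p T : ℝ) (u₀ : L2Torus) (u : ℝ → L2Torus) : Prop where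
  continuousFL : ContinuousFL s p T u
  xNorm_lt_top : xNormOn s p T u < ∞
  initial : u 0 = u₀
  duhamel : IsMildSolution σ T u₀ u

/-- Local well-posedness of mKdV2 with sign `σ` in `FL^{s,p}(𝕋)`: existence on a time interval whose
length depends only on the size of the datum, Lipschitz dependence on the datum in
`Z^{s,1/2}_p(T)` and in `C([-T, T]; FL^{s,p}(𝕋))`, and uniqueness in
`C([-T, T]; FL^{s,p}(𝕋)) ∩ X^{s,1/2}_{p,2}(T)`. -/
structure LocallyWellPosed (σ s p : ℝ) : Prop where
  exists_flow : ∀ R : ℝ, 0 < R → ∃ T : ℝ, 0 < T ∧ T ≤ 1 ∧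
    ∃ (C : ℝ≥0) (Φ : L2Torus → ℝ → L2Torus),
      (∀ u₀ : L2Torus, flNorm s p u₀ ≤ ENNReal.ofReal R →
        IsSolution σ s p T u₀ (Φ u₀) ∧ zNormOn s p T (Φ u₀) < ∞) ∧
      (∀ u₀ v₀ : L2Torus, flNorm s p u₀ ≤ ENNReal.ofReal R → flNorm s p v₀ ≤ ENNReal.ofReal R →
        zNormOn s p T (fun t => Φ u₀ t - Φ v₀ t) ≤ C * flNorm s p (u₀ - v₀) ∧
        ∀ t ∈ Set.Icc (-T) T, flNorm s p (Φ u₀ t - Φ v₀ t) ≤ C * flNorm s p (u₀ - v₀))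
  unique : ∀ T : ℝ, 0 < T → T ≤ 1 → ∀ (u₀ : L2Torus) (u v : ℝ → L2Torus),
    IsSolution σ s p T u₀ u → IsSolution σ s p T u₀ v → ∀ t ∈ Set.Icc (-T) T, u t = v t

end MKdV

end

noncomputable section

namespace MKdV

/-! Put n₂ = k₁ + k₂ - n and pass to the interaction representation a_n(t) = e^{-itn³} û(t, n).
After symmetrization in k₁ and k₂, the two subtracted terms of the nonlinearity cancel the lines k₁
= n and k₂ = n, and only the value -n at the point (n, n) survives on them (`cmean_nonlinearity`).
The equation becomes a_n(t) = c_n + κ ∑_k mult(n, k) ∫_0^t e^{-isΦ} a_{k₁} conj(a_{n₂}) a_{k₂} ds,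
with κ = iσ and Φ = 3 (n - k₁)(n - k₂)(k₁ + k₂).

Existence is a contraction argument for the sequence (a_n), each a_n being measured in L^∞ ∩
B^{1/2}_{2,∞} in time. This space is an algebra, it tolerates sharp restriction to an interval
(which H^{1/2} does not), and integration against e^{isφ} over an interval of length L ≤ 2 gains √L
⟨φ⟩^{-1/2} (`timeNorm_osc_le`): a shift by half a period h = π/|φ| replaces the integrand by an
increment, of size √h in L². The factor √L makes the map contract. All that is left of the time
variable is the factor ⟨Φ⟩^{-1/2}, so the nonlinear estimate is a discrete one on weighted ℓ^p
(`wl_triSum_le`).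

By Hölder in k, the discrete estimate follows once the weighted kernel lies in ℓ^{p'}_k uniformly in
n (`tsum_triMult_rpow_le`). Off the resonance, |mult| ⟨Φ⟩^{-1/2} is at most a constant times |k₁ +
k₂|^{1/2} |n - k₁|^{-1/2} |n - k₂|^{-1/2}. Its p'-th power, with the weights, is dominated by
products (xy)^{-κ} of two brackets that are independent coordinates of k, where κ = p'(1 + 4s)/4;
and κ > 1 says exactly that 3/4 - s < 1/p. At k = (n, n) the kernel is |n| ⟨n⟩^{-2s}, bounded since
s ≥ 1/2. For s ≥ 1/2 and 1 ≤ p < ∞ both cases of the hypothesis amount to 3/4 - s < 1/p.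

That the fixed point lies in the restriction space is shown by an explicit extension: each Duhamel
integral is continued from [-1, 1] by affine pieces to a function supported in [-2, 2], and its
Fourier transform is estimated with the same half-period shift (`zt_ext_le`, `exists_extension`,
`zNormOn_le`).

Uniqueness concerns solutions that are only H^{1/2} in time, which does not embed in L^∞. But
H^{1/2} embeds in L⁶, and this suffices for a trilinear oscillatory integral to gain ⟨φ⟩^{-1/2}
pointwise in time (`enorm_osc_tri_le`). Inserted in the Duhamel formula, it bounds the supremum of
each a_n, so that every solution has finite norm in the contraction space
(`integral_eq_of_isSolution`). Two solutions then agree on short intervals, and a finite number of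
steps covers [-T, T] (`eqOn_of_integral_eq`). -/

lemma one_le_bracket (x : ℝ) : 1 ≤ bracket x := by
  unfold bracket
  rw [Real.one_le_sqrt]
  nlinarith [sq_nonneg x]

lemma bracket_pos (x : ℝ) : 0 < bracket x := zero_lt_one.trans_le (one_le_bracket x)

lemma abs_le_bracket (x : ℝ) : |x| ≤ bracket x := by
  unfold bracket
  exact Real.abs_le_sqrt (by linarith)

lemma bracket_le (x : ℝ) : bracket x ≤ 1 + |x| := by
  unfold bracket
  rw [Real.sqrt_le_left (by positivity)]
  nlinarith [abs_nonneg x, sq_abs x]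

lemma le_two_bracket (x : ℝ) : 1 + |x| ≤ 2 * bracket x := by
  linarith [one_le_bracket x, abs_le_bracket x]

/-! ### Resonance function, multiplier, and the counting estimate -/

/-- The resonance function `n³ - n₁³ + n₂³ - n₃³` with `n₂ = n₁ + n₃ - n`. -/
def phase (n : ℤ) (k : ℤ × ℤ) : ℤ := 3 * (n - k.1) * (n - k.2) * (k.1 + k.2)

/-- The symmetrized multiplier of the nonlinearity of mKdV2. -/
def mult (n : ℤ) (k : ℤ × ℤ) : ℝ :=
  if k.1 = n ∧ k.2 = n then -n else if k.1 = n ∨ k.2 = n then 0 else (k.1 + k.2) / 2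

/-- The multiplier after the gain `⟨Φ⟩^{-1/2}` of the time integration. -/
def gain (n : ℤ) (k : ℤ × ℤ) : ℝ := |mult n k| * bracket (phase n k) ^ (-(1 / 2) : ℝ)

lemma gain_nonneg (n : ℤ) (k : ℤ × ℤ) : 0 ≤ gain n k :=
  mul_nonneg (abs_nonneg _) (Real.rpow_nonneg (bracket_pos _).le _)

/-- The smaller of the two brackets takes over both exponents. -/
lemma rpow_mul_rpow_le_add {x y u v : ℝ} (hx : 1 ≤ x) (hy : 1 ≤ y) (hu : 0 ≤ u) (hv : 0 ≤ v) :
    x ^ (-u) * y ^ (-v) ≤ x ^ (-(u + v)) + y ^ (-(u + v)) := by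
  have hx0 : 0 < x := by linarith
  have hy0 : 0 < y := by linarith
  rcases le_total x y with h | h
  · have : y ^ (-v) ≤ x ^ (-v) := Real.rpow_le_rpow_of_nonpos hx0 h (by linarith)
    have h2 : x ^ (-u) * y ^ (-v) ≤ x ^ (-u) * x ^ (-v) := by gcongr
    rw [← Real.rpow_add hx0] at h2
    have := Real.rpow_nonneg hy0.le (-(u + v))
    rw [neg_add] at *
    linarith
  · have : x ^ (-u) ≤ y ^ (-u) := Real.rpow_le_rpow_of_nonpos hy0 h (by linarith)
    have h2 : x ^ (-u) * y ^ (-v) ≤ y ^ (-u) * y ^ (-v) := by gcongr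
    rw [← Real.rpow_add hy0] at h2
    have := Real.rpow_nonneg hx0.le (-(u + v))
    rw [neg_add] at *
    linarith

/-- When z is the largest, the missing exponents κ - u and κ - v are borrowed from z at no loss, and
the powers of z then cancel since the exponents sum to 2κ. -/
lemma rpow_three_le_aux {x y z u v w κ : ℝ} (hx : 1 ≤ x) (hy : 1 ≤ y) (hz : 1 ≤ z)
    (hu : u ≤ κ) (hv : v ≤ κ) (h : u + v + w = 2 * κ) (hxz : x ≤ z) (hyz : y ≤ z) :
    x ^ (-u) * y ^ (-v) * z ^ (-w) ≤ x ^ (-κ) * y ^ (-κ) := by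
  have hx0 : 0 < x := by linarith
  have hy0 : 0 < y := by linarith
  have hz0 : 0 < z := by linarith
  have h1 : x ^ (κ - u) ≤ z ^ (κ - u) := Real.rpow_le_rpow hx0.le hxz (by linarith)
  have h2 : y ^ (κ - v) ≤ z ^ (κ - v) := Real.rpow_le_rpow hy0.le hyz (by linarith)
  have e1 : x ^ (-u) = x ^ (-κ) * x ^ (κ - u) := by rw [← Real.rpow_add hx0]; ring_nf
  have e2 : y ^ (-v) = y ^ (-κ) * y ^ (κ - v) := by rw [← Real.rpow_add hy0]; ring_nf
  have e3 : z ^ (κ - u) * z ^ (κ - v) * z ^ (-w) = 1 := by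
    rw [← Real.rpow_add hz0, ← Real.rpow_add hz0]
    have : κ - u + (κ - v) + -w = 0 := by linarith
    rw [this, Real.rpow_zero]
  calc x ^ (-u) * y ^ (-v) * z ^ (-w)
      = x ^ (-κ) * y ^ (-κ) * (x ^ (κ - u) * y ^ (κ - v) * z ^ (-w)) := by rw [e1, e2]; ring
    _ ≤ x ^ (-κ) * y ^ (-κ) * (z ^ (κ - u) * z ^ (κ - v) * z ^ (-w)) := by gcongr
    _ = _ := by rw [e3, mul_one]

/-- Turns a product of three brackets with total exponent 2κ into products of two brackets with
exponent κ each, the form that can be summed over ℤ² when κ > 1. The largest bracket is the one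
discarded. -/
lemma rpow_three_le {x y z u v w κ : ℝ} (hx : 1 ≤ x) (hy : 1 ≤ y) (hz : 1 ≤ z)
    (hu : u ≤ κ) (hv : v ≤ κ) (hw : w ≤ κ) (h : u + v + w = 2 * κ) :
    x ^ (-u) * y ^ (-v) * z ^ (-w) ≤
      x ^ (-κ) * y ^ (-κ) + x ^ (-κ) * z ^ (-κ) + y ^ (-κ) * z ^ (-κ) := by
  have hx0 : 0 < x := by linarith
  have hy0 : 0 < y := by linarith
  have hz0 : 0 < z := by linarith
  have p1 : 0 ≤ x ^ (-κ) * y ^ (-κ) := by positivity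
  have p2 : 0 ≤ x ^ (-κ) * z ^ (-κ) := by positivity
  have p3 : 0 ≤ y ^ (-κ) * z ^ (-κ) := by positivity
  rcases le_total x y with hxy | hxy
  · rcases le_total y z with hyz | hyz
    · linarith [rpow_three_le_aux hx hy hz hu hv h (hxy.trans hyz) hyz]
    · have := rpow_three_le_aux hx hz hy hu hw (by linarith : u + w + v = 2 * κ) hxy hyz
      linarith [mul_right_comm (x ^ (-u)) (y ^ (-v)) (z ^ (-w))]
  · rcases le_total x z with hxz | hxz
    · linarith [rpow_three_le_aux hx hy hz hu hv h hxz (hxy.trans hxz)]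
    · have := rpow_three_le_aux hy hz hx hv hw (by linarith : v + w + u = 2 * κ) hxy hxz
      have e : x ^ (-u) * y ^ (-v) * z ^ (-w) = y ^ (-v) * z ^ (-w) * x ^ (-u) := by ring
      linarith

lemma rpow_le_of_le_add {x a b v : ℝ} (ha : 0 < a) (hb : 0 < b) (hx : 0 ≤ x) (hv : 0 ≤ v)
    (h : x ≤ a + b) : x ^ v ≤ 2 ^ v * (a ^ v + b ^ v) := by
  have hm : x ≤ 2 * max a b := by
    linarith [le_max_left a b, le_max_right a b]
  have h1 : x ^ v ≤ (2 * max a b) ^ v := Real.rpow_le_rpow hx hm hv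
  rw [Real.mul_rpow (by norm_num) (by positivity)] at h1
  refine h1.trans ?_
  gcongr
  rcases max_choice a b with h | h <;> rw [h]
  · linarith [Real.rpow_nonneg hb.le v]
  · linarith [Real.rpow_nonneg ha.le v]

/-- The sum of `(xy)^{-κ}` over the pairs of independent brackets. -/
def pairSum (κ d e b1 b2 b3 : ℝ) : ℝ :=
  d ^ (-κ) * b2 ^ (-κ) + d ^ (-κ) * b3 ^ (-κ) + b2 ^ (-κ) * b3 ^ (-κ) +
  (d ^ (-κ) * e ^ (-κ) + b2 ^ (-κ) * e ^ (-κ)) +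
  (e ^ (-κ) * b1 ^ (-κ) + b1 ^ (-κ) * b2 ^ (-κ)) + b1 ^ (-κ) * b3 ^ (-κ)

/-- Here N, d, e, b1, b2, b3 stand for the brackets of n, n - k₁, n - k₂, k₁, n₂, k₂. The weight N^v
goes to b1 or to d; a leftover power of d goes to b3 or b2, because n - k₁ = k₂ - n₂. Every branch
ends with three brackets of total exponent u + 2v = 2κ, each exponent being at most κ. -/
lemma high_freq_le {u v N d e b1 b2 b3 : ℝ} (hu : 0 ≤ u) (huv : u ≤ v) (hN : 0 ≤ N)
    (hd : 1 ≤ d) (he : 1 ≤ e) (h1 : 1 ≤ b1) (h2 : 1 ≤ b2) (h3 : 1 ≤ b3)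
    (hN1 : N ≤ b1 + d) (hd1 : d ≤ b3 + b2) :
    N ^ v * b3 ^ u * (d ^ (-u) * e ^ (-u)) * (b1 ^ (-v) * b2 ^ (-v) * b3 ^ (-v)) ≤
      2 ^ v * (3 * 2 ^ (v - u)) * (3 * pairSum ((u + 2 * v) / 2) d e b1 b2 b3) := by
  have hd0 : 0 < d := by linarith
  have he0 : 0 < e := by linarith
  have p1 : 0 < b1 := by linarith
  have p2 : 0 < b2 := by linarith
  have p3 : 0 < b3 := by linarith
  have hv : 0 ≤ v := hu.trans huv
  set κ := (u + 2 * v) / 2 with hκ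
  have uκ : u ≤ κ := by rw [hκ]; linarith
  have vκ : v ≤ κ := by rw [hκ]; linarith
  have s1 : N ^ v ≤ 2 ^ v * (b1 ^ v + d ^ v) := rpow_le_of_le_add p1 hd0 hN hv hN1
  have s2 : d ^ (v - u) ≤ 2 ^ (v - u) * (b3 ^ (v - u) + b2 ^ (v - u)) :=
    rpow_le_of_le_add p3 p2 hd0.le (by linarith) hd1
  have c1 : b1 ^ v * b1 ^ (-v) = 1 := by rw [← Real.rpow_add p1]; simp
  have c2 : b3 ^ u * b3 ^ (-v) = b3 ^ (-(v - u)) := by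
    rw [← Real.rpow_add p3]; ring_nf
  have c3 : d ^ v * d ^ (-u) = d ^ (v - u) := by rw [← Real.rpow_add hd0]; ring_nf
  have c4 : b3 ^ (v - u) * b3 ^ (-(v - u)) = 1 := by rw [← Real.rpow_add p3]; simp
  have c5 : b2 ^ (v - u) * b2 ^ (-v) = b2 ^ (-u) := by rw [← Real.rpow_add p2]; ring_nf
  have m1 : e ^ (-u) * b3 ^ (-(v - u)) ≤ e ^ (-v) + b3 ^ (-v) := by
    have := rpow_mul_rpow_le_add he h3 hu (by linarith : 0 ≤ v - u)
    simpa using this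
  have hq : ∀ x y : ℝ, 1 ≤ x → 1 ≤ y → 0 ≤ x ^ (-κ) * y ^ (-κ) := fun x y hx hy => by
    have : 0 < x := by linarith
    have : 0 < y := by linarith
    positivity
  have q1 := hq d b2 hd h2
  have q2 := hq d b3 hd h3
  have q3 := hq b2 b3 h2 h3
  have q4 := hq d e hd he
  have q5 := hq b2 e h2 he
  have q6 := hq e b1 he h1
  have q7 := hq b1 b2 h1 h2
  have q8 := hq b1 b3 h1 h3
  -- the part where the output frequency is controlled by `n₁`
  have A : e ^ (-u) * b3 ^ (-(v - u)) * (d ^ (-u) * b2 ^ (-v)) ≤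
      2 * pairSum κ d e b1 b2 b3 := by
    have t1 := rpow_three_le hd h2 he uκ vκ vκ (by rw [hκ]; ring : u + v + v = 2 * κ)
    have t2 := rpow_three_le hd h2 h3 uκ vκ vκ (by rw [hκ]; ring : u + v + v = 2 * κ)
    have : e ^ (-u) * b3 ^ (-(v - u)) * (d ^ (-u) * b2 ^ (-v)) ≤
      (e ^ (-v) + b3 ^ (-v)) * (d ^ (-u) * b2 ^ (-v)) := by gcongr
    unfold pairSum
    nlinarith
  -- The other branch: N is controlled by d, which leaves d^(v-u). The bound `B1` treats the share
  -- given to b3, and `B2` the share given to b2.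
  have B1 : e ^ (-u) * (b1 ^ (-v) * b2 ^ (-v)) ≤ pairSum κ d e b1 b2 b3 := by
    have t1 := rpow_three_le he h1 h2 uκ vκ vκ (by rw [hκ]; ring : u + v + v = 2 * κ)
    have e1 : b2 ^ (-κ) * e ^ (-κ) = e ^ (-κ) * b2 ^ (-κ) := mul_comm _ _
    unfold pairSum
    linarith
  have B2 : e ^ (-u) * b3 ^ (-(v - u)) * (b2 ^ (-u) * b1 ^ (-v)) ≤
      2 * pairSum κ d e b1 b2 b3 := by
    have t1 := rpow_three_le h2 h1 he uκ vκ vκ (by rw [hκ]; ring : u + v + v = 2 * κ)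
    have t2 := rpow_three_le h2 h1 h3 uκ vκ vκ (by rw [hκ]; ring : u + v + v = 2 * κ)
    have : e ^ (-u) * b3 ^ (-(v - u)) * (b2 ^ (-u) * b1 ^ (-v)) ≤
      (e ^ (-v) + b3 ^ (-v)) * (b2 ^ (-u) * b1 ^ (-v)) := by gcongr
    have e1 : b2 ^ (-κ) * b1 ^ (-κ) = b1 ^ (-κ) * b2 ^ (-κ) := mul_comm _ _
    have e2 : b1 ^ (-κ) * e ^ (-κ) = e ^ (-κ) * b1 ^ (-κ) := mul_comm _ _
    unfold pairSum
    nlinarith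
  have hP : 0 ≤ pairSum κ d e b1 b2 b3 := by unfold pairSum; linarith
  have hK : 1 ≤ (2 : ℝ) ^ (v - u) := Real.one_le_rpow (by norm_num) (by linarith)
  calc N ^ v * b3 ^ u * (d ^ (-u) * e ^ (-u)) * (b1 ^ (-v) * b2 ^ (-v) * b3 ^ (-v))
      ≤ 2 ^ v * (b1 ^ v + d ^ v) * b3 ^ u * (d ^ (-u) * e ^ (-u)) *
          (b1 ^ (-v) * b2 ^ (-v) * b3 ^ (-v)) := by gcongr
    _ = 2 ^ v * ((b1 ^ v * b1 ^ (-v)) * (e ^ (-u) * (b3 ^ u * b3 ^ (-v)) * (d ^ (-u) * b2 ^ (-v)))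
          + (d ^ v * d ^ (-u)) * (e ^ (-u) * (b3 ^ u * b3 ^ (-v)) * (b1 ^ (-v) * b2 ^ (-v)))) := by
        ring
    _ = 2 ^ v * (e ^ (-u) * b3 ^ (-(v - u)) * (d ^ (-u) * b2 ^ (-v))
          + d ^ (v - u) * (e ^ (-u) * b3 ^ (-(v - u)) * (b1 ^ (-v) * b2 ^ (-v)))) := by
        rw [c1, c2, c3, one_mul]
    _ ≤ 2 ^ v * (e ^ (-u) * b3 ^ (-(v - u)) * (d ^ (-u) * b2 ^ (-v))
          + 2 ^ (v - u) * (b3 ^ (v - u) + b2 ^ (v - u)) *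
            (e ^ (-u) * b3 ^ (-(v - u)) * (b1 ^ (-v) * b2 ^ (-v)))) := by gcongr
    _ = 2 ^ v * (e ^ (-u) * b3 ^ (-(v - u)) * (d ^ (-u) * b2 ^ (-v))
          + 2 ^ (v - u) * ((b3 ^ (v - u) * b3 ^ (-(v - u))) * (e ^ (-u) * (b1 ^ (-v) * b2 ^ (-v)))
            + e ^ (-u) * b3 ^ (-(v - u)) * ((b2 ^ (v - u) * b2 ^ (-v)) * b1 ^ (-v)))) := by ring
    _ = 2 ^ v * (e ^ (-u) * b3 ^ (-(v - u)) * (d ^ (-u) * b2 ^ (-v))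
          + 2 ^ (v - u) * (e ^ (-u) * (b1 ^ (-v) * b2 ^ (-v))
            + e ^ (-u) * b3 ^ (-(v - u)) * (b2 ^ (-u) * b1 ^ (-v)))) := by
        rw [c4, c5, one_mul]
    _ ≤ 2 ^ v * (2 * pairSum κ d e b1 b2 b3
          + 2 ^ (v - u) * (pairSum κ d e b1 b2 b3 + 2 * pairSum κ d e b1 b2 b3)) := by gcongr
    _ ≤ 2 ^ v * (3 * 2 ^ (v - u)) * (3 * pairSum κ d e b1 b2 b3) := by
        have : 0 < (2 : ℝ) ^ v := by positivity
        rw [mul_assoc]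
        gcongr
        nlinarith

/-- The multiplier of the trilinear estimate in `FL^{s,p}`. -/
def triMult (s : ℝ) (n : ℤ) (k : ℤ × ℤ) : ℝ :=
  bracket n ^ s * gain n k *
    (bracket k.1 ^ (-s) * bracket ((k.1 + k.2 - n : ℤ)) ^ (-s) * bracket k.2 ^ (-s))

lemma triMult_nonneg (s : ℝ) (n : ℤ) (k : ℤ × ℤ) : 0 ≤ triMult s n k := by
  have := gain_nonneg n k
  have h (x : ℝ) := Real.rpow_nonneg (bracket_pos x).le
  unfold triMult
  have := h n s
  have := h k.1 (-s)
  have := h ((k.1 + k.2 - n : ℤ)) (-s)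
  have := h k.2 (-s)
  positivity

/-- `1 + |k|`. -/
def brk (k : ℤ) : ℝ := 1 + |(k : ℝ)|

lemma one_le_brk (k : ℤ) : 1 ≤ brk k := by unfold brk; linarith [abs_nonneg (k : ℝ)]

lemma brk_add (k l : ℤ) : brk (k + l) ≤ brk k + brk l := by
  unfold brk; push_cast; linarith [abs_add_le (k : ℝ) l]

lemma brk_sub (k l : ℤ) : brk (k - l) ≤ brk k + brk l := by
  unfold brk; push_cast; linarith [abs_sub (k : ℝ) l]

lemma brk_le_two_abs {k : ℤ} (hk : k ≠ 0) : brk k ≤ 2 * |(k : ℝ)| := by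
  have : (1 : ℝ) ≤ |(k : ℝ)| := by exact_mod_cast Int.one_le_abs hk
  unfold brk; linarith

lemma bracket_rpow_neg_le (k : ℤ) {v : ℝ} (hv : 0 ≤ v) :
    bracket k ^ (-v) ≤ 2 ^ v * brk k ^ (-v) := by
  have h0 : 0 < brk k := zero_lt_one.trans_le (one_le_brk k)
  have h : brk k / 2 ≤ bracket k := by
    have := le_two_bracket (k : ℝ); unfold brk; linarith
  have := Real.rpow_le_rpow_of_nonpos (by positivity) h (by linarith : -v ≤ 0)
  refine this.trans (le_of_eq ?_)
  rw [Real.div_rpow h0.le (by norm_num), Real.rpow_neg (by norm_num : (0 : ℝ) ≤ 2)]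
  field_simp

/-- With a = |k₁ + k₂|, d = |n - k₁|, e = |n - k₂|, the gain is at most a (dea)^{-1/2}, so half a
derivative of a remains, shared between k₁ and k₂. The gain vanishes on the lines k₁ = n, k₂ = n and
k₁ + k₂ = 0; elsewhere a, d and e are nonzero integers, so they are comparable to their brackets. -/
lemma gain_rpow_le {r : ℝ} (hr : 0 ≤ r) (n : ℤ) (k : ℤ × ℤ) (h : k ≠ (n, n)) :
    gain n k ^ (2 * r) ≤ 2 ^ r * (brk k.1 ^ r + brk k.2 ^ r) *
      (2 ^ r * brk (n - k.1) ^ (-r) * (2 ^ r * brk (n - k.2) ^ (-r))) := by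
  obtain ⟨k1, k3⟩ := k
  have q1 : 0 < brk k1 := zero_lt_one.trans_le (one_le_brk _)
  have q2 : 0 < brk k3 := zero_lt_one.trans_le (one_le_brk _)
  have q3 : 0 < brk (n - k1) := zero_lt_one.trans_le (one_le_brk _)
  have q4 : 0 < brk (n - k3) := zero_lt_one.trans_le (one_le_brk _)
  rcases hr.eq_or_lt with rfl | hr0
  · simp
  by_cases hz : gain n (k1, k3) = 0
  · rw [hz, Real.zero_rpow (by positivity)]
    positivity
  have hm : mult n (k1, k3) ≠ 0 := fun h => hz (by simp [gain, h])
  have h1 : k1 ≠ n := by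
    rintro rfl
    have : k3 ≠ k1 := by rintro rfl; exact h rfl
    simp [mult, this] at hm
  have h3 : k3 ≠ n := by
    rintro rfl
    simp [mult, h1] at hm
  have hme : mult n (k1, k3) = (k1 + k3) / 2 := by simp [mult, h1, h3]
  have hs : k1 + k3 ≠ 0 := by
    intro h0
    apply hm
    rw [hme]
    have : (k1 : ℝ) + k3 = 0 := by exact_mod_cast h0
    simp [this]
  set a : ℝ := |((k1 + k3 : ℤ) : ℝ)| with ha
  set d : ℝ := |((n - k1 : ℤ) : ℝ)| with hd
  set e : ℝ := |((n - k3 : ℤ) : ℝ)| with he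
  have ha0 : 1 ≤ a := by rw [ha]; exact_mod_cast Int.one_le_abs hs
  have hd0 : 1 ≤ d := by rw [hd]; exact_mod_cast Int.one_le_abs (sub_ne_zero.2 h1.symm)
  have he0 : 1 ≤ e := by rw [he]; exact_mod_cast Int.one_le_abs (sub_ne_zero.2 h3.symm)
  have hP : d * e * a ≤ bracket (phase n (k1, k3)) := by
    refine le_trans ?_ (abs_le_bracket _)
    have : |((phase n (k1, k3) : ℤ) : ℝ)| = 3 * (d * e * a) := by
      rw [hd, he, ha, phase]; push_cast
      rw [abs_mul, abs_mul, abs_mul]; norm_num; ring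
    rw [this]
    have : 0 ≤ d * e * a := by positivity
    linarith
  have hg : gain n (k1, k3) ≤ a * (d * e * a) ^ (-(1 / 2) : ℝ) := by
    unfold gain
    have : |mult n (k1, k3)| ≤ a := by
      rw [hme, ha]; push_cast; rw [abs_div, abs_two]
      linarith [abs_nonneg ((k1 : ℝ) + k3)]
    have h2 : bracket (phase n (k1, k3)) ^ (-(1 / 2) : ℝ) ≤ (d * e * a) ^ (-(1 / 2) : ℝ) :=
      Real.rpow_le_rpow_of_nonpos (by positivity) hP (by norm_num)
    exact mul_le_mul this h2 (Real.rpow_nonneg (bracket_pos _).le _) (by positivity)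
  calc gain n (k1, k3) ^ (2 * r) ≤ (a * (d * e * a) ^ (-(1 / 2) : ℝ)) ^ (2 * r) :=
        Real.rpow_le_rpow (gain_nonneg _ _) hg (by positivity)
    _ = a ^ r * (d ^ (-r) * e ^ (-r)) := by
        rw [Real.mul_rpow (by positivity) (by positivity), ← Real.rpow_mul (by positivity)]
        have : -(1 / 2) * (2 * r) = -r := by ring
        rw [this, Real.mul_rpow (by positivity) (by positivity),
          Real.mul_rpow (by positivity) (by positivity)]
        have e1 : a ^ (2 * r) * a ^ (-r) = a ^ r := by
          rw [← Real.rpow_add (by positivity)]; ring_nf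
        rw [← e1]; ring
    _ ≤ _ := by
        have i1 : a ^ r ≤ 2 ^ r * (brk k1 ^ r + brk k3 ^ r) := by
          refine rpow_le_of_le_add q1 q2 (by positivity) hr ?_
          refine le_trans ?_ (brk_add k1 k3)
          unfold brk; linarith
        have i2 (m : ℤ) (hm : m ≠ 0) : |(m : ℝ)| ^ (-r) ≤ 2 ^ r * brk m ^ (-r) := by
          have hb := brk_le_two_abs hm
          have hm0 : 0 < brk m := zero_lt_one.trans_le (one_le_brk _)
          have := Real.rpow_le_rpow_of_nonpos (x := brk m / 2) (y := |(m : ℝ)|) (by positivity)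
            (by linarith) (by linarith : -r ≤ 0)
          refine this.trans (le_of_eq ?_)
          rw [Real.div_rpow hm0.le (by norm_num), Real.rpow_neg (by norm_num : (0 : ℝ) ≤ 2)]
          field_simp
        have i3 := i2 (n - k1) (sub_ne_zero.2 h1.symm)
        have i4 := i2 (n - k3) (sub_ne_zero.2 h3.symm)
        gcongr

/-- The constant in the pointwise bound of `triMult`. -/
def triConst (s r : ℝ) : ℝ :=
  2 ^ r * (2 ^ r * 2 ^ r) * (2 ^ (2 * s * r) * 2 ^ (2 * s * r) * 2 ^ (2 * s * r)) *
    (2 ^ (2 * s * r) * (3 * 2 ^ (2 * s * r - r)) * 3)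

/-- Two applications of `high_freq_le` with u = r and v = 2sr, one for each of the two frequencies
that may carry the remaining half derivative; they differ by exchanging k₁ and k₂. The assumption s
≥ 1/2 gives u ≤ v. -/
lemma triMult_rpow_le {s r : ℝ} (hs : 1 / 2 ≤ s) (hr : 0 ≤ r) (n : ℤ) (k : ℤ × ℤ)
    (h : k ≠ (n, n)) :
    triMult s n k ^ (2 * r) ≤ triConst s r *
      (pairSum ((r + 2 * (2 * s * r)) / 2) (brk (n - k.1)) (brk (n - k.2)) (brk k.1)
          (brk (k.1 + k.2 - n)) (brk k.2) +
        pairSum ((r + 2 * (2 * s * r)) / 2) (brk (n - k.2)) (brk (n - k.1)) (brk k.2)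
          (brk (k.1 + k.2 - n)) (brk k.1)) := by
  have hb (m : ℤ) : 0 < brk m := zero_lt_one.trans_le (one_le_brk m)
  have hbr (m : ℤ) := bracket_pos (m : ℝ)
  set v := 2 * s * r with hv
  have hv0 : 0 ≤ v := by positivity
  have huv : r ≤ v := by rw [hv]; nlinarith
  have q (m : ℤ) : (bracket m ^ (-s)) ^ (2 * r) ≤ 2 ^ v * brk m ^ (-v) := by
    rw [← Real.rpow_mul (hbr m).le]
    have : -s * (2 * r) = -v := by rw [hv]; ring
    rw [this]
    exact bracket_rpow_neg_le m hv0
  have qn : (bracket n ^ s) ^ (2 * r) ≤ brk n ^ v := by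
    rw [← Real.rpow_mul (hbr n).le]
    have : s * (2 * r) = v := by rw [hv]; ring
    rw [this]
    exact Real.rpow_le_rpow (hbr n).le (bracket_le n) hv0
  have A := high_freq_le (N := brk n) hr huv (hb n).le (one_le_brk (n - k.1)) (one_le_brk (n - k.2))
    (one_le_brk k.1) (one_le_brk (k.1 + k.2 - n)) (one_le_brk k.2)
    (by simpa using brk_add k.1 (n - k.1))
    (by have := brk_sub k.2 (k.1 + k.2 - n); ring_nf at this ⊢; linarith)
  have B := high_freq_le (N := brk n) hr huv (hb n).le (one_le_brk (n - k.2)) (one_le_brk (n - k.1))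
    (one_le_brk k.2) (one_le_brk (k.1 + k.2 - n)) (one_le_brk k.1)
    (by simpa using brk_add k.2 (n - k.2))
    (by have := brk_sub k.1 (k.1 + k.2 - n); ring_nf at this ⊢; linarith)
  have G := gain_rpow_le hr n k h
  have g0 := gain_nonneg n k
  have hp (m : ℤ) (t : ℝ) : 0 ≤ bracket m ^ t := Real.rpow_nonneg (hbr m).le t
  have hp' (m : ℤ) (t : ℝ) : 0 ≤ brk m ^ t := Real.rpow_nonneg (hb m).le t
  calc triMult s n k ^ (2 * r)
      = (bracket n ^ s) ^ (2 * r) * gain n k ^ (2 * r) * ((bracket k.1 ^ (-s)) ^ (2 * r) *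
        (bracket ((k.1 + k.2 - n : ℤ)) ^ (-s)) ^ (2 * r) * (bracket k.2 ^ (-s)) ^ (2 * r)) := by
        unfold triMult
        rw [Real.mul_rpow (mul_nonneg (hp _ _) g0)
            (mul_nonneg (mul_nonneg (hp _ _) (hp _ _)) (hp _ _)),
          Real.mul_rpow (hp _ _) g0, Real.mul_rpow (mul_nonneg (hp _ _) (hp _ _)) (hp _ _),
          Real.mul_rpow (hp _ _) (hp _ _)]
    _ ≤ brk n ^ v * (2 ^ r * (brk k.1 ^ r + brk k.2 ^ r) *
          (2 ^ r * brk (n - k.1) ^ (-r) * (2 ^ r * brk (n - k.2) ^ (-r)))) *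
        (2 ^ v * brk k.1 ^ (-v) * (2 ^ v * brk (k.1 + k.2 - n) ^ (-v)) *
          (2 ^ v * brk k.2 ^ (-v))) := by
        have w (m : ℤ) : 0 ≤ (bracket m ^ (-s)) ^ (2 * r) := Real.rpow_nonneg (hp m _) _
        have w' (m : ℤ) : 0 ≤ 2 ^ v * brk m ^ (-v) := (w m).trans (q m)
        have G0 : 0 ≤ gain n k ^ (2 * r) := Real.rpow_nonneg g0 _
        exact mul_le_mul (mul_le_mul qn G G0 (hp' n v))
          (mul_le_mul (mul_le_mul (q _) (q _) (w _) (w' _)) (q _) (w _)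
            (mul_nonneg (w' _) (w' _)))
          (mul_nonneg (mul_nonneg (w _) (w _)) (w _)) (mul_nonneg (hp' n v) (G0.trans G))
    _ = 2 ^ r * (2 ^ r * 2 ^ r) * (2 ^ v * 2 ^ v * 2 ^ v) *
        (brk n ^ v * brk k.2 ^ r * (brk (n - k.1) ^ (-r) * brk (n - k.2) ^ (-r)) *
            (brk k.1 ^ (-v) * brk (k.1 + k.2 - n) ^ (-v) * brk k.2 ^ (-v)) +
          brk n ^ v * brk k.1 ^ r * (brk (n - k.2) ^ (-r) * brk (n - k.1) ^ (-r)) *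
            (brk k.2 ^ (-v) * brk (k.1 + k.2 - n) ^ (-v) * brk k.1 ^ (-v))) := by ring
    _ ≤ _ := mul_le_mul_of_nonneg_left (add_le_add A B) (by positivity)
    _ = _ := by unfold triConst; rw [← hv]; ring

/-- The phase is zero at (n, n), so nothing is gained there; the three weights in the denominator
against one in the numerator pay for the derivative because 2s ≥ 1. -/
lemma triMult_resonant_le {s : ℝ} (hs : 1 / 2 ≤ s) (n : ℤ) : triMult s n (n, n) ≤ 1 := by
  have h0 := bracket_pos (n : ℝ)
  have e1 : gain n (n, n) = |(n : ℝ)| := by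
    simp [gain, mult, phase, bracket]
  have : triMult s n (n, n) = |(n : ℝ)| * bracket n ^ (-(2 * s)) := by
    unfold triMult
    rw [e1]
    simp only [add_sub_cancel_right]
    have : bracket n ^ s * (bracket n ^ (-s) * bracket n ^ (-s) * bracket n ^ (-s)) =
        bracket n ^ (-(2 * s)) := by
      rw [← Real.rpow_add h0, ← Real.rpow_add h0, ← Real.rpow_add h0]; ring_nf
    rw [← this]; ring
  rw [this]
  have h2 : bracket n ^ (-(2 * s)) ≤ bracket n ^ (-1 : ℝ) :=
    Real.rpow_le_rpow_of_exponent_le (one_le_bracket _) (by linarith)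
  calc |(n : ℝ)| * bracket n ^ (-(2 * s)) ≤ bracket n * bracket n ^ (-1 : ℝ) := by
        gcongr
        exact abs_le_bracket _
    _ = 1 := by rw [Real.rpow_neg_one]; field_simp

lemma summable_brk_rpow {κ : ℝ} (hκ : 1 < κ) : Summable fun k : ℤ => brk k ^ (-κ) := by
  have h1 : Summable fun n : ℕ => (1 + (n : ℝ)) ^ (-κ) := by
    have := (summable_nat_add_iff 1).2 (Real.summable_nat_rpow.2 (by linarith : -κ < -1))
    refine this.congr fun n => ?_
    push_cast; rw [add_comm]
  apply Summable.of_nat_of_neg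
  · simpa [brk] using h1
  · simpa [brk] using h1

lemma tsum_pair_le {κ : ℝ} {x y : ℤ × ℤ → ℤ}
    (h : Function.Injective fun k => (x k, y k)) :
    ∑' k, ENNReal.ofReal (brk (x k) ^ (-κ) * brk (y k) ^ (-κ)) ≤
      (∑' k, ENNReal.ofReal (brk k ^ (-κ))) ^ 2 := by
  have hb (m : ℤ) : 0 ≤ brk m ^ (-κ) :=
    Real.rpow_nonneg (zero_le_one.trans (one_le_brk m)) _
  calc ∑' k, ENNReal.ofReal (brk (x k) ^ (-κ) * brk (y k) ^ (-κ))
      = ∑' k, (fun l : ℤ × ℤ => ENNReal.ofReal (brk l.1 ^ (-κ)) *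
          ENNReal.ofReal (brk l.2 ^ (-κ))) (x k, y k) := by
        simp_rw [ENNReal.ofReal_mul (hb _)]
    _ ≤ ∑' l : ℤ × ℤ, ENNReal.ofReal (brk l.1 ^ (-κ)) * ENNReal.ofReal (brk l.2 ^ (-κ)) :=
        ENNReal.tsum_comp_le_tsum_of_injective h _
    _ = _ := by
        rw [ENNReal.tsum_prod', sq]
        simp_rw [ENNReal.tsum_mul_left, ENNReal.tsum_mul_right]

/-- Of the ten pairs among the five brackets, the two absent ones, (d, b1) and (e, b3), are in the
application the pairs that depend on a single component of k. The other eight determine k, whence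
the injectivity assumptions. -/
lemma tsum_pairSum_le {κ : ℝ} {d e b1 b2 b3 : ℤ × ℤ → ℤ}
    (h1 : Function.Injective fun k => (d k, b2 k)) (h2 : Function.Injective fun k => (d k, b3 k))
    (h3 : Function.Injective fun k => (b2 k, b3 k)) (h4 : Function.Injective fun k => (d k, e k))
    (h5 : Function.Injective fun k => (b2 k, e k)) (h6 : Function.Injective fun k => (e k, b1 k))
    (h7 : Function.Injective fun k => (b1 k, b2 k))
    (h8 : Function.Injective fun k => (b1 k, b3 k)) :
    ∑' k, ENNReal.ofReal
        (pairSum κ (brk (d k)) (brk (e k)) (brk (b1 k)) (brk (b2 k)) (brk (b3 k))) ≤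
      8 * (∑' k, ENNReal.ofReal (brk k ^ (-κ))) ^ 2 := by
  have hb (m : ℤ) : 0 ≤ brk m ^ (-κ) :=
    Real.rpow_nonneg (zero_le_one.trans (one_le_brk m)) _
  have hbb (m l : ℤ) : 0 ≤ brk m ^ (-κ) * brk l ^ (-κ) := mul_nonneg (hb m) (hb l)
  unfold pairSum
  refine (ENNReal.tsum_le_tsum fun k => ENNReal.ofReal_add_le.trans <| add_le_add_left
    (ENNReal.ofReal_add_le.trans <| add_le_add (ENNReal.ofReal_add_le.trans <|
    add_le_add (ENNReal.ofReal_add_le.trans <| add_le_add_left ENNReal.ofReal_add_le _)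
      ENNReal.ofReal_add_le) ENNReal.ofReal_add_le) _).trans ?_
  simp_rw [ENNReal.tsum_add]
  have := tsum_pair_le (κ := κ) h1
  have := tsum_pair_le (κ := κ) h2
  have := tsum_pair_le (κ := κ) h3
  have := tsum_pair_le (κ := κ) h4
  have := tsum_pair_le (κ := κ) h5
  have := tsum_pair_le (κ := κ) h6
  have := tsum_pair_le (κ := κ) h7
  have := tsum_pair_le (κ := κ) h8
  set S := (∑' k, ENNReal.ofReal (brk k ^ (-κ))) ^ 2 with hS
  calc _ ≤ S + S + S + (S + S) + (S + S) + S := by gcongr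
    _ = _ := by ring

/-- The counting estimate: the multiplier is in `ℓ^{2r}` uniformly in the output frequency. -/
theorem tsum_triMult_rpow_le {s r : ℝ} (hs : 1 / 2 ≤ s) (hr : 0 ≤ r) (hsr : 2 < (1 + 4 * s) * r) :
    ∃ C : ℝ≥0, ∀ n, ∑' k, ENNReal.ofReal (triMult s n k ^ (2 * r)) ≤ C := by
  set κ := (r + 2 * (2 * s * r)) / 2 with hκ
  have hκ1 : 1 < κ := by rw [hκ]; linarith
  set S := ∑' k, ENNReal.ofReal (brk k ^ (-κ)) with hS
  have hSf : S ≠ ∞ := by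
    rw [hS]
    exact (summable_brk_rpow hκ1).tsum_ofReal_ne_top
  have hT : 0 ≤ triConst s r := by unfold triConst; positivity
  have hfin : 1 + ENNReal.ofReal (triConst s r) * (8 * S ^ 2 + 8 * S ^ 2) ≠ ∞ := by
    finiteness
  refine ⟨(1 + ENNReal.ofReal (triConst s r) * (8 * S ^ 2 + 8 * S ^ 2)).toNNReal, fun n => ?_⟩
  rw [ENNReal.coe_toNNReal hfin]
  -- The resonant point is separated and costs at most 1; all other pairs fall under the two pair
  -- sums.
  have hpt (k : ℤ × ℤ) : ENNReal.ofReal (triMult s n k ^ (2 * r)) ≤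
      (if k = (n, n) then 1 else 0) + ENNReal.ofReal (triConst s r) *
      (ENNReal.ofReal (pairSum κ (brk (n - k.1)) (brk (n - k.2)) (brk k.1)
          (brk (k.1 + k.2 - n)) (brk k.2)) +
        ENNReal.ofReal (pairSum κ (brk (n - k.2)) (brk (n - k.1)) (brk k.2)
          (brk (k.1 + k.2 - n)) (brk k.1))) := by
    by_cases h : k = (n, n)
    · rw [if_pos h, h]
      refine le_trans ?_ le_self_add
      rw [ENNReal.ofReal_le_one]
      exact Real.rpow_le_one (triMult_nonneg _ _ _) (triMult_resonant_le hs n) (by positivity)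
    · rw [if_neg h, zero_add]
      refine (ENNReal.ofReal_le_ofReal (triMult_rpow_le hs hr n k h)).trans ?_
      rw [ENNReal.ofReal_mul hT]
      gcongr
      exact ENNReal.ofReal_add_le
  refine (ENNReal.tsum_le_tsum hpt).trans ?_
  rw [ENNReal.tsum_add, ENNReal.tsum_mul_left, ENNReal.tsum_add, tsum_ite_eq]
  gcongr
  all_goals
    apply tsum_pairSum_le <;>
    · rintro ⟨a, b⟩ ⟨c, d⟩ h
      simp only [Prod.mk.injEq] at h ⊢
      omega

/-! ### Weighted ℓ^p norms and the trilinear estimate -/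

section

/-- The weight `⟨n⟩^s` in `[0, ∞]`. -/
def wt (s : ℝ) (n : ℤ) : ℝ≥0∞ := ENNReal.ofReal (bracket n ^ s)

lemma wt_ne_top (s : ℝ) (n : ℤ) : wt s n ≠ ∞ := ENNReal.ofReal_ne_top

lemma wt_mul_wt_neg (s : ℝ) (n : ℤ) : wt s n * wt (-s) n = 1 := by
  unfold wt
  rw [← ENNReal.ofReal_mul (Real.rpow_nonneg (bracket_pos n).le _),
    ← Real.rpow_add (bracket_pos n)]
  simp

/-- The weighted norm `‖⟨n⟩^s x_n‖_{ℓ^p}`. -/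
def wl (s p : ℝ) (x : ℤ → ℝ≥0∞) : ℝ≥0∞ := (∑' n, (wt s n * x n) ^ p) ^ (1 / p)

variable {s p : ℝ}

lemma wl_mono (hp : 1 ≤ p) {x y : ℤ → ℝ≥0∞} (h : ∀ n, x n ≤ y n) : wl s p x ≤ wl s p y := by
  unfold wl
  gcongr with n
  exact h n

lemma le_wl (hp : 1 ≤ p) (x : ℤ → ℝ≥0∞) (n : ℤ) : wt s n * x n ≤ wl s p x := by
  unfold wl
  rw [one_div, ENNReal.le_rpow_inv_iff (by linarith)]
  exact ENNReal.le_tsum n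

/-- Read with a finite right side, this turns finiteness of the norm of a sequence into finiteness
of every term. -/
lemma le_wl' (hp : 1 ≤ p) (x : ℤ → ℝ≥0∞) (n : ℤ) : x n ≤ wt (-s) n * wl s p x := by
  calc x n = wt (-s) n * (wt s n * x n) := by
        rw [← mul_assoc, mul_comm (wt (-s) n), wt_mul_wt_neg, one_mul]
    _ ≤ _ := by gcongr; exact le_wl hp x n

lemma lt_top_of_wl (hp : 1 ≤ p) {x : ℤ → ℝ≥0∞} (h : wl s p x < ∞) (n : ℤ) : x n < ∞ :=
  (le_wl' hp x n).trans_lt (ENNReal.mul_lt_top (wt_ne_top _ _).lt_top h)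

lemma eq_zero_of_wl (hp : 1 ≤ p) {x : ℤ → ℝ≥0∞} (h : wl s p x = 0) (n : ℤ) : x n = 0 := by
  have := le_wl' (s := s) hp x n
  simpa [h] using this

lemma wl_const_mul (hp : 1 ≤ p) (c : ℝ≥0∞) (x : ℤ → ℝ≥0∞) :
    wl s p (fun n => c * x n) = c * wl s p x := by
  unfold wl
  have (n : ℤ) : (wt s n * (c * x n)) ^ p = c ^ p * (wt s n * x n) ^ p := by
    rw [← ENNReal.mul_rpow_of_nonneg _ _ (by linarith)]; ring_nf
  simp_rw [this, ENNReal.tsum_mul_left]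
  rw [ENNReal.mul_rpow_of_nonneg _ _ (by positivity), ← ENNReal.rpow_mul,
    mul_one_div_cancel (by linarith), ENNReal.rpow_one]

lemma wl_add_le (hp : 1 ≤ p) (x y : ℤ → ℝ≥0∞) :
    wl s p (fun n => x n + y n) ≤ wl s p x + wl s p y := by
  have := ENNReal.lintegral_Lp_add_le (μ := Measure.count) (f := fun n : ℤ => wt s n * x n)
    (g := fun n => wt s n * y n) (measurable_of_countable _).aemeasurable
    (measurable_of_countable _).aemeasurable hp
  simpa [wl, lintegral_count, mul_add] using this

lemma wl_sum_le (hp : 1 ≤ p) (x : ℕ → ℤ → ℝ≥0∞) (J : ℕ) :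
    wl s p (fun n => ∑ j ∈ Finset.range J, x j n) ≤ ∑ j ∈ Finset.range J, wl s p (x j) := by
  induction J with
  | zero =>
    have : 0 < p := by linarith
    simp [wl, this]
  | succ J ih =>
    simp_rw [Finset.sum_range_succ]
    refine (wl_add_le hp _ _).trans ?_
    gcongr

/-- Countable Minkowski: the finite inequality passes to the limit on each finite set of
frequencies, then a supremum over these sets is taken. -/
lemma wl_tsum_le (hp : 1 ≤ p) (x : ℕ → ℤ → ℝ≥0∞) :
    wl s p (fun n => ∑' j, x j n) ≤ ∑' j, wl s p (x j) := by
  have hp0 : 0 < p := by linarith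
  rw [wl, one_div, ENNReal.rpow_inv_le_iff hp0, ENNReal.tsum_eq_iSup_sum]
  refine iSup_le fun S => ?_
  have h1 : Tendsto (fun J : ℕ => ∑ n ∈ S, (wt s n * ∑ j ∈ Finset.range J, x j n) ^ p) atTop
      (𝓝 (∑ n ∈ S, (wt s n * ∑' j, x j n) ^ p)) := by
    refine tendsto_finsetSum _ fun n _ => ?_
    refine ((ENNReal.continuous_rpow_const (y := p)).tendsto _).comp ?_
    exact ENNReal.Tendsto.const_mul (ENNReal.tendsto_nat_tsum _) (Or.inr (wt_ne_top s n))
  refine le_of_tendsto' h1 fun J => ?_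
  calc ∑ n ∈ S, (wt s n * ∑ j ∈ Finset.range J, x j n) ^ p
      ≤ ∑' n, (wt s n * ∑ j ∈ Finset.range J, x j n) ^ p := ENNReal.sum_le_tsum S
    _ = (wl s p (fun n => ∑ j ∈ Finset.range J, x j n)) ^ p := by
        rw [wl, ← ENNReal.rpow_mul, one_div_mul_cancel hp0.ne', ENNReal.rpow_one]
    _ ≤ _ := by
        gcongr
        exact (wl_sum_le hp x J).trans (ENNReal.sum_le_tsum _)

/-- Hölder's inequality. The case p = 1 has its own hypothesis, a uniform bound, because p / (p - 1)
is 0 and not ∞ there. -/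
lemma tsum_mul_rpow_le {ι : Type*} [Countable ι] (hp : 1 ≤ p) {K : ℝ≥0∞} {f g : ι → ℝ≥0∞}
    (h1 : p = 1 → ∀ i, f i ≤ K)
    (h2 : 1 < p → ∑' i, f i ^ (p / (p - 1)) ≤ K ^ (p / (p - 1))) :
    (∑' i, f i * g i) ^ p ≤ K ^ p * ∑' i, g i ^ p := by
  rcases hp.eq_or_lt with rfl | hp1
  · simp only [ENNReal.rpow_one]
    rw [← ENNReal.tsum_mul_left]
    gcongr with i
    exact h1 rfl i
  · let _ : MeasurableSpace ι := ⊤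
    have hpq : (p / (p - 1)).HolderConjugate p :=
      (Real.HolderConjugate.conjExponent hp1).symm
    have := ENNReal.lintegral_mul_le_Lp_mul_Lq (Measure.count : Measure ι) hpq
      (f := f) (g := g) (measurable_of_countable _).aemeasurable
      (measurable_of_countable _).aemeasurable
    simp only [Pi.mul_apply, lintegral_count] at this
    have hp0 : 0 < p := by linarith
    have hq0 : 0 < p / (p - 1) := hpq.pos
    calc (∑' i, f i * g i) ^ p
        ≤ ((∑' i, f i ^ (p / (p - 1))) ^ (1 / (p / (p - 1))) * (∑' i, g i ^ p) ^ (1 / p)) ^ p := by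
          gcongr
      _ ≤ ((K ^ (p / (p - 1))) ^ (1 / (p / (p - 1))) * (∑' i, g i ^ p) ^ (1 / p)) ^ p := by
          gcongr
          exact h2 hp1
      _ = _ := by
          rw [← ENNReal.rpow_mul, mul_one_div_cancel hq0.ne', ENNReal.rpow_one,
            ENNReal.mul_rpow_of_nonneg _ _ hp0.le, ← ENNReal.rpow_mul (∑' i, g i ^ p),
            one_div_mul_cancel hp0.ne', ENNReal.rpow_one]

/-- The sum over the triples of frequencies with the gain of the time integration. -/
def triSum (x y z : ℤ → ℝ≥0∞) (n : ℤ) : ℝ≥0∞ :=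
  ∑' k : ℤ × ℤ, ENNReal.ofReal (gain n k) * (x k.1 * y (k.1 + k.2 - n) * z k.2)

/-- For fixed k the map n ↦ k₁ + k₂ - n is a bijection of ℤ, so summing over n first frees the
middle factor. This is the ℓ¹ convolution identity that closes the Hölder argument for the p-th
powers. -/
lemma tsum_triple (x y z : ℤ → ℝ≥0∞) :
    ∑' n, ∑' k : ℤ × ℤ, x k.1 * y (k.1 + k.2 - n) * z k.2 =
      (∑' n, x n) * (∑' n, y n) * ∑' n, z n := by
  rw [ENNReal.tsum_comm]
  have (k : ℤ × ℤ) : ∑' n, x k.1 * y (k.1 + k.2 - n) * z k.2 = x k.1 * (∑' n, y n) * z k.2 := by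
    rw [ENNReal.tsum_mul_right, ENNReal.tsum_mul_left]
    congr 2
    exact (Equiv.subLeft (k.1 + k.2)).tsum_eq y
  simp_rw [this]
  rw [ENNReal.tsum_prod']
  simp_rw [ENNReal.tsum_mul_left, ENNReal.tsum_mul_right]

lemma exists_triMult_bound (hs : 1 / 2 ≤ s) (hp : 1 ≤ p) (hsp : 3 / 4 - s < 1 / p) :
    ∃ K : ℝ≥0, (p = 1 → ∀ n k, ENNReal.ofReal (triMult s n k) ≤ K) ∧
      (1 < p → ∀ n, ∑' k, ENNReal.ofReal (triMult s n k) ^ (p / (p - 1)) ≤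
        (K : ℝ≥0∞) ^ (p / (p - 1))) := by
  rcases hp.eq_or_lt with rfl | hp1
  · obtain ⟨C, hC⟩ := tsum_triMult_rpow_le (r := 2) hs (by norm_num) (by linarith)
    refine ⟨C ^ (1 / 4 : ℝ), fun _ n k => ?_, fun h => absurd h (lt_irrefl _)⟩
    rw [ENNReal.coe_rpow_of_nonneg _ (by norm_num), one_div, ENNReal.le_rpow_inv_iff (by norm_num)]
    refine le_trans ?_ (hC n)
    refine le_trans ?_ (ENNReal.le_tsum k)
    rw [ENNReal.ofReal_rpow_of_nonneg (triMult_nonneg _ _ _) (by norm_num)]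
    norm_num
  · have hp0 : 0 < p - 1 := by linarith
    have hq : 0 < p / (p - 1) := by positivity
    -- With 2r = p/(p - 1), the counting condition 2 < (1 + 4s) r reads p (3 - 4s) < 4, that is 3/4
    -- - s < 1/p.
    obtain ⟨C, hC⟩ := tsum_triMult_rpow_le (r := p / (p - 1) / 2) hs (by positivity) (by
      rw [lt_div_iff₀ (by linarith)] at hsp
      rw [← mul_div_assoc, ← mul_div_assoc, lt_div_iff₀ (by norm_num), lt_div_iff₀ hp0]
      nlinarith)
    refine ⟨C ^ (1 / (p / (p - 1))), fun h => by linarith, fun _ n => ?_⟩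
    rw [ENNReal.coe_rpow_of_nonneg _ (by positivity), ← ENNReal.rpow_mul,
      one_div_mul_cancel hq.ne', ENNReal.rpow_one]
    refine le_trans (le_of_eq ?_) (hC n)
    refine tsum_congr fun k => ?_
    rw [ENNReal.ofReal_rpow_of_nonneg (triMult_nonneg _ _ _) hq.le]
    congr 2
    ring

/-- The trilinear estimate in the weighted sequence space. -/
theorem wl_triSum_le (hs : 1 / 2 ≤ s) (hp : 1 ≤ p) (hsp : 3 / 4 - s < 1 / p) :
    ∃ K : ℝ≥0, ∀ x y z : ℤ → ℝ≥0∞,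
      wl s p (triSum x y z) ≤ K * (wl s p x * wl s p y * wl s p z) := by
  obtain ⟨K, hK1, hK2⟩ := exists_triMult_bound hs hp hsp
  have hp0 : 0 < p := by linarith
  refine ⟨K, fun x y z => ?_⟩
  have key (n : ℤ) : wt s n * triSum x y z n = ∑' k : ℤ × ℤ, ENNReal.ofReal (triMult s n k) *
      (wt s k.1 * x k.1 * (wt s (k.1 + k.2 - n) * y (k.1 + k.2 - n)) * (wt s k.2 * z k.2)) := by
    rw [triSum, ← ENNReal.tsum_mul_left]
    refine tsum_congr fun k => ?_
    have : ENNReal.ofReal (triMult s n k) = wt s n * ENNReal.ofReal (gain n k) *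
        (wt (-s) k.1 * wt (-s) (k.1 + k.2 - n) * wt (-s) k.2) := by
      have h (x : ℝ) (t : ℝ) := Real.rpow_nonneg (bracket_pos x).le t
      unfold triMult wt
      rw [ENNReal.ofReal_mul (mul_nonneg (h _ _) (gain_nonneg _ _)), ENNReal.ofReal_mul (h _ _),
        ENNReal.ofReal_mul (mul_nonneg (h _ _) (h _ _)), ENNReal.ofReal_mul (h _ _)]
    rw [this]
    calc _ = wt s n * ENNReal.ofReal (gain n k) * ((wt s k.1 * wt (-s) k.1) *
          (wt s (k.1 + k.2 - n) * wt (-s) (k.1 + k.2 - n)) * (wt s k.2 * wt (-s) k.2)) *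
          (x k.1 * y (k.1 + k.2 - n) * z k.2) := by simp only [wt_mul_wt_neg]; ring
      _ = _ := by ring
  rw [wl, one_div, ENNReal.rpow_inv_le_iff hp0]
  simp_rw [key]
  calc _ ≤ ∑' n, (K : ℝ≥0∞) ^ p * ∑' k : ℤ × ℤ, (wt s k.1 * x k.1 *
          (wt s (k.1 + k.2 - n) * y (k.1 + k.2 - n)) * (wt s k.2 * z k.2)) ^ p :=
        ENNReal.tsum_le_tsum fun n =>
          tsum_mul_rpow_le hp (fun h i => hK1 h n i) (fun h => hK2 h n)
    _ = (K : ℝ≥0∞) ^ p * ((∑' n, (wt s n * x n) ^ p) * (∑' n, (wt s n * y n) ^ p) *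
          ∑' n, (wt s n * z n) ^ p) := by
        rw [ENNReal.tsum_mul_left, ← tsum_triple]
        simp_rw [ENNReal.mul_rpow_of_nonneg _ _ hp0.le]
    _ = _ := by
        simp only [wl]
        rw [ENNReal.mul_rpow_of_nonneg _ _ hp0.le, ENNReal.mul_rpow_of_nonneg _ _ hp0.le,
          ENNReal.mul_rpow_of_nonneg _ _ hp0.le]
        simp only [← ENNReal.rpow_mul, one_div_mul_cancel hp0.ne', ENNReal.rpow_one]

end

/-! ### The time space L^∞ ∩ B^{1/2}_{2,∞} -/

section

/-- The increment `f(t + h) - f(t)`. -/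
def incr (h : ℝ) (f : ℝ → ℂ) (t : ℝ) : ℂ := f (t + h) - f t

/-- The uniform norm. -/
def supNorm (f : ℝ → ℂ) : ℝ≥0∞ := ⨆ t, ‖f t‖ₑ

/-- The seminorm of the Besov space `B^{1/2}_{2,∞}(ℝ)`. -/
def besov (f : ℝ → ℂ) : ℝ≥0∞ :=
  ⨆ (h : ℝ) (_ : 0 < h), eLpNorm (incr h f) 2 volume / ENNReal.ofReal (√h)

/-- The norm of `L^∞ ∩ B^{1/2}_{2,∞}`. -/
def timeNorm (f : ℝ → ℂ) : ℝ≥0∞ := supNorm f + besov f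

variable {f g : ℝ → ℂ}

lemma enorm_le_supNorm (f : ℝ → ℂ) (t : ℝ) : ‖f t‖ₑ ≤ supNorm f := le_iSup (fun t => ‖f t‖ₑ) t

lemma supNorm_le_timeNorm (f : ℝ → ℂ) : supNorm f ≤ timeNorm f := le_self_add

lemma besov_le_timeNorm (f : ℝ → ℂ) : besov f ≤ timeNorm f := le_add_self

lemma enorm_le_timeNorm (f : ℝ → ℂ) (t : ℝ) : ‖f t‖ₑ ≤ timeNorm f :=
  (enorm_le_supNorm f t).trans (supNorm_le_timeNorm f)

lemma eLpNorm_incr_le (f : ℝ → ℂ) {h : ℝ} (hh : 0 < h) :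
    eLpNorm (incr h f) 2 volume ≤ ENNReal.ofReal (√h) * besov f := by
  have h0 : ENNReal.ofReal (√h) ≠ 0 := by simpa using hh
  rw [mul_comm, ← ENNReal.div_le_iff h0 ENNReal.ofReal_ne_top]
  exact le_iSup₂ (f := fun (h : ℝ) (_ : 0 < h) =>
    eLpNorm (incr h f) 2 volume / ENNReal.ofReal (√h)) h hh

lemma besov_le {K : ℝ≥0∞}
    (H : ∀ h, 0 < h → eLpNorm (incr h f) 2 volume ≤ ENNReal.ofReal (√h) * K) : besov f ≤ K := by
  refine iSup₂_le fun h hh => ?_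
  have h0 : ENNReal.ofReal (√h) ≠ 0 := by simpa using hh
  rw [ENNReal.div_le_iff h0 ENNReal.ofReal_ne_top, mul_comm]
  exact H h hh

lemma measurable_incr (hf : Measurable f) (h : ℝ) : Measurable (incr h f) :=
  (hf.comp (measurable_id.add_const h)).sub hf

lemma aesm_incr (hf : Measurable f) (h : ℝ) : AEStronglyMeasurable (incr h f) volume :=
  (measurable_incr hf h).aestronglyMeasurable

lemma supNorm_add_le (f g : ℝ → ℂ) : supNorm (f + g) ≤ supNorm f + supNorm g :=
  iSup_le fun t => (enorm_add_le _ _).trans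
    (add_le_add (enorm_le_supNorm f t) (enorm_le_supNorm g t))

lemma besov_add_le (hf : Measurable f) (hg : Measurable g) :
    besov (f + g) ≤ besov f + besov g := by
  refine besov_le fun h hh => ?_
  have : incr h (f + g) = incr h f + incr h g := by
    ext t; simp only [incr, Pi.add_apply]; ring
  rw [this, mul_add]
  exact (eLpNorm_add_le (aesm_incr hf h) (aesm_incr hg h) (by norm_num)).trans
    (add_le_add (eLpNorm_incr_le f hh) (eLpNorm_incr_le g hh))

lemma timeNorm_add_le (hf : Measurable f) (hg : Measurable g) :
    timeNorm (f + g) ≤ timeNorm f + timeNorm g := by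
  calc _ ≤ (supNorm f + supNorm g) + (besov f + besov g) :=
        add_le_add (supNorm_add_le f g) (besov_add_le hf hg)
    _ = _ := by unfold timeNorm; ring

lemma supNorm_const_mul_le (c : ℂ) (f : ℝ → ℂ) :
    supNorm (fun t => c * f t) ≤ ‖c‖ₑ * supNorm f :=
  iSup_le fun t => by
    rw [enorm_mul]
    gcongr
    exact enorm_le_supNorm f t

lemma besov_const_mul_le (c : ℂ) (f : ℝ → ℂ) :
    besov (fun t => c * f t) ≤ ‖c‖ₑ * besov f := by
  refine besov_le fun h hh => ?_
  have : incr h (fun t => c * f t) = c • incr h f := by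
    ext t; simp only [incr, Pi.smul_apply, smul_eq_mul]; ring
  rw [this, eLpNorm_const_smul, mul_left_comm]
  gcongr
  exact eLpNorm_incr_le f hh

lemma timeNorm_const_mul_le (c : ℂ) (f : ℝ → ℂ) :
    timeNorm (fun t => c * f t) ≤ ‖c‖ₑ * timeNorm f := by
  unfold timeNorm
  rw [mul_add]
  exact add_le_add (supNorm_const_mul_le c f) (besov_const_mul_le c f)

lemma timeNorm_neg (f : ℝ → ℂ) : timeNorm (-f) ≤ timeNorm f := by
  have := timeNorm_const_mul_le (-1) f
  simpa [← Pi.neg_def] using this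

lemma timeNorm_sub_le (hf : Measurable f) (hg : Measurable g) :
    timeNorm (f - g) ≤ timeNorm f + timeNorm g := by
  rw [sub_eq_add_neg]
  exact (timeNorm_add_le hf hg.neg).trans (by gcongr; exact timeNorm_neg g)

lemma timeNorm_conj (f : ℝ → ℂ) : timeNorm (fun t => (starRingEnd ℂ) (f t)) = timeNorm f := by
  have h1 : supNorm (fun t => (starRingEnd ℂ) (f t)) = supNorm f := by
    unfold supNorm
    congr with t
    rw [← ofReal_norm, ← ofReal_norm, RCLike.norm_conj]
  have h2 : besov (fun t => (starRingEnd ℂ) (f t)) = besov f := by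
    unfold besov
    congr with h
    congr with hh
    congr 1
    refine eLpNorm_congr_norm_ae (ae_of_all _ fun t => ?_)
    rw [incr, incr, ← map_sub, RCLike.norm_conj]
  rw [timeNorm, timeNorm, h1, h2]

lemma eLpNorm_two_sq (f : ℝ → ℂ) (μ : Measure ℝ) :
    eLpNorm f 2 μ ^ 2 = ∫⁻ t, ‖f t‖ₑ ^ 2 ∂μ := by
  rw [eLpNorm_eq_lintegral_rpow_enorm_toReal (by norm_num) (by norm_num)]
  rw [← ENNReal.rpow_natCast, ← ENNReal.rpow_mul]
  norm_num

lemma eLpNorm_two_le_iff {f : ℝ → ℂ} {μ : Measure ℝ} {K : ℝ≥0∞} :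
    eLpNorm f 2 μ ≤ K ↔ ∫⁻ t, ‖f t‖ₑ ^ 2 ∂μ ≤ K ^ 2 := by
  rw [← eLpNorm_two_sq]
  exact (ENNReal.pow_le_pow_left_iff (by norm_num)).symm

lemma ofReal_sqrt_sq {x : ℝ} (hx : 0 ≤ x) : ENNReal.ofReal (√x) ^ 2 = ENNReal.ofReal x := by
  rw [← ENNReal.ofReal_pow (Real.sqrt_nonneg x), Real.sq_sqrt hx]

lemma eLpNorm_two_le_of_support {S : Set ℝ} (hS : MeasurableSet S) {m : ℝ} (hm : 0 ≤ m)
    (hv : volume S ≤ ENNReal.ofReal m) {K : ℝ≥0∞} (hK : ∀ t ∈ S, ‖f t‖ₑ ≤ K)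
    (h0 : ∀ t ∉ S, f t = 0) : eLpNorm f 2 volume ≤ ENNReal.ofReal (√m) * K := by
  rw [eLpNorm_two_le_iff, mul_pow, ofReal_sqrt_sq hm]
  calc ∫⁻ t, ‖f t‖ₑ ^ 2 ≤ ∫⁻ t, S.indicator (fun _ => K ^ 2) t := by
        refine lintegral_mono fun t => ?_
        by_cases h : t ∈ S
        · rw [Set.indicator_of_mem h]
          gcongr
          exact hK t h
        · simp [h0 t h, h]
    _ = K ^ 2 * volume S := by rw [lintegral_indicator hS, setLIntegral_const]
    _ ≤ _ := by rw [mul_comm]; gcongr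

/-- Increments with both endpoints in [c, d] are bounded by hypothesis. Increments that cross an
endpoint live on two intervals of length h and are bounded by the supremum, which gives √h again: a
jump is harmless in B^{1/2}_{2,∞}. -/
lemma besov_le_of_support {c d : ℝ} (hf : Measurable f) (h0 : ∀ t ∉ Set.Icc c d, f t = 0)
    {K : ℝ≥0∞}
    (H : ∀ h, 0 < h → eLpNorm ({t | t ∈ Set.Icc c d ∧ t + h ∈ Set.Icc c d}.indicator (incr h f))
      2 volume ≤ ENNReal.ofReal (√h) * K) : besov f ≤ K + 2 * supNorm f := by
  refine besov_le fun h hh => ?_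
  set A : Set ℝ := {t | t ∈ Set.Icc c d ∧ t + h ∈ Set.Icc c d} with hA
  have hAm : MeasurableSet A := by
    refine measurableSet_Icc.inter ?_
    exact measurableSet_Icc.preimage (measurable_id.add_const h)
  set S : Set ℝ := Set.Icc (c - h) c ∪ Set.Icc (d - h) d with hS
  have hSm : MeasurableSet S := measurableSet_Icc.union measurableSet_Icc
  -- The measure is at most 2h; the bound 4h is used so that its square root is 2√h.
  have hSv : volume S ≤ ENNReal.ofReal (4 * h) := by
    refine (measure_union_le _ _).trans ?_
    rw [Real.volume_Icc, Real.volume_Icc, ← ENNReal.ofReal_add (by linarith) (by linarith)]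
    exact ENNReal.ofReal_le_ofReal (by linarith)
  have e : incr h f = A.indicator (incr h f) + Aᶜ.indicator (incr h f) :=
    (Set.indicator_self_add_compl A _).symm
  have hB : eLpNorm (Aᶜ.indicator (incr h f)) 2 volume ≤
      ENNReal.ofReal (√(4 * h)) * supNorm f := by
    refine eLpNorm_two_le_of_support hSm (by positivity) hSv (fun t _ => ?_) fun t ht => ?_
    · by_cases h1 : t ∈ Aᶜ
      · rw [Set.indicator_of_mem h1, incr]
        by_cases h2 : t ∈ Set.Icc c d
        · have h3 : t + h ∉ Set.Icc c d := fun h3 => h1 ⟨h2, h3⟩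
          rw [h0 _ h3, zero_sub, enorm_neg]
          exact enorm_le_supNorm f t
        · rw [h0 _ h2, sub_zero]
          exact enorm_le_supNorm f _
      · simp [h1]
    · by_cases h1 : t ∈ Aᶜ
      · rw [Set.indicator_of_mem h1, incr]
        have : t ∉ Set.Icc c d ∧ t + h ∉ Set.Icc c d := by
          simp only [hS, hA, Set.mem_union, Set.mem_Icc, Set.mem_compl_iff, Set.mem_ofPred_eq,
            not_and_or, not_or, not_le] at ht h1 ⊢
          grind
        rw [h0 _ this.1, h0 _ this.2, sub_zero]
      · simp [h1]
  have h4 : ENNReal.ofReal (√(4 * h)) = ENNReal.ofReal (√h) * 2 := by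
    rw [Real.sqrt_mul (by norm_num), mul_comm, ENNReal.ofReal_mul (Real.sqrt_nonneg h)]
    congr 1
    have : √4 = 2 := by rw [show (4 : ℝ) = 2 ^ 2 by norm_num]; simp
    rw [this]; simp
  rw [e]
  refine (eLpNorm_add_le ((aesm_incr hf h).indicator hAm) ((aesm_incr hf h).indicator hAm.compl)
    (by norm_num)).trans ?_
  rw [mul_add, ← mul_assoc, ← h4]
  exact add_le_add (H h hh) hB

lemma eLpNorm_mono_enorm {f g : ℝ → ℂ} (h : ∀ t, ‖f t‖ₑ ≤ ‖g t‖ₑ) (μ : Measure ℝ) :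
    eLpNorm f 2 μ ≤ eLpNorm g 2 μ :=
  eLpNorm_mono_enorm_ae (ae_of_all _ h)

lemma supNorm_indicator_le (S : Set ℝ) (f : ℝ → ℂ) : supNorm (S.indicator f) ≤ supNorm f :=
  iSup_le fun t => (enorm_indicator_le_enorm_self f t).trans (enorm_le_supNorm f t)

/-- This is the reason for the exponent ∞ in the Besov norm: sharp cut-offs are bounded, so no
smooth truncation in time is needed anywhere in the argument. -/
lemma timeNorm_indicator_le (hf : Measurable f) (c d : ℝ) :
    timeNorm ((Set.Icc c d).indicator f) ≤ 3 * timeNorm f := by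
  have h1 : besov ((Set.Icc c d).indicator f) ≤ besov f + 2 * supNorm f := by
    refine (besov_le_of_support (c := c) (d := d) (hf.indicator measurableSet_Icc)
      (fun t ht => by simp [ht]) (K := besov f) fun h hh => ?_).trans ?_
    · refine le_trans (eLpNorm_mono_enorm (fun t => ?_) _) (eLpNorm_incr_le f hh)
      by_cases ht : t ∈ {t | t ∈ Set.Icc c d ∧ t + h ∈ Set.Icc c d}
      · rw [Set.indicator_of_mem ht, incr, incr, Set.indicator_of_mem ht.1,
          Set.indicator_of_mem ht.2]
      · rw [Set.indicator_of_notMem ht]; simp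
    · gcongr
      exact supNorm_indicator_le _ f
  calc timeNorm ((Set.Icc c d).indicator f) ≤ supNorm f + (besov f + 2 * supNorm f) :=
        add_le_add (supNorm_indicator_le _ f) h1
    _ ≤ 3 * supNorm f + 3 * besov f := by
        have : besov f ≤ 3 * besov f := by
          nth_rewrite 1 [← one_mul (besov f)]
          gcongr
          norm_num
        calc _ = 3 * supNorm f + besov f := by ring
          _ ≤ _ := by gcongr
    _ = _ := by unfold timeNorm; ring

lemma timeNorm_const_indicator_le (a : ℂ) (c d : ℝ) :
    timeNorm ((Set.Icc c d).indicator fun _ => a) ≤ 3 * ‖a‖ₑ := by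
  refine (timeNorm_indicator_le measurable_const c d).trans ?_
  gcongr
  have h1 : supNorm (fun _ => a) ≤ ‖a‖ₑ := iSup_le fun t => le_rfl
  have h2 : besov (fun _ => a) ≤ 0 := besov_le fun h hh => by
    have : incr h (fun _ => a) = 0 := by ext; simp [incr]
    rw [this]; simp
  calc timeNorm (fun _ => a) ≤ ‖a‖ₑ + 0 := add_le_add h1 h2
    _ = _ := add_zero _

lemma eLpNorm_mul_le_supNorm (f : ℝ → ℂ) {g F : ℝ → ℂ} (hf : supNorm f ≠ ∞)
    (hF : ∀ t, ‖F t‖ₑ ≤ supNorm f * ‖g t‖ₑ) :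
    eLpNorm F 2 volume ≤ supNorm f * eLpNorm g 2 volume := by
  lift supNorm f to ℝ≥0 using hf with c hc
  have := eLpNorm_le_nnreal_smul_eLpNorm_of_ae_le_mul (μ := volume) (f := F) (g := g) (c := c)
    (ae_of_all _ fun t => by
      have := hF t
      simpa [enorm, ← ENNReal.coe_mul] using this) 2
  simpa [ENNReal.smul_def] using this

lemma timeNorm_zero : timeNorm (0 : ℝ → ℂ) = 0 := by
  have h1 : supNorm (0 : ℝ → ℂ) ≤ 0 := iSup_le fun t => by simp
  have h2 : besov (0 : ℝ → ℂ) ≤ 0 := besov_le fun h hh => by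
    have : incr h (0 : ℝ → ℂ) = 0 := by ext; simp [incr]
    rw [this]; simp
  exact le_antisymm (by simpa [timeNorm] using add_le_add h1 h2) (zero_le)

lemma eq_zero_of_timeNorm (h : timeNorm f = 0) : f = 0 := by
  ext t
  have := enorm_le_timeNorm f t
  simpa [h] using this

/-- Leibniz rule for increments, one factor in L^∞ and the other in the Besov seminorm. Zero and
infinite norms are treated first, to avoid the products of 0 and ∞. -/
lemma timeNorm_mul_le (hf : Measurable f) (hg : Measurable g) :
    timeNorm (f * g) ≤ timeNorm f * timeNorm g := by
  rcases eq_or_ne (timeNorm f) 0 with h | hf0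
  · rw [eq_zero_of_timeNorm h, zero_mul, timeNorm_zero]; simp
  rcases eq_or_ne (timeNorm g) 0 with h | hg0
  · rw [eq_zero_of_timeNorm h, mul_zero, timeNorm_zero]; simp
  rcases eq_or_ne (timeNorm f) ∞ with h | hft
  · rw [h, ENNReal.top_mul hg0]; exact le_top
  rcases eq_or_ne (timeNorm g) ∞ with h | hgt
  · rw [h, ENNReal.mul_top hf0]; exact le_top
  have hfs : supNorm f ≠ ∞ := ne_top_of_le_ne_top hft (supNorm_le_timeNorm f)
  have hgs : supNorm g ≠ ∞ := ne_top_of_le_ne_top hgt (supNorm_le_timeNorm g)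
  have h1 : supNorm (f * g) ≤ supNorm f * supNorm g := iSup_le fun t => by
    rw [Pi.mul_apply, enorm_mul]
    exact mul_le_mul' (enorm_le_supNorm f t) (enorm_le_supNorm g t)
  have h2 : besov (f * g) ≤ supNorm f * besov g + supNorm g * besov f := by
    refine besov_le fun h hh => ?_
    have e : incr h (f * g) = (fun t => f (t + h) * incr h g t) + fun t => g t * incr h f t := by
      ext t; simp only [incr, Pi.mul_apply, Pi.add_apply]; ring
    rw [e]
    refine (eLpNorm_add_le ?_ ?_ (by norm_num)).trans ?_
    · exact ((hf.comp (measurable_id.add_const h)).mul (measurable_incr hg h)).aestronglyMeasurable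
    · exact (hg.mul (measurable_incr hf h)).aestronglyMeasurable
    · rw [mul_add]
      refine add_le_add ?_ ?_
      · refine (eLpNorm_mul_le_supNorm f (g := incr h g) hfs fun t => ?_).trans ?_
        · rw [enorm_mul]; gcongr; exact enorm_le_supNorm f _
        · rw [mul_left_comm]; gcongr; exact eLpNorm_incr_le g hh
      · refine (eLpNorm_mul_le_supNorm g (g := incr h f) hgs fun t => ?_).trans ?_
        · rw [enorm_mul]; gcongr; exact enorm_le_supNorm g _
        · rw [mul_left_comm]; gcongr; exact eLpNorm_incr_le f hh
  calc timeNorm (f * g) ≤ supNorm f * supNorm g + (supNorm f * besov g + supNorm g * besov f) :=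
        add_le_add h1 h2
    _ ≤ supNorm f * supNorm g + (supNorm f * besov g + supNorm g * besov f) +
        besov f * besov g := le_self_add
    _ = _ := by unfold timeNorm; ring

lemma supNorm_tsum_le {ι : Type*} (f : ι → ℝ → ℂ) :
    supNorm (fun t => ∑' i, f i t) ≤ ∑' i, supNorm (f i) :=
  iSup_le fun t => enorm_tsum_le_tsum_enorm.trans
    (ENNReal.tsum_le_tsum fun i => enorm_le_supNorm (f i) t)

lemma lintegral_Lp_sum_le {ι α : Type*} [MeasurableSpace α] {μ : Measure α} {q : ℝ} (hq : 1 ≤ q)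
    (g : ι → α → ℝ≥0∞) (hg : ∀ i, AEMeasurable (g i) μ) (S : Finset ι) :
    (∫⁻ t, (∑ i ∈ S, g i t) ^ q ∂μ) ^ (1 / q) ≤ ∑ i ∈ S, (∫⁻ t, g i t ^ q ∂μ) ^ (1 / q) := by
  classical
  have hq0 : 0 < q := by linarith
  induction S using Finset.induction_on with
  | empty => simp [hq0]
  | insert a S ha ih =>
    simp_rw [Finset.sum_insert ha]
    refine (ENNReal.lintegral_Lp_add_le (hg a)
      (Finset.aemeasurable_fun_sum S fun i _ => hg i) hq).trans ?_
    gcongr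

/-- Minkowski for countable sums, obtained from the finite case by monotone convergence along the
directed family of finite index sets. -/
lemma lintegral_Lp_tsum_le {ι α : Type*} [Countable ι] [MeasurableSpace α] {μ : Measure α} {q : ℝ}
    (hq : 1 ≤ q) (g : ι → α → ℝ≥0∞) (hg : ∀ i, AEMeasurable (g i) μ) :
    (∫⁻ t, (∑' i, g i t) ^ q ∂μ) ^ (1 / q) ≤ ∑' i, (∫⁻ t, g i t ^ q ∂μ) ^ (1 / q) := by
  have hq0 : 0 < q := by linarith
  have e (t : α) : (∑' i, g i t) ^ q = ⨆ S : Finset ι, (∑ i ∈ S, g i t) ^ q := by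
    rw [ENNReal.tsum_eq_iSup_sum]
    exact (ENNReal.orderIsoRpow q hq0).map_iSup _
  simp_rw [e]
  rw [lintegral_iSup_directed, one_div, ENNReal.rpow_inv_le_iff hq0]
  · refine iSup_le fun S => ?_
    rw [← ENNReal.rpow_inv_le_iff hq0, ← one_div]
    exact (lintegral_Lp_sum_le hq g hg S).trans (ENNReal.sum_le_tsum S)
  · exact fun S => (Finset.aemeasurable_fun_sum S fun i _ => hg i).pow_const q
  · refine Monotone.directed_le fun S S' h t => ?_
    dsimp only
    gcongr

lemma eLpNorm_le_tsum {ι α : Type*} [Countable ι] [MeasurableSpace α] {μ : Measure α}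
    {q : ℝ≥0∞} (hq : 1 ≤ q) (hq' : q ≠ ∞) {F : α → ℂ} {g : ι → α → ℂ}
    (hg : ∀ i, AEStronglyMeasurable (g i) μ) (h : ∀ t, ‖F t‖ₑ ≤ ∑' i, ‖g i t‖ₑ) :
    eLpNorm F q μ ≤ ∑' i, eLpNorm (g i) q μ := by
  have hq0 : q ≠ 0 := (zero_lt_one.trans_le hq).ne'
  simp_rw [eLpNorm_eq_lintegral_rpow_enorm_toReal hq0 hq']
  refine le_trans ?_ (lintegral_Lp_tsum_le ?_ (fun i t => ‖g i t‖ₑ) fun i => (hg i).enorm)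
  · gcongr with t
    exact h t
  · simpa using ENNReal.toReal_mono hq' hq

/-- Summability of the suprema makes the series converge at every time; otherwise the default value
of a divergent sum would spoil the identity between the increment of the sum and the sum of the
increments. -/
lemma besov_tsum_le {ι : Type*} [Countable ι] {f : ι → ℝ → ℂ} (hf : ∀ i, Measurable (f i))
    (hs : ∑' i, supNorm (f i) ≠ ∞) :
    besov (fun t => ∑' i, f i t) ≤ ∑' i, besov (f i) := by
  have hsum (t : ℝ) : Summable fun i => f i t := by
    refine Summable.of_enorm (ne_top_of_le_ne_top hs ?_)
    exact ENNReal.tsum_le_tsum fun i => enorm_le_supNorm (f i) t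
  refine besov_le fun h hh => ?_
  refine (eLpNorm_le_tsum (by norm_num) (by norm_num) (fun i => aesm_incr (hf i) h)
    fun t => ?_).trans ?_
  · have : incr h (fun t => ∑' i, f i t) t = ∑' i, incr h (f i) t :=
      ((hsum (t + h)).tsum_sub (hsum t)).symm
    rw [this]
    exact enorm_tsum_le_tsum_enorm
  · rw [← ENNReal.tsum_mul_left]
    exact ENNReal.tsum_le_tsum fun i => eLpNorm_incr_le (f i) hh

lemma timeNorm_tsum_le {ι : Type*} [Countable ι] {f : ι → ℝ → ℂ} (hf : ∀ i, Measurable (f i)) :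
    timeNorm (fun t => ∑' i, f i t) ≤ ∑' i, timeNorm (f i) := by
  by_cases hs : ∑' i, supNorm (f i) = ∞
  · have : ∑' i, timeNorm (f i) = ∞ := by
      rw [← top_le_iff, ← hs]
      exact ENNReal.tsum_le_tsum fun i => supNorm_le_timeNorm (f i)
    rw [this]; exact le_top
  · unfold timeNorm
    rw [ENNReal.tsum_add]
    exact add_le_add (supNorm_tsum_le f) (besov_tsum_le hf hs)

end

/-! ### Oscillatory primitives and the gain of time integration -/

section

/-- The oscillatory integral `∫_{t₀}^t e^{isφ} f(s) ds`. -/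
def osc (φ : ℝ) (f : ℝ → ℂ) (t₀ t : ℝ) : ℂ :=
  ∫ s in t₀..t, Complex.exp (Complex.I * (s * φ : ℝ)) * f s

variable {f : ℝ → ℂ} {φ : ℝ}

lemma norm_exp_I_mul (x : ℝ) : ‖Complex.exp (Complex.I * (x : ℂ))‖ = 1 := by
  rw [mul_comm]; exact Complex.norm_exp_ofReal_mul_I x

lemma enorm_exp_I_mul (x : ℝ) : ‖Complex.exp (Complex.I * (x : ℂ))‖ₑ = 1 := by
  rw [← ofReal_norm, norm_exp_I_mul]; simp

lemma enorm_exp_mul (x : ℝ) (z : ℂ) : ‖Complex.exp (Complex.I * (x : ℂ)) * z‖ₑ = ‖z‖ₑ := by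
  rw [enorm_mul, enorm_exp_I_mul, one_mul]

lemma norm_le_supNorm (hf : supNorm f ≠ ∞) (t : ℝ) : ‖f t‖ ≤ (supNorm f).toReal := by
  rw [← toReal_enorm]
  exact ENNReal.toReal_mono hf (enorm_le_supNorm f t)

lemma intervalIntegrable_of_supNorm (hf : Measurable f) (hs : supNorm f ≠ ∞) (a b : ℝ) :
    IntervalIntegrable f volume a b := by
  rw [intervalIntegrable_iff]
  refine Measure.integrableOn_of_bounded (M := (supNorm f).toReal) (by simp)
    hf.aestronglyMeasurable (ae_of_all _ fun t => norm_le_supNorm hs t)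

lemma measurable_exp_mul (hf : Measurable f) (φ : ℝ) :
    Measurable fun s : ℝ => Complex.exp (Complex.I * (s * φ : ℝ)) * f s := by
  refine Measurable.mul ?_ hf
  fun_prop

lemma supNorm_exp_mul (f : ℝ → ℂ) (φ : ℝ) :
    supNorm (fun s : ℝ => Complex.exp (Complex.I * (s * φ : ℝ)) * f s) = supNorm f := by
  unfold supNorm
  congr with t
  rw [enorm_exp_mul]

lemma intervalIntegrable_exp_mul (hf : Measurable f) (hs : supNorm f ≠ ∞) (φ a b : ℝ) :
    IntervalIntegrable (fun s : ℝ => Complex.exp (Complex.I * (s * φ : ℝ)) * f s) volume a b :=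
  intervalIntegrable_of_supNorm (measurable_exp_mul hf φ) (by rwa [supNorm_exp_mul]) a b

lemma continuous_osc (hf : Measurable f) (hs : supNorm f ≠ ∞) (φ t₀ : ℝ) :
    Continuous (osc φ f t₀) :=
  intervalIntegral.continuous_primitive (fun a b => intervalIntegrable_exp_mul hf hs φ a b) t₀

lemma osc_symm (φ : ℝ) (f : ℝ → ℂ) (a b : ℝ) : osc φ f a b = -osc φ f b a :=
  intervalIntegral.integral_symm b a

lemma osc_sub_osc (hf : Measurable f) (hs : supNorm f ≠ ∞) (φ a b c : ℝ) :
    osc φ f a c - osc φ f a b = osc φ f b c :=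
  intervalIntegral.integral_interval_sub_left (intervalIntegrable_exp_mul hf hs φ a c)
    (intervalIntegrable_exp_mul hf hs φ a b)

lemma enorm_osc_le (φ : ℝ) (f : ℝ → ℂ) (a b : ℝ) :
    ‖osc φ f a b‖ₑ ≤ ENNReal.ofReal |b - a| * supNorm f := by
  by_cases hs : supNorm f = ∞
  · rcases eq_or_ne a b with rfl | hab
    · simp [osc]
    · rw [hs, ENNReal.mul_top]
      · exact le_top
      · simpa [sub_eq_zero] using hab.symm
  · have := intervalIntegral.norm_integral_le_of_norm_le_const (a := a) (b := b)
      (f := fun s : ℝ => Complex.exp (Complex.I * (s * φ : ℝ)) * f s) (C := (supNorm f).toReal)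
      fun t _ => by
        rw [norm_mul, norm_exp_I_mul, one_mul]
        exact norm_le_supNorm hs t
    rw [← ofReal_norm]
    refine (ENNReal.ofReal_le_ofReal this).trans ?_
    rw [mul_comm, ENNReal.ofReal_mul (abs_nonneg _), ENNReal.ofReal_toReal hs]

/-- The oscillatory integral in terms of an increment of the integrand over half a period. -/
lemma two_mul_osc (hf : Measurable f) (hs : supNorm f ≠ ∞) {h : ℝ}
    (hφ : |φ| * h = Real.pi) (a b : ℝ) :
    2 * osc φ f a b = (-∫ s in a..b, Complex.exp (Complex.I * (s * φ : ℝ)) * incr h f s) +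
      osc φ f a (a + h) - osc φ f b (b + h) := by
  set e : ℝ → ℂ := fun s => Complex.exp (Complex.I * (s * φ : ℝ)) with he
  have hper (s : ℝ) : e (s + h) = -e s := by
    simp only [he]
    have : Complex.I * (((s + h) * φ : ℝ) : ℂ) =
        Complex.I * ((s * φ : ℝ) : ℂ) + Complex.I * ((h * φ : ℝ) : ℂ) := by push_cast; ring
    rw [this, Complex.exp_add]
    have h2 : Complex.exp (Complex.I * ((h * φ : ℝ) : ℂ)) = -1 := by
      rcases abs_cases φ with ⟨h1, _⟩ | ⟨h1, _⟩
      · rw [h1] at hφ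
        rw [mul_comm h, hφ, mul_comm, Complex.exp_pi_mul_I]
      · rw [h1] at hφ
        have : h * φ = -Real.pi := by linarith
        rw [this, Complex.ofReal_neg, mul_neg, Complex.exp_neg, mul_comm, Complex.exp_pi_mul_I]
        norm_num
    rw [h2]; ring
  have hi := intervalIntegrable_exp_mul hf hs φ
  have hshift : ∫ s in a..b, e s * f (s + h) = -osc φ f (a + h) (b + h) := by
    have h1 : ∫ s in a..b, e s * f (s + h) = -∫ s in a..b, e (s + h) * f (s + h) := by
      rw [← intervalIntegral.integral_neg]
      refine intervalIntegral.integral_congr fun s _ => ?_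
      simp only [hper]; ring
    rw [h1, intervalIntegral.integral_comp_add_right (fun s => e s * f s) h]
    rfl
  have hi2 : IntervalIntegrable (fun s => e s * f (s + h)) volume a b := by
    have hg : Measurable fun s => f (s + h) := hf.comp (measurable_id.add_const h)
    refine intervalIntegrable_exp_mul hg (ne_top_of_le_ne_top hs ?_) φ a b
    exact iSup_le fun t => enorm_le_supNorm f _
  have h1 : ∫ s in a..b, e s * incr h f s = -osc φ f (a + h) (b + h) - osc φ f a b := by
    rw [← hshift, osc, ← intervalIntegral.integral_sub hi2 (hi a b)]
    refine intervalIntegral.integral_congr fun s _ => ?_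
    simp only [incr, he]; ring
  have h2 : osc φ f (a + h) (b + h) = osc φ f a b - osc φ f a (a + h) + osc φ f b (b + h) := by
    rw [← osc_sub_osc hf hs φ a (a + h) (b + h), ← osc_sub_osc hf hs φ a b (b + h)]; ring
  rw [h1, h2]; ring

/-- Half-period shift: the oscillatory integral is controlled by an increment of the integrand. -/
lemma enorm_osc_le_incr (hf : Measurable f) (hs : supNorm f ≠ ∞) {h : ℝ} (hh : 0 < h)
    (hφ : |φ| * h = Real.pi) {a b : ℝ} (hab : a ≤ b) :
    ‖osc φ f a b‖ₑ ≤ ENNReal.ofReal h * supNorm f + ∫⁻ t in Set.Ioc a b, ‖incr h f t‖ₑ := by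
  set e : ℝ → ℂ := fun s => Complex.exp (Complex.I * (s * φ : ℝ)) with he
  have key := two_mul_osc hf hs hφ a b
  have h3 : ‖∫ s in a..b, e s * incr h f s‖ₑ ≤ ∫⁻ t in Set.Ioc a b, ‖incr h f t‖ₑ := by
    rw [intervalIntegral.integral_of_le hab]
    refine (enorm_integral_le_lintegral_enorm _).trans (le_of_eq ?_)
    refine lintegral_congr fun s => ?_
    rw [he, enorm_exp_mul]
  have h4 (c : ℝ) : ‖osc φ f c (c + h)‖ₑ ≤ ENNReal.ofReal h * supNorm f := by
    have := enorm_osc_le φ f c (c + h)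
    rwa [add_sub_cancel_left, abs_of_pos hh] at this
  have h5 : 2 * ‖osc φ f a b‖ₑ ≤
      2 * (ENNReal.ofReal h * supNorm f + ∫⁻ t in Set.Ioc a b, ‖incr h f t‖ₑ) := by
    have e2 : (2 : ℝ≥0∞) * ‖osc φ f a b‖ₑ = ‖2 * osc φ f a b‖ₑ := by
      rw [enorm_mul, ← ofReal_norm (2 : ℂ)]; simp
    rw [e2, key]
    refine (enorm_sub_le).trans ((add_le_add_left (enorm_add_le _ _) _).trans ?_)
    rw [enorm_neg]
    calc _ ≤ (∫⁻ t in Set.Ioc a b, ‖incr h f t‖ₑ) + ENNReal.ofReal h * supNorm f +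
          ENNReal.ofReal h * supNorm f := by
          gcongr
          · exact h4 a
          · exact h4 b
      _ ≤ _ := by
          rw [mul_add, two_mul, two_mul]
          rw [add_assoc, add_comm]
          gcongr
          exact le_self_add
  exact (ENNReal.mul_le_mul_iff_right (by norm_num) (by norm_num)).1 h5

lemma lintegral_Ioc_le (hf : Measurable f) {a b : ℝ} (hab : a ≤ b) :
    ∫⁻ t in Set.Ioc a b, ‖f t‖ₑ ≤
      ENNReal.ofReal (√(b - a)) * (∫⁻ t in Set.Ioc a b, ‖f t‖ₑ ^ 2) ^ (1 / 2 : ℝ) := by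
  have h := ENNReal.lintegral_mul_le_Lp_mul_Lq (volume.restrict (Set.Ioc a b))
    Real.HolderConjugate.two_two
    (f := fun _ => 1) (g := fun t => ‖f t‖ₑ) aemeasurable_const hf.enorm.aemeasurable
  simp only [Pi.mul_apply, one_mul, ENNReal.one_rpow, lintegral_const, Measure.restrict_apply_univ,
    Real.volume_Ioc] at h
  refine h.trans (le_of_eq ?_)
  rw [Real.sqrt_eq_rpow, ENNReal.ofReal_rpow_of_nonneg (by linarith) (by norm_num)]
  norm_num

/-- Tonelli: every s belongs to the windows whose left endpoint t runs over [s - η, s). -/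
lemma lintegral_window {G : ℝ → ℝ≥0∞} (hG : Measurable G) {η : ℝ} :
    ∫⁻ t, ∫⁻ s in Set.Ioc t (t + η), G s = ENNReal.ofReal η * ∫⁻ s, G s := by
  have e1 (t : ℝ) : ∫⁻ s in Set.Ioc t (t + η), G s =
      ∫⁻ s, {q : ℝ × ℝ | q.1 < q.2 ∧ q.2 ≤ q.1 + η}.indicator (fun q => G q.2) (t, s) := by
    rw [← lintegral_indicator measurableSet_Ioc]
    refine lintegral_congr fun s => ?_
    simp only [Set.indicator_apply, Set.mem_Ioc, Set.mem_ofPred_eq]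
  have hm : MeasurableSet {q : ℝ × ℝ | q.1 < q.2 ∧ q.2 ≤ q.1 + η} :=
    (measurableSet_lt measurable_fst measurable_snd).inter
      (measurableSet_le measurable_snd (measurable_fst.add_const η))
  simp_rw [e1]
  rw [lintegral_lintegral_swap (f := fun t s =>
    {q : ℝ × ℝ | q.1 < q.2 ∧ q.2 ≤ q.1 + η}.indicator (fun q => G q.2) (t, s))
    ((hG.comp measurable_snd).indicator hm).aemeasurable]
  have e2 (s : ℝ) : ∫⁻ t, {q : ℝ × ℝ | q.1 < q.2 ∧ q.2 ≤ q.1 + η}.indicator (fun q => G q.2) (t, s) =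
      ENNReal.ofReal η * G s := by
    have : (fun t => {q : ℝ × ℝ | q.1 < q.2 ∧ q.2 ≤ q.1 + η}.indicator (fun q => G q.2) (t, s)) =
        (Set.Ico (s - η) s).indicator fun _ => G s := by
      ext t
      simp only [Set.indicator_apply, Set.mem_Ico, Set.mem_ofPred_eq]
      congr 1
      ext; constructor <;> rintro ⟨h1, h2⟩ <;> constructor <;> linarith
    rw [this, lintegral_indicator measurableSet_Ico, setLIntegral_const, Real.volume_Ico, mul_comm]
    congr 2; ring
  simp_rw [e2]
  rw [lintegral_const_mul _ hG]

/-- A moving integral over windows of length η is bounded on L² by η: Cauchy–Schwarz inside the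
window, then `lintegral_window`. -/
lemma eLpNorm_indicator_le_window (hf : Measurable f) {A : Set ℝ} {η : ℝ} (hη : 0 ≤ η)
    {F : ℝ → ℂ} (hF : ∀ t ∈ A, ‖F t‖ₑ ≤ ∫⁻ s in Set.Ioc t (t + η), ‖f s‖ₑ) :
    eLpNorm (A.indicator F) 2 volume ≤ ENNReal.ofReal η * eLpNorm f 2 volume := by
  rw [eLpNorm_two_le_iff, mul_pow, eLpNorm_two_sq]
  calc ∫⁻ t, ‖A.indicator F t‖ₑ ^ 2
      ≤ ∫⁻ t, ENNReal.ofReal η * ∫⁻ s in Set.Ioc t (t + η), ‖f s‖ₑ ^ 2 := by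
        refine lintegral_mono fun t => ?_
        by_cases ht : t ∈ A
        · rw [Set.indicator_of_mem ht]
          have h1 := (hF t ht).trans (lintegral_Ioc_le hf (by linarith : t ≤ t + η))
          calc ‖F t‖ₑ ^ 2 ≤ _ := pow_le_pow_left' h1 2
            _ = _ := by
              rw [mul_pow, add_sub_cancel_left, ofReal_sqrt_sq hη, ← ENNReal.rpow_natCast,
                ← ENNReal.rpow_mul]
              norm_num
        · simp [ht]
    _ = _ := by
        have hm : Measurable fun s => ‖f s‖ₑ ^ 2 := hf.enorm.pow_const 2
        rw [lintegral_const_mul' _ _ ENNReal.ofReal_ne_top, lintegral_window hm]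
        ring

/-- The gain of the time integration, in terms of a half period `h` of the oscillation (or of
any `h` at least as large as the length of the time interval). -/
lemma timeNorm_osc_le_aux (hf : Measurable f) (hfin : timeNorm f ≠ ∞) {c d h : ℝ} (hcd : c ≤ d)
    (hh : 0 < h) (H : d - c ≤ h ∨ |φ| * h = Real.pi) {t₀ : ℝ} (ht₀ : t₀ ∈ Set.Icc c d) :
    timeNorm ((Set.Icc c d).indicator (osc φ f t₀)) ≤
      4 * ENNReal.ofReal (√(d - c) * √h) * timeNorm f := by
  have hs : supNorm f ≠ ∞ := ne_top_of_le_ne_top hfin (supNorm_le_timeNorm f)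
  set L := d - c with hL
  have hL0 : 0 ≤ L := by rw [hL]; linarith
  -- The comparisons between the scales L, h and η reduce to this inequality.
  have hsub (x y : ℝ) (hx : 0 ≤ x) (hxy : x ≤ y) : x ≤ √x * √y := by
    calc x = √x * √x := (Real.mul_self_sqrt hx).symm
      _ ≤ _ := by gcongr
  -- Supremum bound. If L ≤ h there is no oscillation to exploit and the length of the interval
  -- suffices; if L > h the half-period shift costs h times the supremum of f plus the L¹ norm of an
  -- increment, at most √L √h times the Besov seminorm.
  have hab (a b : ℝ) (ha : a ∈ Set.Icc c d) (hb : b ∈ Set.Icc c d) (hle : a ≤ b) :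
      ‖osc φ f a b‖ₑ ≤ ENNReal.ofReal (√L * √h) * timeNorm f := by
    by_cases hLh : L ≤ h
    · refine (enorm_osc_le φ f a b).trans ?_
      have : |b - a| ≤ √L * √h := by
        rw [abs_of_nonneg (by linarith)]
        refine le_trans ?_ (hsub L h hL0 hLh)
        rw [hL]; linarith [ha.1, hb.2]
      gcongr
      exact supNorm_le_timeNorm f
    · have hφ : |φ| * h = Real.pi := H.resolve_left hLh
      refine (enorm_osc_le_incr hf hs hh hφ hle).trans ?_
      unfold timeNorm
      rw [mul_add]
      have hLh' : h ≤ L := le_of_not_ge hLh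
      have q1 : h ≤ √L * √h := by rw [mul_comm]; exact hsub h L hh.le hLh'
      gcongr
      refine (lintegral_Ioc_le (measurable_incr hf h) hle).trans ?_
      have q2 : (∫⁻ t in Set.Ioc a b, ‖incr h f t‖ₑ ^ 2) ^ (1 / 2 : ℝ) ≤
          ENNReal.ofReal (√h) * besov f := by
        refine le_trans ?_ (eLpNorm_incr_le f hh)
        rw [one_div, ENNReal.rpow_inv_le_iff (by norm_num)]
        rw [show ((2 : ℝ)) = ((2 : ℕ) : ℝ) by norm_num, ENNReal.rpow_natCast, eLpNorm_two_sq]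
        exact setLIntegral_le_lintegral _ _
      rw [ENNReal.ofReal_mul (Real.sqrt_nonneg _), mul_assoc]
      refine mul_le_mul' ?_ q2
      refine ENNReal.ofReal_le_ofReal (Real.sqrt_le_sqrt ?_)
      rw [hL]; linarith [ha.1, hb.2]
  set M := ENNReal.ofReal (√L * √h) * timeNorm f with hM
  have hsup : supNorm ((Set.Icc c d).indicator (osc φ f t₀)) ≤ M := by
    refine iSup_le fun t => ?_
    by_cases ht : t ∈ Set.Icc c d
    · rw [Set.indicator_of_mem ht]
      rcases le_total t₀ t with h1 | h1
      · exact hab _ _ ht₀ ht h1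
      · rw [osc_symm, enorm_neg]; exact hab _ _ ht ht₀ h1
    · simp [ht]
  have hmeas : Measurable ((Set.Icc c d).indicator (osc φ f t₀)) :=
    (continuous_osc hf hs φ t₀).measurable.indicator measurableSet_Icc
  have hbes : besov ((Set.Icc c d).indicator (osc φ f t₀)) ≤ M +
      2 * supNorm ((Set.Icc c d).indicator (osc φ f t₀)) := by
    refine besov_le_of_support (c := c) (d := d) hmeas
      (fun t ht => Set.indicator_of_notMem ht _) fun η hη => ?_
    set A : Set ℝ := {t | t ∈ Set.Icc c d ∧ t + η ∈ Set.Icc c d} with hA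
    have hAm : MeasurableSet A :=
      measurableSet_Icc.inter (measurableSet_Icc.preimage (measurable_id.add_const η))
    by_cases hηL : η ≤ L
    swap
    -- A step longer than the interval never has both endpoints in it.
    · have : A = ∅ := by
        ext t
        simp only [hA, Set.mem_ofPred_eq, Set.mem_Icc, Set.mem_empty_iff_false, iff_false]
        rintro ⟨⟨h1, h2⟩, h3, h4⟩
        apply hηL; rw [hL]; linarith
      simp [this]
    have hincr (t : ℝ) (ht : t ∈ A) :
        incr η ((Set.Icc c d).indicator (osc φ f t₀)) t = osc φ f t (t + η) := by
      rw [incr, Set.indicator_of_mem ht.1, Set.indicator_of_mem ht.2, osc_sub_osc hf hs]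
    have e1 : A.indicator (incr η ((Set.Icc c d).indicator (osc φ f t₀))) =
        A.indicator (fun t => osc φ f t (t + η)) := by
      ext t
      by_cases ht : t ∈ A
      · rw [Set.indicator_of_mem ht, Set.indicator_of_mem ht, hincr t ht]
      · simp [ht]
    have hAv : volume A ≤ ENNReal.ofReal L := by
      rw [hL, ← Real.volume_Icc]
      exact measure_mono fun t ht => ht.1
    rw [e1]
    by_cases hηh : η ≤ h
    -- Steps below the half period: the integral over a step is at most η times the supremum of f,
    -- on a set of measure at most L.
    · refine (eLpNorm_two_le_of_support hAm hL0 hAv (K := ENNReal.ofReal η * supNorm f)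
        (fun t ht => ?_) fun t ht => by simp [ht]).trans ?_
      · rw [Set.indicator_of_mem ht]
        have := enorm_osc_le φ f t (t + η)
        rwa [add_sub_cancel_left, abs_of_pos hη] at this
      · rw [hM, ← mul_assoc, ← mul_assoc, ← ENNReal.ofReal_mul (Real.sqrt_nonneg _),
          ← ENNReal.ofReal_mul (Real.sqrt_nonneg _)]
        refine mul_le_mul' (ENNReal.ofReal_le_ofReal ?_) (supNorm_le_timeNorm f)
        have := hsub η h hη.le hηh
        calc √L * η ≤ √L * (√η * √h) := by gcongr
          _ = _ := by ring
    -- Steps above the half period: the shift is applied on each window [t, t + η]; the constant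
    -- term is measured over the interval and the moving integral by `eLpNorm_indicator_le_window`.
    · have hηh' : h ≤ η := le_of_not_ge hηh
      have hφ : |φ| * h = Real.pi := H.resolve_left (by linarith)
      have hD (t : ℝ) := enorm_osc_le_incr hf hs hh hφ (by linarith : t ≤ t + η)
      -- split off the boundary term by Minkowski's inequality
      set g1 : ℝ → ℂ := A.indicator fun _ => ((h * (supNorm f).toReal : ℝ) : ℂ) with hg1
      set g2 : ℝ → ℂ := A.indicator fun t =>
        (((∫⁻ s in Set.Ioc t (t + η), ‖incr h f s‖ₑ).toReal : ℝ) : ℂ) with hg2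
      have hwfin (t : ℝ) : ∫⁻ s in Set.Ioc t (t + η), ‖incr h f s‖ₑ ≠ ∞ := by
        refine ne_top_of_le_ne_top ?_ (lintegral_mono (g := fun _ => 2 * supNorm f) fun s => ?_)
        · rw [setLIntegral_const, Real.volume_Ioc]
          finiteness
        · rw [two_mul]
          exact (enorm_sub_le).trans (add_le_add (enorm_le_supNorm f _) (enorm_le_supNorm f _))
      have hwm : Measurable fun t => ∫⁻ s in Set.Ioc t (t + η), ‖incr h f s‖ₑ := by
        have e1 : (fun t => ∫⁻ s in Set.Ioc t (t + η), ‖incr h f s‖ₑ) = fun t =>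
            ∫⁻ s, {q : ℝ × ℝ | q.1 < q.2 ∧ q.2 ≤ q.1 + η}.indicator
              (fun q => ‖incr h f q.2‖ₑ) (t, s) := by
          ext t
          rw [← lintegral_indicator measurableSet_Ioc]
          refine lintegral_congr fun s => ?_
          simp only [Set.indicator_apply, Set.mem_Ioc, Set.mem_ofPred_eq]
        rw [e1]
        have hm : MeasurableSet {q : ℝ × ℝ | q.1 < q.2 ∧ q.2 ≤ q.1 + η} :=
          (measurableSet_lt measurable_fst measurable_snd).inter
            (measurableSet_le measurable_snd (measurable_fst.add_const η))
        exact (((measurable_incr hf h).enorm.comp measurable_snd).indicator hm).lintegral_prod_right'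
      have hg1m : AEStronglyMeasurable g1 volume :=
        (measurable_const.indicator hAm).aestronglyMeasurable
      have hg2m : AEStronglyMeasurable g2 volume :=
        ((Complex.measurable_ofReal.comp hwm.ennreal_toReal).indicator hAm).aestronglyMeasurable
      have n1 (t : ℝ) (ht : t ∈ A) : ‖g1 t‖ₑ = ENNReal.ofReal h * supNorm f := by
        rw [hg1, Set.indicator_of_mem ht, ← ofReal_norm, Complex.norm_real, Real.norm_eq_abs,
          abs_of_nonneg (by positivity), ENNReal.ofReal_mul hh.le, ENNReal.ofReal_toReal hs]
      have n2 (t : ℝ) (ht : t ∈ A) : ‖g2 t‖ₑ = ∫⁻ s in Set.Ioc t (t + η), ‖incr h f s‖ₑ := by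
        rw [hg2, Set.indicator_of_mem ht, ← ofReal_norm, Complex.norm_real, Real.norm_eq_abs,
          abs_of_nonneg ENNReal.toReal_nonneg, ENNReal.ofReal_toReal (hwfin t)]
      have hle : eLpNorm (A.indicator (fun t => osc φ f t (t + η))) 2 volume ≤
          eLpNorm g1 2 volume + eLpNorm g2 2 volume := by
        have := eLpNorm_le_tsum (ι := Bool) (q := 2) (by norm_num) (by norm_num)
          (F := A.indicator (fun t => osc φ f t (t + η))) (g := fun b => if b then g1 else g2)
          (μ := volume) (by rintro (_ | _) <;> simp [hg1m, hg2m]) (fun t => ?_)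
        · simpa [tsum_bool, add_comm] using this
        · by_cases ht : t ∈ A
          · rw [Set.indicator_of_mem ht]
            have := hD t
            simpa [tsum_bool, n1 t ht, n2 t ht, add_comm] using this
          · simp [ht]
      refine hle.trans ?_
      have b1 : eLpNorm g1 2 volume ≤ ENNReal.ofReal (√L) * (ENNReal.ofReal h * supNorm f) :=
        eLpNorm_two_le_of_support hAm hL0 hAv (fun t ht => (n1 t ht).le)
          fun t ht => by simp [hg1, ht]
      have b2 : eLpNorm g2 2 volume ≤ ENNReal.ofReal η * (ENNReal.ofReal (√h) * besov f) := by
        refine le_trans (eLpNorm_indicator_le_window (measurable_incr hf h) hη.le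
          fun t ht => ?_) (mul_le_mul' le_rfl (eLpNorm_incr_le f hh))
        have := n2 t ht
        rw [hg2, Set.indicator_of_mem ht] at this
        exact this.le
      refine (add_le_add b1 b2).trans ?_
      rw [hM, timeNorm, mul_add, mul_add, ← mul_assoc, ← mul_assoc, ← mul_assoc, ← mul_assoc,
        ← ENNReal.ofReal_mul (by positivity), ← ENNReal.ofReal_mul (by positivity),
        ← ENNReal.ofReal_mul (by positivity)]
      have q1 : √L * h ≤ √η * (√L * √h) := by
        have := hsub h η hh.le hηh'
        calc √L * h ≤ √L * (√h * √η) := by gcongr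
          _ = _ := by ring
      have q2 : η * √h ≤ √η * (√L * √h) := by
        have := hsub η L hη.le hηL
        calc η * √h ≤ (√η * √L) * √h := by gcongr
          _ = _ := by ring
      gcongr
  calc timeNorm ((Set.Icc c d).indicator (osc φ f t₀))
      ≤ M + (M + 2 * M) := by
        refine add_le_add hsup (hbes.trans ?_)
        gcongr
    _ = _ := by rw [hM]; ring

/-- The gain `⟨φ⟩^{-1/2}` of the time integration on an interval of length at most `2`. -/
theorem timeNorm_osc_le (hf : Measurable f) (hfin : timeNorm f ≠ ∞) {c d : ℝ} (hcd : c ≤ d)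
    (hcd2 : d - c ≤ 2) {t₀ : ℝ} (ht₀ : t₀ ∈ Set.Icc c d) :
    timeNorm ((Set.Icc c d).indicator (osc φ f t₀)) ≤
      12 * ENNReal.ofReal (√(d - c) * bracket φ ^ (-(1 / 2) : ℝ)) * timeNorm f := by
  have hb := bracket_pos φ
  -- The constant 9 leaves room for π(1 + |φ|) ≤ 8|φ| when |φ| ≥ 1, and for h = 2 when |φ| < 1; its
  -- square root turns the factor 4 of the previous bound into 12.
  have key : ∃ h : ℝ, 0 < h ∧ h ≤ 9 / bracket φ ∧ (d - c ≤ h ∨ |φ| * h = Real.pi) := by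
    have hπ := Real.pi_lt_four
    rcases le_or_gt 1 |φ| with h1 | h1
    · refine ⟨Real.pi / |φ|, by positivity, ?_, Or.inr (by field_simp)⟩
      rw [div_le_div_iff₀ (by positivity) hb]
      have := bracket_le φ
      nlinarith [Real.pi_pos]
    · refine ⟨2, by norm_num, ?_, Or.inl hcd2⟩
      rw [le_div_iff₀ hb]
      have := bracket_le φ
      linarith
  obtain ⟨h, hh, hle, H⟩ := key
  refine (timeNorm_osc_le_aux hf hfin hcd hh H ht₀).trans ?_
  refine mul_le_mul' ?_ le_rfl
  have h12 : (12 : ℝ≥0∞) = 4 * ENNReal.ofReal 3 := by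
    rw [ENNReal.ofReal_ofNat]; norm_num
  rw [h12, mul_assoc, ← ENNReal.ofReal_mul (by norm_num)]
  refine mul_le_mul' le_rfl (ENNReal.ofReal_le_ofReal ?_)
  have : √h ≤ 3 * bracket φ ^ (-(1 / 2) : ℝ) := by
    refine (Real.sqrt_le_sqrt hle).trans (le_of_eq ?_)
    rw [Real.sqrt_div (by norm_num), show (9 : ℝ) = 3 ^ 2 by norm_num,
      Real.sqrt_sq (by norm_num), Real.rpow_neg hb.le, Real.sqrt_eq_rpow, div_eq_mul_inv]
  calc √(d - c) * √h ≤ √(d - c) * (3 * bracket φ ^ (-(1 / 2) : ℝ)) := by gcongr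
    _ = _ := by ring

end

/-! ### Plancherel and inversion for the unnormalized Fourier integral -/

section Plancherel

open FourierTransform SchwartzMap

/-- Both transforms have the same pairing with every compactly supported smooth function: the L² one
through tempered distributions, the integral one through the multiplication formula. -/
lemma fourier_ae_eq_toLp {f : ℝ → ℂ} (hf : Integrable f) (hf2 : MemLp f 2 volume) :
    (𝓕 (hf2.toLp f) : Lp ℂ 2 (volume : Measure ℝ)) =ᵐ[volume] 𝓕 f := by
  have hcont : Continuous (𝓕 f) :=
    VectorFourier.fourierIntegral_continuous Real.continuous_fourierChar
      (by exact continuous_inner) hf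
  refine ae_eq_of_integral_contDiff_smul_eq
    ((Lp.memLp _).locallyIntegrable (by norm_num)) hcont.locallyIntegrable fun g hg hgc => ?_
  set G : 𝓢(ℝ, ℂ) := HasCompactSupport.toSchwartzMap (f := fun x => (g x : ℂ))
    (hgc.comp_left (g := fun x : ℝ => (x : ℂ)) Complex.ofReal_zero)
    (Complex.ofRealCLM.contDiff.comp hg) with hG
  have hGc (x : ℝ) : G x = g x := rfl
  have h1 := congrArg (fun F : 𝓢'(ℝ, ℂ) => F G)
    (Lp.fourier_toTemperedDistribution_eq (hf2.toLp f))
  simp only [TemperedDistribution.fourier_apply, Lp.toTemperedDistribution_apply] at h1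
  have h2 : ∫ x, g x • (𝓕 (hf2.toLp f) : Lp ℂ 2 (volume : Measure ℝ)) x =
      ∫ x, (𝓕 G) x • f x := by
    calc _ = ∫ x, G x • (𝓕 (hf2.toLp f) : Lp ℂ 2 (volume : Measure ℝ)) x := by
          refine integral_congr_ae (ae_of_all _ fun x => ?_)
          simp [hGc]
      _ = _ := h1.symm
      _ = _ := by
          refine integral_congr_ae ?_
          filter_upwards [hf2.coeFn_toLp] with x hx
          rw [hx]
  rw [h2]
  have h3 := VectorFourier.integral_fourierIntegral_smul_eq_flip (L := innerₗ ℝ) (μ := volume)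
    (ν := volume) (f := G) (g := f) Real.continuous_fourierChar (by exact continuous_inner)
    G.integrable hf
  calc ∫ x, (𝓕 G) x • f x = ∫ x, G x • 𝓕 f x := by
        simpa using! h3
    _ = _ := by
        refine integral_congr_ae (ae_of_all _ fun x => ?_)
        simp [hGc]

theorem eLpNorm_fourier {f : ℝ → ℂ} (hf : Integrable f) (hf2 : MemLp f 2 volume) :
    eLpNorm (𝓕 f) 2 volume = eLpNorm f 2 volume := by
  rw [← eLpNorm_congr_ae (fourier_ae_eq_toLp hf hf2)]
  have h1 := Lp.norm_fourier_eq (hf2.toLp f)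
  rw [Lp.norm_toLp, Lp.norm_def] at h1
  exact (ENNReal.toReal_eq_toReal_iff' (Lp.eLpNorm_ne_top _) hf2.eLpNorm_ne_top).1 h1

end Plancherel

section FT

open FourierTransform

/-- The Fourier integral `∫ e^{itx} f(t) dt`. -/
def ft (f : ℝ → ℂ) (x : ℝ) : ℂ := ∫ t, Complex.exp (Complex.I * (t * x : ℝ)) * f t

/-- Change of normalization: the opposite sign and the missing 2π in the exponent account for the
constant √(2π) in Plancherel and 2π in inversion. -/
lemma ft_eq_fourier (f : ℝ → ℂ) (x : ℝ) : ft f x = 𝓕 f (-(2 * Real.pi)⁻¹ * x) := by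
  rw [Real.fourier_real_eq_integral_exp_smul, ft]
  refine integral_congr_ae (ae_of_all _ fun t => ?_)
  simp only [smul_eq_mul]
  congr 2
  rw [mul_comm]
  congr 2
  field_simp

lemma continuous_fourier {f : ℝ → ℂ} (hf : Integrable f) : Continuous (𝓕 f) :=
  VectorFourier.fourierIntegral_continuous Real.continuous_fourierChar
    (by exact continuous_inner) hf

lemma continuous_ft {f : ℝ → ℂ} (hf : Integrable f) : Continuous (ft f) := by
  have : ft f = fun x => 𝓕 f (-(2 * Real.pi)⁻¹ * x) := funext fun x => ft_eq_fourier f x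
  rw [this]
  exact (continuous_fourier hf).comp (by fun_prop)

lemma lintegral_comp_mul_left {g : ℝ → ℝ≥0∞} (hg : Measurable g) {a : ℝ} (ha : a ≠ 0) :
    ∫⁻ x, g (a * x) = ENNReal.ofReal |a⁻¹| * ∫⁻ x, g x := by
  rw [← lintegral_map (f := g) (g := fun x => a * x) hg (measurable_const_mul a),
    Real.map_volume_mul_left ha, lintegral_smul_measure, smul_eq_mul]

theorem eLpNorm_ft {f : ℝ → ℂ} (hf : Integrable f) (hf2 : MemLp f 2 volume) :
    eLpNorm (ft f) 2 volume = ENNReal.ofReal (√(2 * Real.pi)) * eLpNorm f 2 volume := by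
  have hinj : Function.Injective fun x : ℝ≥0∞ => x ^ 2 :=
    (ENNReal.pow_right_strictMono (n := 2) (by norm_num)).injective
  apply hinj
  dsimp only
  rw [mul_pow, ofReal_sqrt_sq Real.two_pi_pos.le, ← eLpNorm_fourier hf hf2, eLpNorm_two_sq,
    eLpNorm_two_sq]
  simp_rw [ft_eq_fourier]
  rw [lintegral_comp_mul_left (g := fun x => ‖𝓕 f x‖ₑ ^ 2)
    ((continuous_fourier hf).measurable.enorm.pow_const 2) (by simp [Real.pi_ne_zero])]
  congr 2
  rw [inv_neg, inv_inv, abs_neg, abs_of_pos Real.two_pi_pos]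

theorem ft_ft_neg {f : ℝ → ℂ} (hc : Continuous f) (hf : Integrable f) (h'f : Integrable (ft f))
    (t : ℝ) : ∫ x, Complex.exp (Complex.I * (t * x : ℝ)) * ft f (-x) = 2 * Real.pi * f t := by
  have hF : Integrable (𝓕 f) := by
    have h1 : Integrable fun x => 𝓕 f (-(2 * Real.pi)⁻¹ * x) :=
      h'f.congr (ae_of_all _ fun x => ft_eq_fourier f x)
    exact (integrable_comp_mul_left_iff _ (by simp [Real.pi_ne_zero])).1 h1
  have key := congrFun (hc.fourierInv_fourier_eq hf hF) t
  rw [Real.fourierInv_eq'] at key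
  have h2 : ∫ x, Complex.exp (Complex.I * (t * x : ℝ)) * ft f (-x) =
      ∫ x, (fun v : ℝ => Complex.exp (((2 * Real.pi * inner ℝ v t : ℝ) : ℂ) * Complex.I) • 𝓕 f v)
        ((2 * Real.pi)⁻¹ * x) := by
    refine integral_congr_ae (ae_of_all _ fun x => ?_)
    simp only [ft_eq_fourier, smul_eq_mul]
    congr 2
    · rw [mul_comm]
      congr 2
      simp only [RCLike.inner_apply, conj_trivial]
      field_simp
    · ring_nf
  rw [h2, Measure.integral_comp_mul_left (fun v : ℝ =>
    Complex.exp (((2 * Real.pi * inner ℝ v t : ℝ) : ℂ) * Complex.I) • 𝓕 f v), key, inv_inv, abs_of_pos Real.two_pi_pos,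
    Complex.real_smul]
  push_cast; ring

end FT

/-! ### The Z-norm in the modulation variable -/

/-- The weighted norm of a nonnegative function of the time frequency that corresponds to the
norm of `Z^{s,1/2}_p`. -/
def zt (u : ℝ → ℝ≥0∞) : ℝ≥0∞ :=
  (∫⁻ x, (ENNReal.ofReal (bracket x ^ (1 / 2 : ℝ)) * u x) ^ (2 : ℝ)) ^ (1 / (2 : ℝ)) + ∫⁻ x, u x

/-- The `L²` norm of a nonnegative function. -/
def l2 (u : ℝ → ℝ≥0∞) : ℝ≥0∞ := (∫⁻ x, u x ^ (2 : ℝ)) ^ (1 / (2 : ℝ))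

lemma zt_mono {u v : ℝ → ℝ≥0∞} (h : ∀ x, u x ≤ v x) : zt u ≤ zt v := by
  unfold zt
  gcongr with x x
  · exact h x
  · exact h x

lemma l2_mono {u v : ℝ → ℝ≥0∞} (h : ∀ x, u x ≤ v x) : l2 u ≤ l2 v := by
  unfold l2
  gcongr with x
  exact h x

lemma measurable_bracket : Measurable bracket := by
  unfold bracket; fun_prop

lemma measurable_weight : Measurable fun x => ENNReal.ofReal (bracket x ^ (1 / 2 : ℝ)) :=
  (measurable_bracket.pow_const _).ennreal_ofReal

lemma zt_tsum_le {ι : Type*} [Countable ι] {u : ι → ℝ → ℝ≥0∞} (hu : ∀ i, Measurable (u i)) :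
    zt (fun x => ∑' i, u i x) ≤ ∑' i, zt (u i) := by
  unfold zt
  rw [ENNReal.tsum_add]
  refine add_le_add ?_ (lintegral_tsum fun i => (hu i).aemeasurable).le
  simp_rw [← ENNReal.tsum_mul_left]
  exact lintegral_Lp_tsum_le (by norm_num) (fun i x => ENNReal.ofReal (bracket x ^ (1 / 2 : ℝ)) *
    u i x) fun i => (measurable_weight.mul (hu i)).aemeasurable

lemma zt_add_le {u v : ℝ → ℝ≥0∞} (hu : Measurable u) (hv : Measurable v) :
    zt (fun x => u x + v x) ≤ zt u + zt v := by
  have := zt_tsum_le (u := fun b : Bool => if b then u else v)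
    (by rintro (_ | _) <;> simp [hu, hv])
  simpa [tsum_bool, add_comm] using this

lemma lintegral_mul_le_l2 {u v : ℝ → ℝ≥0∞} (hu : Measurable u) (hv : Measurable v) :
    ∫⁻ x, u x * v x ≤ l2 u * l2 v :=
  ENNReal.lintegral_mul_le_Lp_mul_Lq volume Real.HolderConjugate.two_two hu.aemeasurable
    hv.aemeasurable

/-- The inverse bracket in `[0, ∞]`. -/
def ib (x : ℝ) : ℝ≥0∞ := ENNReal.ofReal (bracket x)⁻¹

lemma measurable_ib : Measurable ib := measurable_bracket.inv.ennreal_ofReal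

lemma weight_mul_ib (x : ℝ) : ENNReal.ofReal (bracket x ^ (1 / 2 : ℝ)) * ib x =
    ENNReal.ofReal (bracket x ^ (-(1 / 2) : ℝ)) := by
  rw [ib, ← ENNReal.ofReal_mul (Real.rpow_nonneg (bracket_pos x).le _), ← Real.rpow_neg_one,
    ← Real.rpow_add (bracket_pos x)]
  norm_num

lemma lintegral_ib_sq_Ioi {m : ℝ} (hm : 0 < m) :
    ∫⁻ x in Set.Ioi m, ib x ^ (2 : ℝ) ≤ ENNReal.ofReal m⁻¹ := by
  have h1 : ∫ x in Set.Ioi m, x ^ (-2 : ℝ) = m⁻¹ := by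
    rw [integral_Ioi_rpow_of_lt (by norm_num) hm]
    norm_num
    exact Real.rpow_neg_one m
  rw [← h1, ofReal_integral_eq_lintegral_ofReal]
  · refine lintegral_mono_ae ?_
    filter_upwards [ae_restrict_mem measurableSet_Ioi] with x hx
    have hx0 : 0 < x := hm.trans hx
    rw [ib, ENNReal.ofReal_rpow_of_nonneg (inv_nonneg.2 (bracket_pos x).le) (by norm_num)]
    refine ENNReal.ofReal_le_ofReal ?_
    rw [← Real.rpow_neg_one, ← Real.rpow_mul (bracket_pos x).le, neg_one_mul]
    exact Real.rpow_le_rpow_of_nonpos hx0 ((le_abs_self x).trans (abs_le_bracket x)) (by norm_num)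
  · exact integrableOn_Ioi_rpow_of_lt (by norm_num) hm
  · filter_upwards [ae_restrict_mem measurableSet_Ioi] with x hx
    exact Real.rpow_nonneg (hm.trans hx).le _

lemma bracket_neg (x : ℝ) : bracket (-x) = bracket x := by simp [bracket]

lemma lintegral_ib_sq_tail {m : ℝ} (hm : 0 < m) :
    ∫⁻ x in {x : ℝ | m < |x|}, ib x ^ (2 : ℝ) ≤ ENNReal.ofReal (2 * m⁻¹) := by
  have h1 : {x : ℝ | m < |x|} ⊆ Set.Ioi m ∪ Set.Iio (-m) := by
    intro x hx
    rcases lt_abs.1 (show m < |x| from hx) with h | h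
    · exact Or.inl h
    · exact Or.inr (by simp only [Set.mem_Iio]; linarith)
  have h2 : ∫⁻ x in Set.Iio (-m), ib x ^ (2 : ℝ) = ∫⁻ x in Set.Ioi m, ib x ^ (2 : ℝ) := by
    have := (Measure.measurePreserving_neg (volume : Measure ℝ)).setLIntegral_comp_preimage
      (s := Set.Iio (-m)) measurableSet_Iio (f := fun x => ib x ^ (2 : ℝ))
      (measurable_ib.pow_const _)
    rw [← this]
    simp [ib, bracket_neg]
  calc _ ≤ ∫⁻ x in Set.Ioi m ∪ Set.Iio (-m), ib x ^ (2 : ℝ) := lintegral_mono_set h1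
    _ ≤ _ := lintegral_union_le _ _ _
    _ ≤ ENNReal.ofReal m⁻¹ + ENNReal.ofReal m⁻¹ := by
        rw [h2]
        exact add_le_add (lintegral_ib_sq_Ioi hm) (lintegral_ib_sq_Ioi hm)
    _ = _ := by rw [← ENNReal.ofReal_add (by positivity) (by positivity)]; congr 1; ring

lemma l2_ib_le : l2 ib ≤ 2 := by
  have h1 : ∫⁻ x, ib x ^ (2 : ℝ) ≤ 4 := by
    have hu : (Set.univ : Set ℝ) = {x : ℝ | 1 < |x|} ∪ Set.Icc (-1) 1 := by
      ext x
      simp only [Set.mem_univ, Set.mem_union, Set.mem_ofPred_eq, Set.mem_Icc, true_iff]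
      rcases lt_or_ge 1 |x| with h | h
      · exact Or.inl h
      · exact Or.inr (abs_le.1 h)
    rw [← setLIntegral_univ, hu]
    refine (lintegral_union_le _ _ _).trans ?_
    have h2 : ∫⁻ x in Set.Icc (-1 : ℝ) 1, ib x ^ (2 : ℝ) ≤ 2 := by
      calc _ ≤ ∫⁻ x in Set.Icc (-1 : ℝ) 1, 1 := by
            refine lintegral_mono fun x => ?_
            refine ENNReal.rpow_le_one ?_ (by norm_num)
            rw [ib, ENNReal.ofReal_le_one]
            exact inv_le_one_of_one_le₀ (one_le_bracket x)
        _ = 2 := by rw [setLIntegral_const, Real.volume_Icc]; norm_num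
    have h3 := lintegral_ib_sq_tail (m := 1) (by norm_num)
    rw [inv_one, mul_one, ENNReal.ofReal_ofNat] at h3
    calc _ ≤ (2 : ℝ≥0∞) + 2 := add_le_add h3 h2
      _ = 4 := by norm_num
  unfold l2
  rw [one_div, ENNReal.rpow_inv_le_iff (by norm_num)]
  exact h1.trans (by norm_num)

/-- One inverse bracket times an L² function pays for both parts of the norm: half a bracket for the
weighted L² part, and Cauchy–Schwarz with ⟨x⟩^{-1} ∈ L² for the L¹ part. -/
lemma zt_le_of_ib {u V : ℝ → ℝ≥0∞} (hV : Measurable V) (h : ∀ x, u x ≤ ib x * V x) :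
    zt u ≤ 3 * l2 V := by
  refine (zt_mono h).trans ?_
  have h1 : (∫⁻ x, (ENNReal.ofReal (bracket x ^ (1 / 2 : ℝ)) * (ib x * V x)) ^ (2 : ℝ)) ^
      (1 / (2 : ℝ)) ≤ l2 V := by
    refine l2_mono (u := fun x => ENNReal.ofReal (bracket x ^ (1 / 2 : ℝ)) * (ib x * V x))
      fun x => ?_
    rw [← mul_assoc, weight_mul_ib]
    calc _ ≤ 1 * V x := by
          gcongr
          rw [ENNReal.ofReal_le_one]
          exact Real.rpow_le_one_of_one_le_of_nonpos (one_le_bracket x) (by norm_num)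
      _ = _ := one_mul _
  have h2 : ∫⁻ x, ib x * V x ≤ 2 * l2 V :=
    (lintegral_mul_le_l2 measurable_ib hV).trans (mul_le_mul' l2_ib_le le_rfl)
  calc _ ≤ l2 V + 2 * l2 V := add_le_add h1 h2
    _ = _ := by ring

/-- On |x| > m the spare half bracket gives m^{-1/2} in the weighted L² part, and the L² tail of
⟨x⟩^{-1} gives the same power in the L¹ part. -/
lemma zt_le_of_tail {u V : ℝ → ℝ≥0∞} (hV : Measurable V) {m : ℝ} (hm : 0 < m)
    (h : ∀ x, u x ≤ {x : ℝ | m < |x|}.indicator (fun x => ib x * V x) x) :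
    zt u ≤ 3 * ENNReal.ofReal (m ^ (-(1 / 2) : ℝ)) * l2 V := by
  have hS : MeasurableSet {x : ℝ | m < |x|} := measurableSet_lt measurable_const
    continuous_abs.measurable
  refine (zt_mono h).trans ?_
  have h1 : (∫⁻ x, (ENNReal.ofReal (bracket x ^ (1 / 2 : ℝ)) *
      {x : ℝ | m < |x|}.indicator (fun x => ib x * V x) x) ^ (2 : ℝ)) ^
      (1 / (2 : ℝ)) ≤ ENNReal.ofReal (m ^ (-(1 / 2) : ℝ)) * l2 V := by
    have e : ENNReal.ofReal (m ^ (-(1 / 2) : ℝ)) * l2 V =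
        l2 fun x => ENNReal.ofReal (m ^ (-(1 / 2) : ℝ)) * V x := by
      unfold l2
      simp_rw [ENNReal.mul_rpow_of_nonneg _ _ (by norm_num : (0 : ℝ) ≤ 2)]
      rw [lintegral_const_mul _ (hV.pow_const _), ENNReal.mul_rpow_of_nonneg _ _ (by norm_num),
        ← ENNReal.rpow_mul]
      norm_num
    rw [e]
    refine l2_mono (u := fun x => ENNReal.ofReal (bracket x ^ (1 / 2 : ℝ)) *
      {x : ℝ | m < |x|}.indicator (fun x => ib x * V x) x) fun x => ?_
    by_cases hx : x ∈ {x : ℝ | m < |x|}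
    · rw [Set.indicator_of_mem hx, ← mul_assoc, weight_mul_ib]
      gcongr ENNReal.ofReal ?_ * _
      exact Real.rpow_le_rpow_of_nonpos hm (hx.le.trans (abs_le_bracket x)) (by norm_num)
    · rw [Set.indicator_of_notMem hx]; simp
  have h2 : ∫⁻ x, {x : ℝ | m < |x|}.indicator (fun x => ib x * V x) x ≤
      2 * ENNReal.ofReal (m ^ (-(1 / 2) : ℝ)) * l2 V := by
    have e (x : ℝ) : {x : ℝ | m < |x|}.indicator (fun x => ib x * V x) x =
        {x : ℝ | m < |x|}.indicator ib x * V x := by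
      by_cases hx : x ∈ {x : ℝ | m < |x|} <;> simp [*]
    simp_rw [e]
    refine (lintegral_mul_le_l2 (measurable_ib.indicator hS) hV).trans ?_
    refine mul_le_mul' ?_ le_rfl
    have e2 (x : ℝ) : {x : ℝ | m < |x|}.indicator ib x ^ (2 : ℝ) =
        {x : ℝ | m < |x|}.indicator (fun x => ib x ^ (2 : ℝ)) x := by
      by_cases hx : x ∈ {x : ℝ | m < |x|} <;> simp [*]
    unfold l2
    simp_rw [e2]
    rw [lintegral_indicator hS, one_div, ENNReal.rpow_inv_le_iff (by norm_num)]
    refine (lintegral_ib_sq_tail hm).trans ?_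
    rw [ENNReal.mul_rpow_of_nonneg _ _ (by norm_num),
      ENNReal.ofReal_rpow_of_nonneg (by positivity) (by norm_num), ← Real.rpow_mul hm.le,
      ENNReal.ofReal_mul (by norm_num)]
    norm_num
    rw [Real.rpow_neg_one]
    gcongr
    norm_num
  calc _ ≤ ENNReal.ofReal (m ^ (-(1 / 2) : ℝ)) * l2 V +
      2 * ENNReal.ofReal (m ^ (-(1 / 2) : ℝ)) * l2 V := add_le_add h1 h2
    _ = _ := by ring

/-! ### Compactly supported extension of a Duhamel integral -/

section

/-- The primitive of `ψ` that vanishes at `-2`. -/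
def prim (ψ : ℝ → ℂ) (t : ℝ) : ℂ := ∫ s in (-2 : ℝ)..t, ψ s

variable {ψ : ℝ → ℂ}

lemma integrable_of_support (hm : Measurable ψ) (hs : supNorm ψ ≠ ∞) {c d : ℝ}
    (h0 : ∀ t ∉ Set.Icc c d, ψ t = 0) : Integrable ψ := by
  rw [← integrableOn_iff_integrable_of_support_subset (s := Set.Icc c d)]
  · refine Measure.integrableOn_of_bounded (M := (supNorm ψ).toReal) (by simp)
      hm.aestronglyMeasurable (ae_of_all _ fun t => norm_le_supNorm hs t)
  · intro t ht
    by_contra h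
    exact ht (h0 t h)

lemma eLpNorm_two_le_supNorm {c d : ℝ} (hcd : c ≤ d) (h0 : ∀ t ∉ Set.Icc c d, ψ t = 0) :
    eLpNorm ψ 2 volume ≤ ENNReal.ofReal (√(d - c)) * supNorm ψ :=
  eLpNorm_two_le_of_support measurableSet_Icc (by linarith) (by rw [Real.volume_Icc])
    (fun t _ => enorm_le_supNorm ψ t) h0

lemma memLp_two_of_support (hm : Measurable ψ) (hs : supNorm ψ ≠ ∞) {c d : ℝ} (hcd : c ≤ d)
    (h0 : ∀ t ∉ Set.Icc c d, ψ t = 0) : MemLp ψ 2 volume :=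
  ⟨hm.aestronglyMeasurable, (eLpNorm_two_le_supNorm hcd h0).trans_lt (by finiteness)⟩

lemma prim_eq_zero (h0 : ∀ t ∉ Set.Icc (-2 : ℝ) 2, ψ t = 0) (hz : ∫ t, ψ t = 0) (t : ℝ)
    (ht : t ∉ Set.Icc (-2 : ℝ) 2) : prim ψ t = 0 := by
  unfold prim
  rcases lt_or_ge t (-2) with h | h
  · rw [intervalIntegral.integral_symm, intervalIntegral.integral_of_le h.le,
      ← integral_Ico_eq_integral_Ioc, neg_eq_zero]
    refine setIntegral_eq_zero_of_forall_eq_zero fun s hs => h0 s fun h' => ?_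
    linarith [hs.2, h'.1]
  · have h2 : 2 < t := by
      by_contra h3
      exact ht ⟨h, le_of_not_gt h3⟩
    rw [intervalIntegral.integral_of_le h, ← integral_Icc_eq_integral_Ioc,
      setIntegral_eq_integral_of_forall_compl_eq_zero, hz]
    intro s hs
    refine h0 s fun h' => hs ⟨h'.1, h'.2.trans h2.le⟩

lemma prim_eq_integral (h0 : ∀ t ∉ Set.Icc (-2 : ℝ) 2, ψ t = 0) {t : ℝ} (ht : -2 ≤ t) :
    prim ψ t = ∫ s, (Set.Iic t).indicator ψ s := by
  unfold prim
  rw [integral_indicator measurableSet_Iic, intervalIntegral.integral_of_le ht,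
    ← integral_Icc_eq_integral_Ioc, ← Set.Ici_inter_Iic,
    ← Measure.restrict_restrict measurableSet_Ici,
    setIntegral_eq_integral_of_forall_compl_eq_zero]
  intro s hs
  exact h0 s fun h => hs h.1

/-- Integration by parts for a merely bounded measurable ψ, done by Fubini on the triangle s ≤ t of
[-2, 2]². The boundary term at t = 2 is a multiple of ∫ψ and vanishes. -/
lemma ft_prim (hm : Measurable ψ) (hs : supNorm ψ ≠ ∞)
    (h0 : ∀ t ∉ Set.Icc (-2 : ℝ) 2, ψ t = 0) (hz : ∫ t, ψ t = 0) (x : ℝ) :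
    Complex.I * x * ft (prim ψ) x = -ft ψ x := by
  rcases eq_or_ne x 0 with rfl | hx
  · simp [ft, hz]
  set e : ℝ → ℂ := fun t => Complex.exp (Complex.I * (t * x : ℝ)) with he
  have hec : Continuous e := by rw [he]; fun_prop
  set S : Set (ℝ × ℝ) := {q | q.1 ∈ Set.Icc (-2 : ℝ) 2 ∧ q.2 ≤ q.1} with hS
  have hSm : MeasurableSet S := (measurableSet_Icc.preimage measurable_fst).inter
    (measurableSet_le measurable_snd measurable_fst)
  set K : ℝ → ℝ → ℂ := fun t s => S.indicator (fun q => e q.1 * ψ q.2) (t, s) with hK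
  have hKm : Measurable (Function.uncurry K) :=
    ((hec.measurable.comp measurable_fst).mul (hm.comp measurable_snd)).indicator hSm
  have hKi : Integrable (Function.uncurry K) (volume.prod volume) := by
    rw [← integrableOn_iff_integrable_of_support_subset
      (s := Set.Icc (-2 : ℝ) 2 ×ˢ Set.Icc (-2 : ℝ) 2)]
    · refine Measure.integrableOn_of_bounded (M := (supNorm ψ).toReal) ?_
        hKm.aestronglyMeasurable (ae_of_all _ fun q => ?_)
      · rw [Measure.prod_prod, Real.volume_Icc]; finiteness
      · refine (norm_indicator_le_norm_self (fun q : ℝ × ℝ => e q.1 * ψ q.2) q).trans ?_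
        rw [norm_mul, he, norm_exp_I_mul, one_mul]
        exact norm_le_supNorm hs _
    · rintro ⟨t, s⟩ hq
      have hq' : S.indicator (fun q => e q.1 * ψ q.2) (t, s) ≠ 0 := hq
      have h1 := Set.mem_of_indicator_ne_zero hq'
      rw [Set.indicator_of_mem h1] at hq'
      refine ⟨h1.1, ?_⟩
      by_contra h
      exact hq' (by simp [h0 s h])
  have h1 : ft (prim ψ) x = ∫ t, ∫ s, K t s := by
    refine integral_congr_ae (ae_of_all _ fun t => ?_)
    dsimp only
    by_cases ht : t ∈ Set.Icc (-2 : ℝ) 2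
    · rw [prim_eq_integral h0 ht.1, ← integral_const_mul]
      refine integral_congr_ae (ae_of_all _ fun s => ?_)
      simp only [hK, Set.indicator_apply, Set.mem_Iic, hS, Set.mem_ofPred_eq, ht, true_and]
      split_ifs <;> simp [he]
    · rw [prim_eq_zero h0 hz t ht]
      have : ∀ s, K t s = 0 := fun s => Set.indicator_of_notMem (fun h => ht h.1) _
      simp [this]
  have h2 (s : ℝ) : Complex.I * x * ∫ t, K t s = (e 2 - e s) * ψ s := by
    by_cases hs2 : s ∈ Set.Icc (-2 : ℝ) 2
    · have e1 : (fun t => K t s) = (Set.Icc s 2).indicator fun t => e t * ψ s := by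
        ext t
        simp only [hK, hS, Set.indicator_apply, Set.mem_Icc, Set.mem_ofPred_eq]
        congr 1
        ext
        constructor
        · rintro ⟨⟨_, h⟩, h'⟩; exact ⟨h', h⟩
        · rintro ⟨h, h'⟩; exact ⟨⟨hs2.1.trans h, h'⟩, h⟩
      rw [e1, integral_indicator measurableSet_Icc, integral_Icc_eq_integral_Ioc,
        ← intervalIntegral.integral_of_le hs2.2, intervalIntegral.integral_mul_const]
      have hc : Complex.I * x ≠ 0 := by simp [hx]
      have e2 : ∫ t in s..2, e t = (e 2 - e s) / (Complex.I * x) := by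
        have he' (t : ℝ) : e t = Complex.exp (Complex.I * x * t) := by
          simp only [he]; congr 1; push_cast; ring
        simp only [he']
        exact integral_exp_mul_complex hc
      rw [e2, ← mul_assoc, mul_div_cancel₀ _ hc]
    · have : ∀ t, K t s = 0 := fun t => by
        simp only [hK, Set.indicator_apply]
        split_ifs <;> simp [h0 s hs2]
      simp [this, h0 s hs2]
  rw [h1, integral_integral_swap hKi, ← integral_const_mul]
  simp_rw [h2, sub_mul]
  have hi := integrable_of_support hm hs h0
  rw [integral_sub]
  · rw [integral_const_mul, hz, mul_zero, zero_sub]; rfl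
  · exact hi.const_mul _
  · refine hi.bdd_mul (c := 1) hec.aestronglyMeasurable (ae_of_all _ fun t => ?_)
    rw [he, norm_exp_I_mul]

end

section

lemma l2_enorm (f : ℝ → ℂ) : l2 (fun x => ‖f x‖ₑ) = eLpNorm f 2 volume := by
  rw [eLpNorm_eq_lintegral_rpow_enorm_toReal (by norm_num) (by norm_num), l2]
  norm_num

lemma l2_add_le {u v : ℝ → ℝ≥0∞} (hu : Measurable u) (hv : Measurable v) :
    l2 (fun x => u x + v x) ≤ l2 u + l2 v :=
  ENNReal.lintegral_Lp_add_le hu.aemeasurable hv.aemeasurable (by norm_num)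

lemma l2_const_mul (c : ℝ≥0∞) {u : ℝ → ℝ≥0∞} (hu : Measurable u) :
    l2 (fun x => c * u x) = c * l2 u := by
  unfold l2
  simp_rw [ENNReal.mul_rpow_of_nonneg _ _ (by norm_num : (0 : ℝ) ≤ 2)]
  rw [lintegral_const_mul _ (hu.pow_const _), ENNReal.mul_rpow_of_nonneg _ _ (by norm_num),
    ← ENNReal.rpow_mul]
  norm_num

/-- The derivative of the extension to `ℝ` of `c + ∫_0^t e^{isφ} f(s) ds`. -/
def extDer (φ : ℝ) (c : ℂ) (f : ℝ → ℂ) (s : ℝ) : ℂ :=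
  Complex.exp (Complex.I * (s * φ : ℝ)) * f s +
    ((Set.Ico (-2 : ℝ) (-1)).indicator (fun _ => c + osc φ f 0 (-1)) s -
      (Set.Ioc (1 : ℝ) 2).indicator (fun _ => c + osc φ f 0 1) s)

/-- The extension of `c + ∫_0^t e^{isφ} f(s) ds` from `[-1, 1]` to a function supported in
`[-2, 2]` that is affine on `[-2, -1]` and on `[1, 2]`. -/
def ext (φ : ℝ) (c : ℂ) (f : ℝ → ℂ) : ℝ → ℂ := prim (extDer φ c f)

variable {φ : ℝ} {c : ℂ} {f : ℝ → ℂ}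

/-- The part of `extDer` that is supported outside `[-1, 1]`. -/
def extCorr (φ : ℝ) (c : ℂ) (f : ℝ → ℂ) (s : ℝ) : ℂ :=
  (Set.Ico (-2 : ℝ) (-1)).indicator (fun _ => c + osc φ f 0 (-1)) s -
    (Set.Ioc (1 : ℝ) 2).indicator (fun _ => c + osc φ f 0 1) s

lemma measurable_extCorr : Measurable (extCorr φ c f) :=
  (measurable_const.indicator measurableSet_Ico).sub (measurable_const.indicator measurableSet_Ioc)

lemma measurable_extDer (hf : Measurable f) : Measurable (extDer φ c f) :=
  (measurable_exp_mul hf φ).add measurable_extCorr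

/-- The size of the integral term on `[-1, 1]`. -/
def oscSup (φ : ℝ) (f : ℝ → ℂ) : ℝ≥0∞ := supNorm ((Set.Icc (-1 : ℝ) 1).indicator (osc φ f 0))

lemma enorm_osc_le_oscSup {t : ℝ} (ht : t ∈ Set.Icc (-1 : ℝ) 1) :
    ‖osc φ f 0 t‖ₑ ≤ oscSup φ f := by
  have := enorm_le_supNorm ((Set.Icc (-1 : ℝ) 1).indicator (osc φ f 0)) t
  rwa [Set.indicator_of_mem ht] at this

/-- The size of the primitive on [-1, 1] already carries the gain ⟨φ⟩^{-1/2}, so the affine pieces,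
whose slopes are its endpoint values, carry it too. -/
lemma oscSup_le (hf : Measurable f) (hfin : timeNorm f ≠ ∞) :
    oscSup φ f ≤ 24 * (ENNReal.ofReal (bracket φ ^ (-(1 / 2) : ℝ)) * timeNorm f) := by
  refine (supNorm_le_timeNorm _).trans ?_
  refine (timeNorm_osc_le hf hfin (by norm_num) (by norm_num) (by norm_num)).trans ?_
  rw [ENNReal.ofReal_mul (Real.sqrt_nonneg _)]
  have : ENNReal.ofReal (√(1 - -1)) ≤ 2 := by
    rw [show (2 : ℝ≥0∞) = ENNReal.ofReal 2 by simp]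
    refine ENNReal.ofReal_le_ofReal ?_
    rw [Real.sqrt_le_left (by norm_num)]; norm_num
  calc _ ≤ 12 * (2 * ENNReal.ofReal (bracket φ ^ (-(1 / 2) : ℝ))) * timeNorm f := by gcongr
    _ = 12 * 2 * (ENNReal.ofReal (bracket φ ^ (-(1 / 2) : ℝ)) * timeNorm f) := by ring
    _ = _ := by norm_num

lemma enorm_extCorr_le (s : ℝ) : ‖extCorr φ c f s‖ₑ ≤ 2 * (‖c‖ₑ + oscSup φ f) := by
  have h (t : ℝ) (ht : t ∈ Set.Icc (-1 : ℝ) 1) : ‖c + osc φ f 0 t‖ₑ ≤ ‖c‖ₑ + oscSup φ f :=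
    (enorm_add_le _ _).trans (add_le_add le_rfl (enorm_osc_le_oscSup ht))
  unfold extCorr
  rw [two_mul]
  refine enorm_sub_le.trans (add_le_add ?_ ?_)
  · exact (enorm_indicator_le_enorm_self _ _).trans (h _ (by norm_num))
  · exact (enorm_indicator_le_enorm_self _ _).trans (h _ (by norm_num))

lemma extCorr_eq_zero {s : ℝ} (hs : s ∉ Set.Icc (-2 : ℝ) 2) : extCorr φ c f s = 0 := by
  unfold extCorr
  rw [Set.indicator_of_notMem, Set.indicator_of_notMem, sub_zero]
  · exact fun h => hs ⟨by linarith [h.1], h.2⟩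
  · exact fun h => hs ⟨h.1, by linarith [h.2]⟩

lemma extDer_eq_zero (h0 : ∀ t ∉ Set.Icc (-1 : ℝ) 1, f t = 0) {s : ℝ}
    (hs : s ∉ Set.Icc (-2 : ℝ) 2) : extDer φ c f s = 0 := by
  have h1 : f s = 0 := h0 s fun h => hs ⟨by linarith [h.1], by linarith [h.2]⟩
  have := extCorr_eq_zero (φ := φ) (c := c) (f := f) hs
  unfold extCorr at this
  rw [extDer, this, h1]; simp

lemma supNorm_extDer_ne_top (hs : supNorm f ≠ ∞) : supNorm (extDer φ c f) ≠ ∞ := by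
  have h2 : oscSup φ f ≠ ∞ := by
    refine ne_top_of_le_ne_top (b := supNorm f) hs (iSup_le fun t => ?_)
    by_cases ht : t ∈ Set.Icc (-1 : ℝ) 1
    · rw [Set.indicator_of_mem ht]
      refine (enorm_osc_le φ f 0 t).trans ?_
      calc _ ≤ 1 * supNorm f := by
            gcongr
            rw [ENNReal.ofReal_le_one, sub_zero]
            exact abs_le.2 ht
        _ = _ := one_mul _
    · rw [Set.indicator_of_notMem ht]; simp
  have : supNorm (extDer φ c f) ≤ supNorm f + 2 * (‖c‖ₑ + oscSup φ f) := by
    refine iSup_le fun t => (enorm_add_le _ _).trans (add_le_add ?_ (enorm_extCorr_le t))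
    rw [enorm_exp_mul]
    exact enorm_le_supNorm f t
  exact ne_top_of_le_ne_top (by finiteness) this

lemma osc_eq_zero_of_support (h0 : ∀ t ∉ Set.Icc (-1 : ℝ) 1, f t = 0) {a b : ℝ}
    (h : ∀ t, t ∈ Set.Ioo a b → t ∉ Set.Icc (-1 : ℝ) 1) (hab : a ≤ b) : osc φ f a b = 0 := by
  rw [osc, intervalIntegral.integral_of_le hab, integral_Ioc_eq_integral_Ioo]
  refine setIntegral_eq_zero_of_forall_eq_zero fun t ht => ?_
  simp [h0 t (h t ht)]

lemma prim_extDer (hf : Measurable f) (hs : supNorm f ≠ ∞) (t : ℝ) :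
    ext φ c f t = osc φ f (-2) t + ∫ s in (-2 : ℝ)..t, extCorr φ c f s := by
  rw [ext, prim, osc, ← intervalIntegral.integral_add (intervalIntegrable_exp_mul hf hs φ _ _)]
  · rfl
  · refine (integrable_of_support measurable_extCorr ?_ fun t ht =>
      extCorr_eq_zero ht).intervalIntegrable
    have := supNorm_extDer_ne_top (φ := φ) (c := c) hs
    have h2 : supNorm (extCorr φ c f) ≤ supNorm (extDer φ c f) + supNorm f := by
      refine iSup_le fun t => ?_
      have : extCorr φ c f t = extDer φ c f t - Complex.exp (Complex.I * (t * φ : ℝ)) * f t := by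
        rw [extDer, extCorr]; ring
      rw [this]
      refine enorm_sub_le.trans (add_le_add (enorm_le_supNorm _ t) ?_)
      rw [enorm_exp_mul]
      exact enorm_le_supNorm f t
    exact ne_top_of_le_ne_top (by finiteness) h2

lemma integral_extCorr (t : ℝ) (ht : t ∈ Set.Icc (-1 : ℝ) 1) :
    ∫ s in (-2 : ℝ)..t, extCorr φ c f s = c + osc φ f 0 (-1) := by
  have e (s : ℝ) (hs : s ∈ Set.Ico (-2 : ℝ) t) : extCorr φ c f s =
      (Set.Ico (-2 : ℝ) (-1)).indicator (fun _ => c + osc φ f 0 (-1)) s := by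
    rw [extCorr, Set.indicator_of_notMem (s := Set.Ioc (1 : ℝ) 2), sub_zero]
    exact fun h => by linarith [h.1, hs.2, ht.2]
  rw [intervalIntegral.integral_of_le (by linarith [ht.1]), ← integral_Ico_eq_integral_Ioc,
    setIntegral_congr_fun measurableSet_Ico e, integral_indicator measurableSet_Ico,
    Measure.restrict_restrict measurableSet_Ico, setIntegral_const]
  have : Set.Ico (-2 : ℝ) (-1) ∩ Set.Ico (-2) t = Set.Ico (-2) (-1) :=
    Set.inter_eq_left.2 (Set.Ico_subset_Ico_right ht.1)
  rw [this]
  simp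
  norm_num

/-- The ramp on [-2, -1] climbs to the value c + ∫_0^{-1} of the primitive at -1, after which only
the oscillating integrand acts. -/
lemma ext_eq (hf : Measurable f) (hs : supNorm f ≠ ∞) (h0 : ∀ t ∉ Set.Icc (-1 : ℝ) 1, f t = 0)
    {t : ℝ} (ht : t ∈ Set.Icc (-1 : ℝ) 1) : ext φ c f t = c + osc φ f 0 t := by
  rw [prim_extDer hf hs, integral_extCorr t ht]
  have h1 : osc φ f (-2) (-1) = 0 :=
    osc_eq_zero_of_support h0 (fun t ht h => by linarith [ht.2, h.1]) (by norm_num)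
  have h2 := osc_sub_osc hf hs φ (-2) (-1) t
  have h3 := osc_sub_osc hf hs φ 0 (-1) t
  rw [h1, sub_zero] at h2
  rw [h2, ← h3]; ring

/-- The ramp on [1, 2] brings the value at t = 1 back to zero; a vanishing total integral is what
makes the extension compactly supported. -/
lemma integral_extDer (hf : Measurable f) (hs : supNorm f ≠ ∞)
    (h0 : ∀ t ∉ Set.Icc (-1 : ℝ) 1, f t = 0) : ∫ t, extDer φ c f t = 0 := by
  have h1 : ∫ t, extDer φ c f t = ext φ c f 2 := by
    rw [ext, prim_eq_integral (fun t ht => extDer_eq_zero h0 ht) (by norm_num)]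
    refine integral_congr_ae (ae_of_all _ fun t => ?_)
    by_cases ht : t ≤ 2
    · simp [ht]
    · simp only [Set.indicator_apply, Set.mem_Iic, ht, if_false]
      exact extDer_eq_zero h0 fun h => ht h.2
  have h2 := ext_eq (φ := φ) (c := c) hf hs h0 (t := 1) (by norm_num)
  have h3 : ext φ c f 2 - ext φ c f 1 = ∫ t in (1 : ℝ)..2, extDer φ c f t :=
    intervalIntegral.integral_interval_sub_left
      (intervalIntegrable_of_supNorm (measurable_extDer hf) (supNorm_extDer_ne_top hs) _ _)
      (intervalIntegrable_of_supNorm (measurable_extDer hf) (supNorm_extDer_ne_top hs) _ _)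
  have h4 : ∫ t in (1 : ℝ)..2, extDer φ c f t = -(c + osc φ f 0 1) := by
    have e (s : ℝ) (hs : s ∈ Set.Ioc (1 : ℝ) 2) : extDer φ c f s = -(c + osc φ f 0 1) := by
      rw [extDer, h0 s (fun h => by linarith [h.2, hs.1]), Set.indicator_of_mem hs,
        Set.indicator_of_notMem]
      · ring
      · exact fun h => by linarith [h.2, hs.1]
    rw [intervalIntegral.integral_of_le (by norm_num), setIntegral_congr_fun measurableSet_Ioc e,
      setIntegral_const]
    simp
    norm_num
  rw [h1, ← sub_add_cancel (ext φ c f 2) (ext φ c f 1), h3, h4, h2]; ring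

lemma continuous_ext (hf : Measurable f) (hs : supNorm f ≠ ∞) : Continuous (ext φ c f) :=
  intervalIntegral.continuous_primitive (fun a b => intervalIntegrable_of_supNorm
    (measurable_extDer hf) (supNorm_extDer_ne_top hs) a b) _

lemma ext_eq_zero (hf : Measurable f) (hs : supNorm f ≠ ∞)
    (h0 : ∀ t ∉ Set.Icc (-1 : ℝ) 1, f t = 0) (t : ℝ) (ht : t ∉ Set.Icc (-2 : ℝ) 2) :
    ext φ c f t = 0 :=
  prim_eq_zero (fun _ h => extDer_eq_zero h0 h) (integral_extDer hf hs h0) t ht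

/-- The bound is by `oscSup`, which has the gain in φ, and not by the supremum of f, which does not.
-/
lemma supNorm_ext_le (hf : Measurable f) (hs : supNorm f ≠ ∞)
    (h0 : ∀ t ∉ Set.Icc (-1 : ℝ) 1, f t = 0) :
    supNorm (ext φ c f) ≤ 10 * (‖c‖ₑ + oscSup φ f) := by
  refine iSup_le fun t => ?_
  by_cases ht : t ∈ Set.Icc (-2 : ℝ) 2
  swap
  · rw [ext_eq_zero hf hs h0 t ht]; simp
  rw [prim_extDer hf hs]
  have h1 : ‖osc φ f (-2) t‖ₑ ≤ 2 * oscSup φ f := by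
    have hm : osc φ f (-2) (-1) = 0 :=
      osc_eq_zero_of_support h0 (fun t ht h => by linarith [ht.2, h.1]) (by norm_num)
    have h2 (u : ℝ) (hu : u ∈ Set.Icc (-1 : ℝ) 1) : ‖osc φ f (-2) u‖ₑ ≤ 2 * oscSup φ f := by
      have e1 := osc_sub_osc hf hs φ (-2) (-1) u
      have e2 := osc_sub_osc hf hs φ 0 (-1) u
      rw [hm, sub_zero] at e1
      rw [e1, ← e2, two_mul]
      exact enorm_sub_le.trans (add_le_add (enorm_osc_le_oscSup hu)
        (enorm_osc_le_oscSup (by norm_num)))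
    rcases lt_or_ge t (-1) with h | h
    · rw [osc_eq_zero_of_support h0 (fun t ht h => by linarith [ht.2, h.1]) ht.1]; simp
    rcases le_or_gt t 1 with h' | h'
    · exact h2 t ⟨h, h'⟩
    · have e1 := osc_sub_osc hf hs φ (-2) 1 t
      have e2 : osc φ f 1 t = 0 :=
        osc_eq_zero_of_support h0 (fun t ht h => by linarith [ht.1, h.2]) h'.le
      rw [e2, sub_eq_zero] at e1
      rw [e1]; exact h2 1 (by norm_num)
  have h3 : ‖∫ s in (-2 : ℝ)..t, extCorr φ c f s‖ₑ ≤ 4 * (2 * (‖c‖ₑ + oscSup φ f)) := by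
    rw [intervalIntegral.integral_of_le ht.1]
    refine (enorm_integral_le_lintegral_enorm _).trans ?_
    refine (lintegral_mono fun s => enorm_extCorr_le s).trans ?_
    rw [setLIntegral_const, Real.volume_Ioc, mul_comm]
    gcongr
    rw [show (4 : ℝ≥0∞) = ENNReal.ofReal 4 by simp]
    exact ENNReal.ofReal_le_ofReal (by linarith [ht.2])
  calc _ ≤ 2 * oscSup φ f + 4 * (2 * (‖c‖ₑ + oscSup φ f)) :=
        (enorm_add_le _ _).trans (add_le_add h1 h3)
    _ ≤ 2 * (‖c‖ₑ + oscSup φ f) + 4 * (2 * (‖c‖ₑ + oscSup φ f)) := by gcongr; exact le_add_self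
    _ = _ := by ring

lemma enorm_ft_le (g : ℝ → ℂ) (h0 : ∀ t ∉ Set.Icc (-2 : ℝ) 2, g t = 0) (x : ℝ) :
    ‖ft g x‖ₑ ≤ 4 * supNorm g := by
  refine (enorm_integral_le_lintegral_enorm _).trans ?_
  calc ∫⁻ t, ‖Complex.exp (Complex.I * (t * x : ℝ)) * g t‖ₑ
      ≤ ∫⁻ t, (Set.Icc (-2 : ℝ) 2).indicator (fun _ => supNorm g) t := by
        refine lintegral_mono fun t => ?_
        rw [enorm_exp_mul]
        by_cases ht : t ∈ Set.Icc (-2 : ℝ) 2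
        · rw [Set.indicator_of_mem ht]; exact enorm_le_supNorm g t
        · simp [h0 t ht]
    _ = _ := by
        rw [lintegral_indicator measurableSet_Icc, setLIntegral_const, Real.volume_Icc, mul_comm]
        norm_num

lemma ofReal_sqrt_two_pi_le : ENNReal.ofReal (√(2 * Real.pi)) ≤ 3 := by
  rw [show (3 : ℝ≥0∞) = ENNReal.ofReal 3 by simp]
  refine ENNReal.ofReal_le_ofReal ?_
  rw [Real.sqrt_le_left (by norm_num)]
  linarith [Real.pi_lt_four]

/-- For low time frequencies the Fourier integral is controlled by that of an increment. -/
lemma enorm_ft_le_incr (hf : Measurable f) (hs : supNorm f ≠ ∞)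
    (h0 : ∀ t ∉ Set.Icc (-1 : ℝ) 1, f t = 0) {h : ℝ} (hφ : |φ| * h = Real.pi) (hh : 0 < h)
    {x : ℝ} (hx : |x| ≤ |φ| / 2) :
    ‖ft (fun s : ℝ => Complex.exp (Complex.I * (s * φ : ℝ)) * f s) x‖ₑ ≤
      ‖ft (fun s : ℝ => Complex.exp (Complex.I * (s * φ : ℝ)) * incr h f s) x‖ₑ := by
  set g : ℝ → ℂ := fun s : ℝ => Complex.exp (Complex.I * (s * φ : ℝ)) * f s with hg
  set E : ℝ → ℂ := fun s => Complex.exp (Complex.I * (s * x : ℝ)) * g s with hE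
  have hgi : Integrable g := integrable_of_support (measurable_exp_mul hf φ)
    (by rwa [supNorm_exp_mul]) (c := -1) (d := 1) fun t ht => by simp [hg, h0 t ht]
  have hEi : Integrable E := by
    refine hgi.bdd_mul (c := 1) (by fun_prop) (ae_of_all _ fun t => ?_)
    rw [norm_exp_I_mul]
  have hper : Complex.exp (Complex.I * ((h * φ : ℝ) : ℂ)) = -1 := by
    rcases abs_cases φ with ⟨h1, _⟩ | ⟨h1, _⟩
    · rw [h1] at hφ
      rw [mul_comm h, hφ, mul_comm, Complex.exp_pi_mul_I]
    · rw [h1] at hφ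
      have : h * φ = -Real.pi := by linarith
      rw [this, Complex.ofReal_neg, mul_neg, Complex.exp_neg, mul_comm, Complex.exp_pi_mul_I]
      norm_num
  set w : ℂ := Complex.exp (Complex.I * ((-(h * x) : ℝ) : ℂ)) with hw
  have hpt (s : ℝ) : Complex.exp (Complex.I * (s * x : ℝ)) *
      (Complex.exp (Complex.I * (s * φ : ℝ)) * incr h f s) = -w * E (s + h) - E s := by
    have e1 : Complex.exp (Complex.I * ((s + h) * φ : ℝ)) =
        -Complex.exp (Complex.I * (s * φ : ℝ)) := by
      have : Complex.I * (((s + h) * φ : ℝ) : ℂ) =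
          Complex.I * ((s * φ : ℝ) : ℂ) + Complex.I * ((h * φ : ℝ) : ℂ) := by push_cast; ring
      rw [this, Complex.exp_add, hper]; ring
    have e2 : w * Complex.exp (Complex.I * ((s + h) * x : ℝ)) =
        Complex.exp (Complex.I * (s * x : ℝ)) := by
      rw [hw, ← Complex.exp_add]
      congr 1
      push_cast; ring
    simp only [hE, hg, incr]
    rw [e1]
    linear_combination (-Complex.exp (Complex.I * (s * φ : ℝ)) * f (s + h)) * e2
  -- Translation by h multiplies the Fourier integral by w = e^{-ihx}, and the modulation changes
  -- sign over half a period. For |x| ≤ |φ|/2 one has |hx| ≤ π/2, so Re w ≥ 0 and |1 + w| ≥ 1.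
  have key : ft (fun s : ℝ => Complex.exp (Complex.I * (s * φ : ℝ)) * incr h f s) x =
      -(1 + w) * ft g x := by
    have h1 : ∫ s, E (s + h) = ∫ s, E s := integral_add_right_eq_self E h
    rw [ft]
    simp_rw [hpt]
    rw [integral_sub ((hEi.comp_add_right h).const_mul _) hEi, integral_const_mul, h1]
    change -w * ft g x - ft g x = _
    ring
  rw [key, enorm_mul]
  have hre : 1 ≤ ‖-(1 + w)‖ := by
    rw [norm_neg]
    refine le_trans ?_ (Complex.re_le_norm _)
    have : w.re = Real.cos (h * x) := by
      rw [hw, mul_comm, Complex.exp_ofReal_mul_I_re, Real.cos_neg]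
    rw [Complex.add_re, Complex.one_re, this]
    have hb : |h * x| ≤ Real.pi / 2 := by
      rw [abs_mul, abs_of_pos hh]
      calc h * |x| ≤ h * (|φ| / 2) := by gcongr
        _ = Real.pi / 2 := by rw [← hφ]; ring
    have := Real.cos_nonneg_of_neg_pi_div_two_le_of_le (abs_le.1 hb).1 (abs_le.1 hb).2
    linarith
  calc ‖ft g x‖ₑ = 1 * ‖ft g x‖ₑ := (one_mul _).symm
    _ ≤ _ := by
      gcongr
      rw [← ofReal_norm]
      simpa using ENNReal.ofReal_le_ofReal hre

end

section

variable {φ : ℝ} {c : ℂ} {f : ℝ → ℂ}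

/-- The function `f` modulated to frequency `φ`. -/
def modu (φ : ℝ) (f : ℝ → ℂ) (s : ℝ) : ℂ := Complex.exp (Complex.I * (s * φ : ℝ)) * f s

lemma enorm_modu (φ : ℝ) (f : ℝ → ℂ) (s : ℝ) : ‖modu φ f s‖ₑ = ‖f s‖ₑ := enorm_exp_mul _ _

lemma l2_ft_le {g : ℝ → ℂ} (hi : Integrable g) (h2 : MemLp g 2 volume) :
    l2 (fun x => ‖ft g x‖ₑ) ≤ 3 * eLpNorm g 2 volume := by
  rw [l2_enorm, eLpNorm_ft hi h2]
  exact mul_le_mul' ofReal_sqrt_two_pi_le le_rfl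

lemma enorm_ofReal_mul_le_ib {x : ℝ} (hx : 1 < |x|) {z : ℂ} {W : ℝ≥0∞}
    (h : ‖(x : ℂ) * z‖ₑ ≤ W) : ‖z‖ₑ ≤ ib x * (2 * W) := by
  have hb : ENNReal.ofReal |x|⁻¹ ≤ ib x * 2 := by
    rw [ib, show (2 : ℝ≥0∞) = ENNReal.ofReal 2 by simp,
      ← ENNReal.ofReal_mul (inv_nonneg.2 (bracket_pos x).le)]
    refine ENNReal.ofReal_le_ofReal ?_
    rw [inv_mul_eq_div, inv_eq_one_div, div_le_div_iff₀ (by linarith) (bracket_pos x)]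
    linarith [bracket_le x]
  have hx0 : |x| ≠ 0 := by linarith
  calc ‖z‖ₑ = ENNReal.ofReal |x|⁻¹ * ‖(x : ℂ) * z‖ₑ := by
        rw [enorm_mul, ← mul_assoc, ← ofReal_norm (x : ℂ), Complex.norm_real, Real.norm_eq_abs,
          ← ENNReal.ofReal_mul (by positivity), inv_mul_cancel₀ hx0]
        simp
    _ ≤ ib x * 2 * W := mul_le_mul' hb h
    _ = _ := mul_assoc _ _ _

/-- Three ranges of time frequency. For |x| ≤ 1 the supremum of the extension suffices. For |x| > 1
one divides the transform of the derivative by x; its ramps are bounded in L², and its modulated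
part is replaced by D when |x| ≤ m and gains m^{-1/2} when |x| > m. -/
lemma zt_ext_le_aux (hf : Measurable f) (hs : supNorm f ≠ ∞)
    (h0 : ∀ t ∉ Set.Icc (-1 : ℝ) 1, f t = 0) {D : ℝ → ℂ} {m : ℝ} (hm : 1 ≤ m)
    (hD : Integrable D) (hD2 : MemLp D 2 volume)
    (h : ∀ x, 1 < |x| → |x| ≤ m → ‖ft (modu φ f) x‖ₑ ≤ ‖ft D x‖ₑ) :
    zt (fun x => ‖ft (ext φ c f) x‖ₑ) ≤ 600 * (‖c‖ₑ + oscSup φ f) +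
      18 * eLpNorm D 2 volume + 36 * (ENNReal.ofReal (m ^ (-(1 / 2) : ℝ)) * supNorm f) := by
  set A := ‖c‖ₑ + oscSup φ f with hA
  set I : ℝ → ℝ≥0∞ := (Set.Icc (-1 : ℝ) 1).indicator fun _ => 80 * A with hI
  have hce : supNorm (extCorr φ c f) ≠ ∞ := by
    have h2 : supNorm (extCorr φ c f) ≤ supNorm (extDer φ c f) + supNorm f := by
      refine iSup_le fun t => ?_
      have : extCorr φ c f t = extDer φ c f t - Complex.exp (Complex.I * (t * φ : ℝ)) * f t := by
        rw [extDer, extCorr]; ring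
      rw [this]
      refine enorm_sub_le.trans (add_le_add (enorm_le_supNorm _ t) ?_)
      rw [enorm_exp_mul]
      exact enorm_le_supNorm f t
    exact ne_top_of_le_ne_top (ENNReal.add_ne_top.2 ⟨supNorm_extDer_ne_top hs, hs⟩) h2
  have hci : Integrable (extCorr φ c f) :=
    integrable_of_support measurable_extCorr hce fun t ht => extCorr_eq_zero ht
  have hc2 : MemLp (extCorr φ c f) 2 volume :=
    memLp_two_of_support measurable_extCorr hce (by norm_num) fun t ht => extCorr_eq_zero ht
  have hm0 : ∀ t ∉ Set.Icc (-1 : ℝ) 1, modu φ f t = 0 := fun t ht => by simp [modu, h0 t ht]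
  have hmm : Measurable (modu φ f) := measurable_exp_mul hf φ
  have hms : supNorm (modu φ f) = supNorm f := supNorm_exp_mul f φ
  have hmi : Integrable (modu φ f) := integrable_of_support hmm (by rwa [hms]) hm0
  have hm2 : MemLp (modu φ f) 2 volume :=
    memLp_two_of_support hmm (by rwa [hms]) (by norm_num) hm0
  have mI : Measurable I := measurable_const.indicator measurableSet_Icc
  have mft {g : ℝ → ℂ} (hg : Integrable g) : Measurable fun x => ‖ft g x‖ₑ :=
    (continuous_ft hg).measurable.enorm
  have mT : Measurable ({x : ℝ | m < |x|}.indicator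
      fun x => ib x * (2 * ‖ft (modu φ f) x‖ₑ)) :=
    (measurable_ib.mul ((mft hmi).const_mul 2)).indicator
      (measurableSet_lt measurable_const continuous_abs.measurable)
  have key (x : ℝ) : ‖ft (ext φ c f) x‖ₑ ≤
      (ib x * (I x + (2 * ‖ft (extCorr φ c f) x‖ₑ + 2 * ‖ft D x‖ₑ))) +
      {x : ℝ | m < |x|}.indicator (fun x => ib x * (2 * ‖ft (modu φ f) x‖ₑ)) x := by
    rcases le_or_gt |x| 1 with hx | hx
    · have h1 : ‖ft (ext φ c f) x‖ₑ ≤ 4 * (10 * A) :=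
        (enorm_ft_le _ (ext_eq_zero hf hs h0) x).trans
          (mul_le_mul' le_rfl (supNorm_ext_le hf hs h0))
      have h2 : 1 ≤ ib x * 2 := by
        rw [ib, show (2 : ℝ≥0∞) = ENNReal.ofReal 2 by simp,
          ← ENNReal.ofReal_mul (inv_nonneg.2 (bracket_pos x).le), ENNReal.one_le_ofReal,
          inv_mul_eq_div, le_div_iff₀ (bracket_pos x)]
        linarith [bracket_le x]
      have h3 : I x = 80 * A := Set.indicator_of_mem (s := Set.Icc (-1 : ℝ) 1) (abs_le.1 hx) _
      calc ‖ft (ext φ c f) x‖ₑ ≤ 1 * (4 * (10 * A)) := by rwa [one_mul]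
        _ ≤ ib x * 2 * (4 * (10 * A)) := mul_le_mul' h2 le_rfl
        _ = ib x * I x := by rw [h3]; ring
        _ ≤ ib x * (I x + (2 * ‖ft (extCorr φ c f) x‖ₑ + 2 * ‖ft D x‖ₑ)) :=
          mul_le_mul' le_rfl le_self_add
        _ ≤ _ := le_self_add
    · have h1 : ‖(x : ℂ) * ft (ext φ c f) x‖ₑ ≤
          ‖ft (modu φ f) x‖ₑ + ‖ft (extCorr φ c f) x‖ₑ := by
        have h2 := ft_prim (measurable_extDer hf) (supNorm_extDer_ne_top hs)
          (fun t ht => extDer_eq_zero (φ := φ) (c := c) h0 ht) (integral_extDer hf hs h0) x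
        have h3 : ft (extDer φ c f) x = ft (modu φ f) x + ft (extCorr φ c f) x := by
          unfold ft
          rw [← integral_add]
          · refine integral_congr_ae (ae_of_all _ fun t => ?_)
            simp only [extDer, modu, extCorr]
            ring
          · exact hmi.bdd_mul (c := 1) (by fun_prop)
              (ae_of_all _ fun t => by rw [norm_exp_I_mul])
          · exact hci.bdd_mul (c := 1) (by fun_prop)
              (ae_of_all _ fun t => by rw [norm_exp_I_mul])
        calc _ = ‖Complex.I * x * ft (prim (extDer φ c f)) x‖ₑ := by
              rw [mul_assoc, enorm_mul Complex.I, ← ofReal_norm Complex.I, Complex.norm_I]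
              simp [ext]
          _ = ‖ft (modu φ f) x + ft (extCorr φ c f) x‖ₑ := by rw [h2, enorm_neg, h3]
          _ ≤ _ := enorm_add_le _ _
      have h2 := enorm_ofReal_mul_le_ib hx h1
      refine h2.trans ?_
      by_cases hxm : m < |x|
      · rw [Set.indicator_of_mem (show x ∈ {x : ℝ | m < |x|} from hxm), ← mul_add]
        refine mul_le_mul' le_rfl ?_
        rw [mul_add, add_comm]
        gcongr
        exact le_trans le_self_add le_add_self
      · refine le_trans ?_ le_self_add
        refine mul_le_mul' le_rfl ?_
        rw [mul_add, add_comm]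
        refine le_trans ?_ le_add_self
        gcongr
        exact h x hx (not_lt.1 hxm)
  have hI2 : l2 I ≤ 2 * (80 * A) := by
    unfold l2
    have e (x : ℝ) : I x ^ (2 : ℝ) =
        (Set.Icc (-1 : ℝ) 1).indicator (fun _ => (80 * A) ^ (2 : ℝ)) x := by
      by_cases hx : x ∈ Set.Icc (-1 : ℝ) 1 <;> simp [hI, hx]
    simp_rw [e]
    rw [lintegral_indicator measurableSet_Icc, setLIntegral_const, one_div,
      ENNReal.rpow_inv_le_iff (by norm_num), Real.volume_Icc,
      ENNReal.mul_rpow_of_nonneg 2 (80 * A) (by norm_num : (0 : ℝ) ≤ 2), mul_comm]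
    refine mul_le_mul' ?_ le_rfl
    rw [show (1 - -1 : ℝ) = 2 by norm_num, ENNReal.ofReal_ofNat, ENNReal.rpow_two]
    norm_num
  have hc3 : eLpNorm (extCorr φ c f) 2 volume ≤ 2 * (2 * A) := by
    refine (eLpNorm_two_le_supNorm (c := -2) (d := 2) (by norm_num)
      fun t ht => extCorr_eq_zero ht).trans ?_
    refine mul_le_mul' ?_ (iSup_le enorm_extCorr_le)
    rw [show (2 : ℝ≥0∞) = ENNReal.ofReal 2 by simp]
    refine ENNReal.ofReal_le_ofReal ?_
    rw [Real.sqrt_le_left (by norm_num)]; norm_num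
  have hm3 : eLpNorm (modu φ f) 2 volume ≤ 2 * supNorm f := by
    refine (eLpNorm_two_le_supNorm (c := -1) (d := 1) (by norm_num) hm0).trans ?_
    rw [hms]
    refine mul_le_mul' ?_ le_rfl
    rw [show (2 : ℝ≥0∞) = ENNReal.ofReal 2 by simp]
    refine ENNReal.ofReal_le_ofReal ?_
    rw [Real.sqrt_le_left (by norm_num)]; norm_num
  have mV : Measurable fun x => I x + (2 * ‖ft (extCorr φ c f) x‖ₑ + 2 * ‖ft D x‖ₑ) :=
    mI.add (((mft hci).const_mul 2).add ((mft hD).const_mul 2))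
  refine (zt_mono key).trans ((zt_add_le (measurable_ib.mul mV) mT).trans ?_)
  refine (add_le_add (zt_le_of_ib mV fun x => le_rfl)
    (zt_le_of_tail ((mft hmi).const_mul 2) (by linarith) fun x => le_rfl)).trans ?_
  have hV : l2 (fun x => I x + (2 * ‖ft (extCorr φ c f) x‖ₑ + 2 * ‖ft D x‖ₑ)) ≤
      2 * (80 * A) + (2 * (3 * (2 * (2 * A))) + 2 * (3 * eLpNorm D 2 volume)) := by
    refine (l2_add_le mI (((mft hci).const_mul 2).add ((mft hD).const_mul 2))).trans ?_
    refine add_le_add hI2 ((l2_add_le ((mft hci).const_mul 2) ((mft hD).const_mul 2)).trans ?_)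
    rw [l2_const_mul 2 (mft hci), l2_const_mul 2 (mft hD)]
    gcongr
    · exact (l2_ft_le hci hc2).trans (by gcongr)
    · exact l2_ft_le hD hD2
  have hW : l2 (fun x => 2 * ‖ft (modu φ f) x‖ₑ) ≤ 2 * (3 * (2 * supNorm f)) := by
    rw [l2_const_mul 2 (mft hmi)]
    gcongr
    exact (l2_ft_le hmi hm2).trans (by gcongr)
  calc _ ≤ 3 * (2 * (80 * A) + (2 * (3 * (2 * (2 * A))) + 2 * (3 * eLpNorm D 2 volume))) +
        3 * ENNReal.ofReal (m ^ (-(1 / 2) : ℝ)) * (2 * (3 * (2 * supNorm f))) := by gcongr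
    _ = 552 * A + 18 * eLpNorm D 2 volume +
        36 * (ENNReal.ofReal (m ^ (-(1 / 2) : ℝ)) * supNorm f) := by ring
    _ ≤ _ := by gcongr; norm_num

/-- The choice is m = |φ|/2 and D the modulated increment of f over half a period: D has L² norm at
most √h times the Besov seminorm, comparable to ⟨φ⟩^{-1/2}, and so is m^{-1/2}. -/
theorem zt_ext_le (hf : Measurable f) (hfin : timeNorm f ≠ ∞)
    (h0 : ∀ t ∉ Set.Icc (-1 : ℝ) 1, f t = 0) :
    zt (fun x => ‖ft (ext φ c f) x‖ₑ) ≤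
      20000 * (‖c‖ₑ + ENNReal.ofReal (bracket φ ^ (-(1 / 2) : ℝ)) * timeNorm f) := by
  have hs : supNorm f ≠ ∞ := ne_top_of_le_ne_top hfin (supNorm_le_timeNorm f)
  set B := ENNReal.ofReal (bracket φ ^ (-(1 / 2) : ℝ)) * timeNorm f with hB
  have hosc : oscSup φ f ≤ 24 * B := oscSup_le hf hfin
  have hbp := bracket_pos φ
  suffices H : ∃ (D : ℝ → ℂ) (m : ℝ), 1 ≤ m ∧ Integrable D ∧ MemLp D 2 volume ∧
      (∀ x, 1 < |x| → |x| ≤ m → ‖ft (modu φ f) x‖ₑ ≤ ‖ft D x‖ₑ) ∧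
      eLpNorm D 2 volume ≤ 3 * B ∧ m ^ (-(1 / 2) : ℝ) ≤ 2 * bracket φ ^ (-(1 / 2) : ℝ) by
    obtain ⟨D, m, hm, hD, hD2, h, hDB, hmb⟩ := H
    refine (zt_ext_le_aux hf hs h0 hm hD hD2 h).trans ?_
    have h3 : ENNReal.ofReal (m ^ (-(1 / 2) : ℝ)) * supNorm f ≤ 2 * B := by
      calc _ ≤ ENNReal.ofReal (2 * bracket φ ^ (-(1 / 2) : ℝ)) * timeNorm f :=
            mul_le_mul' (ENNReal.ofReal_le_ofReal hmb) (supNorm_le_timeNorm f)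
        _ = _ := by rw [ENNReal.ofReal_mul (by norm_num), hB]; simp [mul_assoc]
    calc _ ≤ 600 * (‖c‖ₑ + 24 * B) + 18 * (3 * B) + 36 * (2 * B) := by gcongr
      _ = 600 * ‖c‖ₑ + 14526 * B := by ring
      _ ≤ 20000 * ‖c‖ₑ + 20000 * B := by gcongr <;> norm_num
      _ = _ := by ring
  rcases lt_or_ge |φ| 2 with hφ | hφ
  -- For bounded φ there is nothing to gain: m = 1 empties the intermediate range, so D = 0 serves.
  · refine ⟨0, 1, le_rfl, integrable_zero _ _ _, MemLp.zero, fun x h1 h2 => absurd h1 (not_lt.2 h2),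
      by simp, ?_⟩
    rw [Real.one_rpow]
    have : (4 : ℝ) ^ (-(1 / 2) : ℝ) ≤ bracket φ ^ (-(1 / 2) : ℝ) :=
      Real.rpow_le_rpow_of_nonpos hbp (by linarith [bracket_le φ]) (by norm_num)
    rw [show (4 : ℝ) = 2 ^ (2 : ℝ) by norm_num, ← Real.rpow_mul (by norm_num)] at this
    norm_num at this ⊢
    linarith
  · set h := Real.pi / |φ| with hh
    have hφ0 : 0 < |φ| := by linarith
    have hh0 : 0 < h := by positivity
    have hmm : Measurable (modu φ (incr h f)) := measurable_exp_mul (measurable_incr hf h) φ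
    have hmn : supNorm (modu φ (incr h f)) ≠ ∞ := by
      have : supNorm (modu φ (incr h f)) ≤ supNorm f + supNorm f := by
        refine iSup_le fun t => ?_
        rw [enorm_modu]
        exact enorm_sub_le.trans (add_le_add (enorm_le_supNorm _ _) (enorm_le_supNorm _ _))
      exact ne_top_of_le_ne_top (by finiteness) this
    have hm0 : ∀ t ∉ Set.Icc (-1 - h : ℝ) 1, modu φ (incr h f) t = 0 := fun t ht => by
      rw [modu, incr, h0 t fun h' => ht ⟨by linarith [h'.1], h'.2⟩,
        h0 (t + h) fun h' => ht ⟨by linarith [h'.1], by linarith [h'.2]⟩]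
      simp
    refine ⟨modu φ (incr h f), |φ| / 2, by linarith, integrable_of_support hmm hmn hm0,
      memLp_two_of_support hmm hmn (by linarith) hm0, fun x _ hx => ?_, ?_, ?_⟩
    · refine enorm_ft_le_incr hf hs h0 (by rw [hh]; field_simp) hh0 hx
    · have h1 : eLpNorm (modu φ (incr h f)) 2 volume ≤ eLpNorm (incr h f) 2 volume :=
        eLpNorm_mono_enorm (fun t => (enorm_modu φ (incr h f) t).le) volume
      refine h1.trans ((eLpNorm_incr_le f hh0).trans ?_)
      have h2 : √h ≤ 3 * bracket φ ^ (-(1 / 2) : ℝ) := by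
        rw [Real.sqrt_le_left (by positivity), mul_pow, ← Real.rpow_natCast (bracket φ ^ _),
          ← Real.rpow_mul hbp.le]
        norm_num
        rw [Real.rpow_neg_one, hh, ← div_eq_mul_inv, div_le_div_iff₀ hφ0 hbp]
        nlinarith [bracket_le φ, Real.pi_lt_four, Real.pi_pos]
      calc _ ≤ ENNReal.ofReal (3 * bracket φ ^ (-(1 / 2) : ℝ)) * timeNorm f :=
            mul_le_mul' (ENNReal.ofReal_le_ofReal h2) (besov_le_timeNorm f)
        _ = _ := by rw [ENNReal.ofReal_mul (by norm_num), hB]; simp [mul_assoc]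
    · have h1 : (4 : ℝ) ^ (-(1 / 2) : ℝ) = 1 / 2 := by
        rw [show (4 : ℝ) = 2 ^ (2 : ℝ) by norm_num, ← Real.rpow_mul (by norm_num)]
        norm_num
      have h2 : (4 * (|φ| / 2)) ^ (-(1 / 2) : ℝ) ≤ bracket φ ^ (-(1 / 2) : ℝ) :=
        Real.rpow_le_rpow_of_nonpos hbp (by linarith [bracket_le φ]) (by norm_num)
      rw [Real.mul_rpow (by norm_num) (by positivity), h1] at h2
      linarith

end

/-! ### Extensions of series of Duhamel integrals and the restriction norm -/

lemma zt_comp_neg (u : ℝ → ℝ≥0∞) : zt (fun x => u (-x)) = zt u := by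
  have h1 := lintegral_neg_eq_self (μ := volume)
    fun x => (ENNReal.ofReal (bracket x ^ (1 / 2 : ℝ)) * u x) ^ (2 : ℝ)
  have h2 := lintegral_neg_eq_self (μ := volume) u
  simp only [bracket_neg] at h1
  rw [zt, zt, h1, h2]

lemma timeNorm_ne_top_of_tsum {ι : Type*} {φ : ι → ℝ} {f : ι → ℝ → ℂ}
    (hY : ∑' i, ENNReal.ofReal (bracket (φ i) ^ (-(1 / 2) : ℝ)) * timeNorm (f i) ≠ ∞) (i : ι) :
    timeNorm (f i) ≠ ∞ := by
  intro h
  have := ENNReal.ne_top_of_tsum_ne_top hY i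
  rw [h, ENNReal.mul_top] at this
  · exact this rfl
  · simpa using Real.rpow_pos_of_pos (bracket_pos _) _

/-- The extensions of the summands are added up, with one more for the constant c, and γ is the
reflected Fourier transform of the sum divided by 2π. Fourier inversion recovers the sum at every
time of [-1, 1]. -/
theorem exists_extension {ι : Type*} [Countable ι] {φ : ι → ℝ} {c : ℂ} {f : ι → ℝ → ℂ}
    (hf : ∀ i, Measurable (f i)) (h0 : ∀ i, ∀ t ∉ Set.Icc (-1 : ℝ) 1, f i t = 0)
    (hY : ∑' i, ENNReal.ofReal (bracket (φ i) ^ (-(1 / 2) : ℝ)) * timeNorm (f i) ≠ ∞) :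
    ∃ γ : ℝ → ℂ, Continuous γ ∧ Integrable γ ∧
      zt (fun x => ‖γ x‖ₑ) ≤ 20000 * (‖c‖ₑ +
        ∑' i, ENNReal.ofReal (bracket (φ i) ^ (-(1 / 2) : ℝ)) * timeNorm (f i)) ∧
      ∀ t ∈ Set.Icc (-1 : ℝ) 1, ∫ x, Complex.exp (Complex.I * (t * x : ℝ)) * γ x =
        c + ∑' i, osc (φ i) (f i) 0 t := by
  have hT := timeNorm_ne_top_of_tsum hY
  have hS (i : ι) : supNorm (f i) ≠ ∞ := ne_top_of_le_ne_top (hT i) (supNorm_le_timeNorm _)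
  set y : ι → ℝ≥0∞ := fun i =>
    ENNReal.ofReal (bracket (φ i) ^ (-(1 / 2) : ℝ)) * timeNorm (f i) with hy
  have m0 : Measurable (0 : ℝ → ℂ) := measurable_zero
  have t0 : timeNorm (0 : ℝ → ℂ) = 0 := timeNorm_zero
  have s0 : supNorm (0 : ℝ → ℂ) ≠ ∞ :=
    ne_top_of_le_ne_top (by rw [t0]; simp) (supNorm_le_timeNorm _)
  have hext (i : ι) : supNorm (ext (φ i) 0 (f i)) ≤ 240 * y i := by
    refine (supNorm_ext_le (hf i) (hS i) (h0 i)).trans ?_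
    rw [enorm_zero, zero_add]
    calc _ ≤ 10 * (24 * y i) := mul_le_mul' le_rfl (oscSup_le (hf i) (hT i))
      _ = _ := by ring
  have hsum : ∑' i, 240 * y i ≠ ∞ := by
    rw [ENNReal.tsum_mul_left]; exact ENNReal.mul_ne_top (by simp) hY
  have hreal : Summable fun i => (240 * y i).toReal := ENNReal.summable_toReal hsum
  have hbd (i : ι) (t : ℝ) : ‖ext (φ i) 0 (f i) t‖ ≤ (240 * y i).toReal := by
    have h1 := (enorm_le_supNorm (ext (φ i) 0 (f i)) t).trans (hext i)
    rw [← toReal_enorm]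
    exact ENNReal.toReal_mono (ENNReal.ne_top_of_tsum_ne_top hsum i) h1
  set S : ℝ → ℂ := fun t => ∑' i, ext (φ i) 0 (f i) t with hSdef
  have hSc : Continuous S := continuous_tsum (fun i => continuous_ext (hf i) (hS i)) hreal hbd
  -- The constant gets its own extension, with zero integrand; all the others start from zero.
  set E : ℝ → ℂ := ext 0 c 0 with hE
  have hEc : Continuous E := continuous_ext m0 s0
  have hE0 : ∀ t ∉ Set.Icc (-2 : ℝ) 2, E t = 0 := ext_eq_zero m0 s0 fun t _ => rfl
  have he0 (i : ι) : ∀ t ∉ Set.Icc (-2 : ℝ) 2, ext (φ i) 0 (f i) t = 0 :=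
    ext_eq_zero (hf i) (hS i) (h0 i)
  have hS0 : ∀ t ∉ Set.Icc (-2 : ℝ) 2, S t = 0 := fun t ht => by
    simp only [hSdef, he0 _ t ht, tsum_zero]
  have hci {g : ℝ → ℂ} (hg : Continuous g) (hg0 : ∀ t ∉ Set.Icc (-2 : ℝ) 2, g t = 0) :
      Integrable g :=
    hg.integrable_of_hasCompactSupport (HasCompactSupport.intro isCompact_Icc hg0)
  have hiE := hci hEc hE0
  have hiS := hci hSc hS0
  have hie (i : ι) := hci (continuous_ext (c := 0) (φ := φ i) (hf i) (hS i)) (he0 i)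
  have hmodi {g : ℝ → ℂ} (hg : Integrable g) (x : ℝ) :
      Integrable fun t : ℝ => Complex.exp (Complex.I * (t * x : ℝ)) * g t :=
    hg.bdd_mul (c := 1) (by fun_prop) (ae_of_all _ fun t => by rw [norm_exp_I_mul])
  have hftS (x : ℝ) : ft S x = ∑' i, ft (ext (φ i) 0 (f i)) x := by
    unfold ft
    simp only [hSdef]
    simp_rw [← tsum_mul_left]
    refine (integral_tsum (fun i => (hmodi (hie i) x).aestronglyMeasurable) ?_)
    simp_rw [enorm_exp_mul]
    refine ne_top_of_le_ne_top (b := ∑' i, 4 * (240 * y i)) ?_ (ENNReal.tsum_le_tsum fun i => ?_)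
    · rw [ENNReal.tsum_mul_left]; exact ENNReal.mul_ne_top (by simp) hsum
    · calc ∫⁻ t, ‖ext (φ i) 0 (f i) t‖ₑ
          ≤ ∫⁻ t, (Set.Icc (-2 : ℝ) 2).indicator (fun _ => 240 * y i) t := by
            refine lintegral_mono fun t => ?_
            by_cases ht : t ∈ Set.Icc (-2 : ℝ) 2
            · rw [Set.indicator_of_mem ht]; exact (enorm_le_supNorm _ t).trans (hext i)
            · simp [he0 i t ht]
        _ = _ := by
            rw [lintegral_indicator measurableSet_Icc, setLIntegral_const, Real.volume_Icc,
              mul_comm]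
            norm_num
  have hftG (x : ℝ) : ft (fun t => E t + S t) x = ft E x + ft S x := by
    unfold ft
    rw [← integral_add (hmodi hiE x) (hmodi hiS x)]
    simp_rw [mul_add]
  have hiG : Integrable fun t => E t + S t := hiE.add hiS
  have mft {g : ℝ → ℂ} (hg : Integrable g) : Measurable fun x => ‖ft g x‖ₑ :=
    (continuous_ft hg).measurable.enorm
  have hzt : zt (fun x => ‖ft (fun t => E t + S t) x‖ₑ) ≤ 20000 * (‖c‖ₑ + ∑' i, y i) := by
    have h1 (x : ℝ) : ‖ft (fun t => E t + S t) x‖ₑ ≤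
        ‖ft E x‖ₑ + ∑' i, ‖ft (ext (φ i) 0 (f i)) x‖ₑ := by
      rw [hftG, hftS]
      exact (enorm_add_le _ _).trans (add_le_add le_rfl enorm_tsum_le_tsum_enorm)
    refine (zt_mono h1).trans ((zt_add_le (mft hiE)
      (Measurable.tsum fun i => mft (hie i))).trans ?_)
    rw [mul_add, ← ENNReal.tsum_mul_left]
    refine add_le_add ?_ ((zt_tsum_le fun i => mft (hie i)).trans (ENNReal.tsum_le_tsum fun i => ?_))
    · refine (zt_ext_le m0 (by rw [t0]; simp) fun t _ => rfl).trans ?_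
      rw [t0, mul_zero, add_zero]
    · refine (zt_ext_le (hf i) (hT i) (h0 i)).trans ?_
      rw [enorm_zero, zero_add]
  have hY' : ‖c‖ₑ + ∑' i, y i ≠ ∞ := ENNReal.add_ne_top.2 ⟨enorm_ne_top, hY⟩
  -- The L¹ part of the norm is what makes the transform integrable, so that inversion holds
  -- pointwise.
  have hiF : Integrable (ft fun t => E t + S t) := by
    refine ⟨(continuous_ft hiG).aestronglyMeasurable, lt_of_le_of_lt ?_
      (lt_top_iff_ne_top.2 (ENNReal.mul_ne_top (by simp) hY' :
        20000 * (‖c‖ₑ + ∑' i, y i) ≠ ∞))⟩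
    exact le_trans (le_add_self) hzt
  refine ⟨fun x => (2 * Real.pi : ℂ)⁻¹ * ft (fun t => E t + S t) (-x),
    continuous_const.mul ((continuous_ft hiG).comp continuous_neg),
    hiF.comp_neg.const_mul _, ?_, fun t ht => ?_⟩
  · refine (zt_mono fun x => ?_).trans
      ((zt_comp_neg fun x => ‖ft (fun t => E t + S t) x‖ₑ).le.trans hzt)
    rw [enorm_mul]
    calc _ ≤ 1 * ‖ft (fun t => E t + S t) (-x)‖ₑ := by
          gcongr
          rw [← ofReal_norm, ENNReal.ofReal_le_one, norm_inv, norm_mul, Complex.norm_real,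
            Complex.norm_ofNat, Real.norm_eq_abs, abs_of_pos Real.pi_pos]
          exact inv_le_one_of_one_le₀ (by linarith [Real.pi_gt_three])
      _ = _ := one_mul _
  · have h1 := ft_ft_neg (f := fun t => E t + S t) (hEc.add hSc) hiG hiF t
    have hpi : (2 * Real.pi : ℂ) ≠ 0 := by
      simp [Real.pi_ne_zero]
    have h2 (x : ℝ) : Complex.exp (Complex.I * (t * x : ℝ)) *
        ((2 * Real.pi : ℂ)⁻¹ * ft (fun t => E t + S t) (-x)) = (2 * Real.pi : ℂ)⁻¹ *
        (Complex.exp (Complex.I * (t * x : ℝ)) * ft (fun t => E t + S t) (-x)) := by ring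
    simp_rw [h2]
    rw [integral_const_mul, h1, ← mul_assoc, inv_mul_cancel₀ hpi, one_mul]
    congr 1
    · rw [hE, ext_eq m0 s0 (fun t _ => rfl) ht]
      simp [osc]
    · refine tsum_congr fun i => ?_
      rw [ext_eq (hf i) (hS i) (h0 i) ht, zero_add]

/-- The translation τ = x + n³ removes the dispersion, so for each n the norm involves only the
modulation x. -/
lemma eLpNorm_weighted {s b : ℝ} (n : ℤ) (g : ℝ → ℂ) :
    eLpNorm (fun τ : ℝ => bracket n ^ s * bracket (τ - (n : ℝ) ^ 3) ^ b * ‖g τ‖) 2 volume =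
      wt s n * (∫⁻ x, (ENNReal.ofReal (bracket x ^ b) * ‖g (x + (n : ℝ) ^ 3)‖ₑ) ^ (2 : ℝ)) ^
        (1 / (2 : ℝ)) := by
  rw [eLpNorm_eq_lintegral_rpow_enorm_toReal (by norm_num) (by norm_num),
    ← lintegral_add_right_eq_self _ ((n : ℝ) ^ 3)]
  have e (x : ℝ) : ‖bracket n ^ s * bracket (x + (n : ℝ) ^ 3 - (n : ℝ) ^ 3) ^ b *
      ‖g (x + (n : ℝ) ^ 3)‖‖ₑ ^ (2 : ℝ≥0∞).toReal = wt s n ^ (2 : ℝ) *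
      (ENNReal.ofReal (bracket x ^ b) * ‖g (x + (n : ℝ) ^ 3)‖ₑ) ^ (2 : ℝ) := by
    rw [add_sub_cancel_right, ← ENNReal.mul_rpow_of_nonneg _ _ (by norm_num), wt, ← mul_assoc,
      ← ENNReal.ofReal_mul (Real.rpow_nonneg (bracket_pos _).le _), enorm_mul,
      Real.enorm_of_nonneg (mul_nonneg (Real.rpow_nonneg (bracket_pos _).le _)
        (Real.rpow_nonneg (bracket_pos _).le _)), enorm_norm]
    norm_num
  simp_rw [e]
  rw [lintegral_const_mul' _ _ (by
    exact ENNReal.rpow_ne_top_of_nonneg (by norm_num) (wt_ne_top s n)),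
    ENNReal.mul_rpow_of_nonneg _ _ (by norm_num), ← ENNReal.rpow_mul]
  norm_num

lemma eLpNorm_weighted_one {s : ℝ} (n : ℤ) (g : ℝ → ℂ) :
    eLpNorm (fun τ : ℝ => bracket n ^ s * bracket (τ - (n : ℝ) ^ 3) ^ (0 : ℝ) * ‖g τ‖) 1 volume =
      wt s n * ∫⁻ x, ‖g (x + (n : ℝ) ^ 3)‖ₑ := by
  rw [eLpNorm_one_eq_lintegral_enorm, ← lintegral_add_right_eq_self _ ((n : ℝ) ^ 3)]
  have e (x : ℝ) : ‖bracket n ^ s * bracket (x + (n : ℝ) ^ 3 - (n : ℝ) ^ 3) ^ (0 : ℝ) *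
      ‖g (x + (n : ℝ) ^ 3)‖‖ₑ = wt s n * ‖g (x + (n : ℝ) ^ 3)‖ₑ := by
    rw [Real.rpow_zero, mul_one, enorm_mul, wt,
      Real.enorm_of_nonneg (Real.rpow_nonneg (bracket_pos _).le _), enorm_norm]
  simp_rw [e]
  rw [lintegral_const_mul' _ _ (wt_ne_top s n)]

lemma xNorm_eq_wl {s p : ℝ} (g : ℤ → ℝ → ℂ) : xNorm s (1 / 2) p 2 g = wl s p fun n =>
    (∫⁻ x, (ENNReal.ofReal (bracket x ^ (1 / 2 : ℝ)) * ‖g n (x + (n : ℝ) ^ 3)‖ₑ) ^ (2 : ℝ)) ^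
      (1 / (2 : ℝ)) := by
  rw [xNorm, wl]
  simp_rw [eLpNorm_weighted]

lemma xNorm_one_eq_wl {s p : ℝ} (g : ℤ → ℝ → ℂ) :
    xNorm s 0 p 1 g = wl s p fun n => ∫⁻ x, ‖g n (x + (n : ℝ) ^ 3)‖ₑ := by
  rw [xNorm, wl]
  simp_rw [eLpNorm_weighted_one]

/-- Since γ is integrable, the truncated integrals converge uniformly in t, hence in L² of the
bounded interval. -/
lemma tendsto_eLpNorm_truncation {γ : ℝ → ℂ} (hγ : Integrable γ) (m T : ℝ) (v : ℝ → ℂ)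
    (hv : ∀ t ∈ Set.Icc (-T) T, v t = Complex.exp (Complex.I * (t * m : ℝ)) *
      ∫ x, Complex.exp (Complex.I * (t * x : ℝ)) * γ x) :
    Tendsto (fun A : ℝ => eLpNorm
        (fun t : ℝ => v t -
          ∫ τ in (-A)..A, Complex.exp (Complex.I * (t * τ : ℝ)) * γ (τ - m))
        2 (volume.restrict (Set.Icc (-T) T)))
      atTop (𝓝 0) := by
  have hγm : Integrable fun τ => γ (τ - m) := hγ.comp_sub_right m
  have hmod (t : ℝ) : Integrable fun τ : ℝ => Complex.exp (Complex.I * (t * τ : ℝ)) * γ (τ - m) :=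
    hγm.bdd_mul (c := 1) (by fun_prop) (ae_of_all _ fun τ => by
      rw [mul_comm t, norm_exp_I_mul])
  set J : ℝ → ℝ := fun A => ∫ τ in (Set.Ioc (-A) A)ᶜ, ‖γ (τ - m)‖ with hJ
  have hJ0 : Tendsto J atTop (𝓝 0) := by
    have h1 : Tendsto (fun A : ℝ => ∫ τ in (-A)..A, ‖γ (τ - m)‖) atTop
        (𝓝 (∫ τ, ‖γ (τ - m)‖)) :=
      intervalIntegral_tendsto_integral hγm.norm tendsto_neg_atTop_atBot tendsto_id
    have h2 : Tendsto (fun A : ℝ => (∫ τ, ‖γ (τ - m)‖) - ∫ τ in (-A)..A, ‖γ (τ - m)‖) atTop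
        (𝓝 0) := by
      have h3 := (tendsto_const_nhds (x := ∫ τ, ‖γ (τ - m)‖) (f := atTop (α := ℝ))).sub h1
      rwa [sub_self] at h3
    refine h2.congr' ?_
    filter_upwards [eventually_ge_atTop 0] with A hA
    rw [hJ, intervalIntegral.integral_of_le (by linarith),
      ← integral_add_compl (measurableSet_Ioc (a := -A) (b := A)) hγm.norm]
    simp
  have hpt (A : ℝ) (hA : 0 ≤ A) (t : ℝ) (ht : t ∈ Set.Icc (-T) T) :
      ‖v t - ∫ τ in (-A)..A, Complex.exp (Complex.I * (t * τ : ℝ)) * γ (τ - m)‖ ≤ J A := by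
    have h1 : v t = ∫ τ : ℝ, Complex.exp (Complex.I * (t * τ : ℝ)) * γ (τ - m) := by
      rw [hv t ht, ← integral_const_mul, ← integral_sub_right_eq_self _ m]
      refine integral_congr_ae (ae_of_all _ fun τ => ?_)
      simp only
      rw [← mul_assoc, ← Complex.exp_add]
      congr 2
      push_cast; ring
    rw [h1, intervalIntegral.integral_of_le (by linarith),
      ← integral_add_compl (measurableSet_Ioc (a := -A) (b := A)) (hmod t), add_sub_cancel_left]
    refine (norm_integral_le_integral_norm _).trans (le_of_eq ?_)
    refine integral_congr_ae (ae_of_all _ fun τ => ?_)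
    simp only [norm_mul]
    rw [mul_comm t, norm_exp_I_mul, one_mul]
  have hup : Tendsto (fun A : ℝ => (volume.restrict (Set.Icc (-T) T)) Set.univ ^
      (2 : ℝ≥0∞).toReal⁻¹ * ENNReal.ofReal (J A)) atTop (𝓝 0) := by
    have h3 : Tendsto (fun A => ENNReal.ofReal (J A)) atTop (𝓝 0) := by
      simpa using ENNReal.tendsto_ofReal hJ0
    simpa using ENNReal.Tendsto.const_mul (a := (volume.restrict (Set.Icc (-T) T)) Set.univ ^
      (2 : ℝ≥0∞).toReal⁻¹) h3 (Or.inr (by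
        exact ENNReal.rpow_ne_top_of_nonneg (by norm_num) (by simp)))
  refine tendsto_of_tendsto_of_tendsto_of_le_of_le' tendsto_const_nhds hup
    (Eventually.of_forall fun A => zero_le) ?_
  filter_upwards [eventually_ge_atTop 0] with A hA
  refine eLpNorm_le_of_ae_bound ?_
  filter_upwards [ae_restrict_mem measurableSet_Icc] with t ht
  exact hpt A hA t ht

/-- A function given on `[-T, T]` by a sum of oscillating primitives has an extension that is
controlled by the time norms of the integrands. -/
theorem zNormOn_le {ι : Type*} [Countable ι] {s p T : ℝ} (hp : 1 ≤ p) (hT1 : T ≤ 1)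
    {φ : ℤ → ι → ℝ} {c : ℤ → ℂ} {f : ℤ → ι → ℝ → ℂ} {u : ℝ → L2Torus}
    (hf : ∀ n i, Measurable (f n i)) (h0 : ∀ n i, ∀ t ∉ Set.Icc (-1 : ℝ) 1, f n i t = 0)
    (hu : ∀ t ∈ Set.Icc (-T) T, ∀ n, coeff (u t) n = Complex.exp (Complex.I * (t * (n : ℝ) ^ 3 : ℝ)) *
      (c n + ∑' i, osc (φ n i) (f n i) 0 t)) :
    zNormOn s p T u ≤ 40000 * wl s p fun n => ‖c n‖ₑ +
      ∑' i, ENNReal.ofReal (bracket (φ n i) ^ (-(1 / 2) : ℝ)) * timeNorm (f n i) := by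
  set Y : ℤ → ℝ≥0∞ := fun n => ‖c n‖ₑ +
      ∑' i, ENNReal.ofReal (bracket (φ n i) ^ (-(1 / 2) : ℝ)) * timeNorm (f n i) with hY
  by_cases hfin : wl s p Y = ∞
  · rw [hfin]; simp
  have hYn (n : ℤ) : Y n ≠ ∞ := (lt_top_of_wl hp (lt_top_iff_ne_top.2 hfin) n).ne
  have hE (n : ℤ) := exists_extension (c := c n) (hf n) (h0 n)
    (ne_top_of_le_ne_top (hYn n) le_add_self)
  choose γ hγc hγi hγz hγ using hE
  have hz (n : ℤ) : zt (fun x => ‖γ n x‖ₑ) ≤ 20000 * Y n := hγz n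
  -- The extension of the n-th coefficient in the interaction representation, moved back to the
  -- frequency n³.
  have hIE : IsExtension T u fun n τ => γ n (τ - (n : ℝ) ^ 3) := fun n => by
    refine ⟨((hγc n).comp (continuous_sub_right _)).aestronglyMeasurable, ?_⟩
    refine tendsto_eLpNorm_truncation (hγi n) _ T _ fun t ht => ?_
    rw [hu t ht, hγ n t ⟨by linarith [ht.1], by linarith [ht.2]⟩]
  · refine (iInf₂_le (fun n τ => γ n (τ - (n : ℝ) ^ 3)) hIE).trans ?_
    rw [xNorm_eq_wl, xNorm_one_eq_wl]
    simp only [add_sub_cancel_right]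
    have h1 : wl s p (fun n => 20000 * Y n) = 20000 * wl s p Y := wl_const_mul hp _ _
    calc _ ≤ wl s p (fun n => 20000 * Y n) + wl s p (fun n => 20000 * Y n) :=
          add_le_add (wl_mono hp fun n => le_trans le_self_add (hz n))
            (wl_mono hp fun n => le_trans le_add_self (hz n))
      _ = _ := by rw [h1]; ring

/-! ### Trilinear oscillatory integrals of H^{1/2} functions -/

section

/-- The `L⁶` norm of a nonnegative function. -/
def l6 (u : ℝ → ℝ≥0∞) : ℝ≥0∞ := (∫⁻ x, u x ^ (6 : ℝ)) ^ (1 / (6 : ℝ))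

/-- Hölder with 1/2 + 3/6 = 1. The exponent 6 lets the product of three factors, or an increment and
two factors on a bounded interval, be integrated. -/
lemma lintegral_mul_four_le {μ : Measure ℝ} {u v w x : ℝ → ℝ≥0∞} (hu : Measurable u)
    (hv : Measurable v) (hw : Measurable w) (hx : Measurable x) :
    ∫⁻ t, u t * (v t * w t * x t) ∂μ ≤ (∫⁻ t, u t ^ (2 : ℝ) ∂μ) ^ (1 / (2 : ℝ)) *
      ((∫⁻ t, v t ^ (6 : ℝ) ∂μ) ^ (1 / (6 : ℝ)) * (∫⁻ t, w t ^ (6 : ℝ) ∂μ) ^ (1 / (6 : ℝ)) *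
        (∫⁻ t, x t ^ (6 : ℝ) ∂μ) ^ (1 / (6 : ℝ))) := by
  have h := ENNReal.lintegral_prod_norm_pow_le (μ := μ) (Finset.univ : Finset (Fin 4))
    (f := ![fun t => u t ^ (2 : ℝ), fun t => v t ^ (6 : ℝ), fun t => w t ^ (6 : ℝ),
      fun t => x t ^ (6 : ℝ)]) (by
        intro i _
        fin_cases i
        · exact (hu.pow_const _).aemeasurable
        · exact (hv.pow_const _).aemeasurable
        · exact (hw.pow_const _).aemeasurable
        · exact (hx.pow_const _).aemeasurable)
    (p := ![1 / 2, 1 / 6, 1 / 6, 1 / 6]) (by simp [Fin.sum_univ_four]; norm_num)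
    (by intro i _; fin_cases i <;> simp)
  simp only [Fin.prod_univ_four, Matrix.cons_val] at h
  have e2 (a : ℝ≥0∞) : (a ^ (2 : ℝ)) ^ (1 / 2 : ℝ) = a := by rw [← ENNReal.rpow_mul]; norm_num
  have e6 (a : ℝ≥0∞) : (a ^ (6 : ℝ)) ^ (1 / 6 : ℝ) = a := by rw [← ENNReal.rpow_mul]; norm_num
  simp only [e2, e6] at h
  simpa only [mul_assoc] using h

/-- A function supported in `[c, d]` that has the regularity of an element of `H^{1/2}([c, d])`. -/
structure HalfReg (c d : ℝ) (b : ℝ → ℂ) (M : ℝ≥0∞) : Prop where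
  meas : Measurable b
  supp : ∀ t ∉ Set.Icc c d, b t = 0
  bdd : supNorm b ≠ ∞
  l6_le : l6 (fun t => ‖b t‖ₑ) ≤ M
  incr_le : ∀ h, 0 < h → eLpNorm ({t | t ∈ Set.Icc c d ∧ t + h ∈ Set.Icc c d}.indicator (incr h b))
    2 volume ≤ ENNReal.ofReal (√h) * M

variable {c d : ℝ} {b₁ b₂ b₃ : ℝ → ℂ} {M₁ M₂ M₃ : ℝ≥0∞}

lemma enorm_conj (z : ℂ) : ‖(starRingEnd ℂ) z‖ₑ = ‖z‖ₑ := by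
  rw [← ofReal_norm, ← ofReal_norm, RCLike.norm_conj]

lemma supNorm_mul_le (f g : ℝ → ℂ) : supNorm (fun t => f t * g t) ≤ supNorm f * supNorm g :=
  iSup_le fun t => by
    rw [enorm_mul]
    exact mul_le_mul' (enorm_le_supNorm f t) (enorm_le_supNorm g t)

lemma supNorm_conj (f : ℝ → ℂ) : supNorm (fun t => (starRingEnd ℂ) (f t)) = supNorm f := by
  unfold supNorm
  simp_rw [enorm_conj]

lemma l6_indicator_le (hcd2 : d - c ≤ 2) :
    l6 ((Set.Icc c d).indicator fun _ => 1) ≤ 2 := by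
  have e (x : ℝ) : (Set.Icc c d).indicator (fun _ => (1 : ℝ≥0∞)) x ^ (6 : ℝ) =
      (Set.Icc c d).indicator (fun _ => 1) x := by
    by_cases hx : x ∈ Set.Icc c d <;> simp [hx]
  unfold l6
  simp_rw [e]
  rw [lintegral_indicator measurableSet_Icc, setLIntegral_const, one_mul, Real.volume_Icc, one_div,
    ENNReal.rpow_inv_le_iff (by norm_num)]
  calc ENNReal.ofReal (d - c) ≤ ENNReal.ofReal 2 := ENNReal.ofReal_le_ofReal hcd2
    _ = (2 : ℝ≥0∞) ^ (1 : ℝ) := by simp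
    _ ≤ _ := ENNReal.rpow_le_rpow_of_exponent_le (by norm_num) (by norm_num)

lemma l6_comp_add (u : ℝ → ℝ≥0∞) (h : ℝ) : l6 (fun t => u (t + h)) = l6 u := by
  unfold l6
  rw [lintegral_add_right_eq_self (fun x => u x ^ (6 : ℝ))]

/-- The product of three L⁶ functions is in L², which gives √h on an interval of length at most h.
-/
lemma setLIntegral_tri_le (h₁ : HalfReg c d b₁ M₁) (h₂ : HalfReg c d b₂ M₂)
    (h₃ : HalfReg c d b₃ M₃) {x y h : ℝ} (hxy : y - x ≤ h) :
    ∫⁻ t in Set.Ioc x y, ‖b₁ t * (starRingEnd ℂ) (b₂ t) * b₃ t‖ₑ ≤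
      ENNReal.ofReal (√h) * (M₁ * M₂ * M₃) := by
  have key := lintegral_mul_four_le (μ := volume.restrict (Set.Ioc x y)) (u := fun _ => 1)
    measurable_const h₁.meas.enorm h₂.meas.enorm h₃.meas.enorm
  simp only [one_mul, ENNReal.one_rpow, lintegral_one, Measure.restrict_apply_univ,
    Real.volume_Ioc] at key
  simp_rw [enorm_mul, enorm_conj]
  refine key.trans (mul_le_mul' ?_ (mul_le_mul' (mul_le_mul' ?_ ?_) ?_))
  · rw [one_div, ENNReal.rpow_inv_le_iff (by norm_num), ENNReal.rpow_two]
    rcases le_or_gt 0 h with hh | hh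
    · rw [ofReal_sqrt_sq hh]; exact ENNReal.ofReal_le_ofReal hxy
    · rw [ENNReal.ofReal_of_nonpos (by linarith)]; simp
  · refine le_trans ?_ h₁.l6_le
    exact ENNReal.rpow_le_rpow (setLIntegral_le_lintegral _ _) (by norm_num)
  · refine le_trans ?_ h₂.l6_le
    exact ENNReal.rpow_le_rpow (setLIntegral_le_lintegral _ _) (by norm_num)
  · refine le_trans ?_ h₃.l6_le
    exact ENNReal.rpow_le_rpow (setLIntegral_le_lintegral _ _) (by norm_num)

/-- The increment is put in L² and the other two factors in L⁶; the indicator of [c, d] takes the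
remaining exponent 1/6, at a cost of at most 2. -/
lemma HalfReg.lintegral_incr_le (h₁ : HalfReg c d b₁ M₁) (hcd2 : d - c ≤ 2) {h : ℝ}
    (hh : 0 < h) {v w : ℝ → ℝ≥0∞} (hv : Measurable v) (hw : Measurable w) (hv2 : l6 v ≤ M₂)
    (hw3 : l6 w ≤ M₃) :
    ∫⁻ t in {t | t ∈ Set.Icc c d ∧ t + h ∈ Set.Icc c d}, ‖incr h b₁ t‖ₑ * (v t * w t) ≤
      2 * (ENNReal.ofReal (√h) * (M₁ * M₂ * M₃)) := by
  set A : Set ℝ := {t | t ∈ Set.Icc c d ∧ t + h ∈ Set.Icc c d} with hA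
  have hAm : MeasurableSet A :=
    measurableSet_Icc.inter (measurableSet_Icc.preimage (measurable_id.add_const h))
  have hmi : Measurable (A.indicator (incr h b₁)) := (measurable_incr h₁.meas h).indicator hAm
  have key := lintegral_mul_four_le (μ := volume) (u := fun t => ‖A.indicator (incr h b₁) t‖ₑ)
    hmi.enorm hv hw (x := (Set.Icc c d).indicator fun _ => 1)
    (measurable_const.indicator measurableSet_Icc)
  rw [← lintegral_indicator hAm]
  calc ∫⁻ t, A.indicator (fun t => ‖incr h b₁ t‖ₑ * (v t * w t)) t
      ≤ ∫⁻ t, ‖A.indicator (incr h b₁) t‖ₑ *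
        (v t * w t * (Set.Icc c d).indicator (fun _ => 1) t) := by
        refine lintegral_mono fun t => ?_
        by_cases ht : t ∈ A
        · rw [Set.indicator_of_mem ht, Set.indicator_of_mem ht, Set.indicator_of_mem ht.1, mul_one]
        · rw [Set.indicator_of_notMem ht]; exact zero_le
    _ ≤ l2 (fun t => ‖A.indicator (incr h b₁) t‖ₑ) * (l6 v * l6 w *
        l6 ((Set.Icc c d).indicator fun _ => 1)) := key
    _ ≤ ENNReal.ofReal (√h) * M₁ * (M₂ * M₃ * 2) := by
        rw [l2_enorm]
        exact mul_le_mul' (h₁.incr_le h hh)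
          (mul_le_mul' (mul_le_mul' hv2 hw3) (l6_indicator_le hcd2))
    _ = _ := by ring

/-- Leibniz rule for the increment of a product of three factors; translation does not change the L⁶
norms. -/
lemma setLIntegral_incr_tri_le (h₁ : HalfReg c d b₁ M₁) (h₂ : HalfReg c d b₂ M₂)
    (h₃ : HalfReg c d b₃ M₃) (hcd2 : d - c ≤ 2) {h : ℝ} (hh : 0 < h) :
    ∫⁻ t in {t | t ∈ Set.Icc c d ∧ t + h ∈ Set.Icc c d},
      ‖incr h (fun t => b₁ t * (starRingEnd ℂ) (b₂ t) * b₃ t) t‖ₑ ≤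
      6 * (ENNReal.ofReal (√h) * (M₁ * M₂ * M₃)) := by
  set A : Set ℝ := {t | t ∈ Set.Icc c d ∧ t + h ∈ Set.Icc c d} with hA
  have sh {b : ℝ → ℂ} (hb : Measurable b) : Measurable fun t => ‖b (t + h)‖ₑ :=
    (hb.comp (measurable_id.add_const h)).enorm
  have l2' : l6 (fun t => ‖b₂ (t + h)‖ₑ) ≤ M₂ := (l6_comp_add (fun t => ‖b₂ t‖ₑ) h).le.trans h₂.l6_le
  have l3' : l6 (fun t => ‖b₃ (t + h)‖ₑ) ≤ M₃ := (l6_comp_add (fun t => ‖b₃ t‖ₑ) h).le.trans h₃.l6_le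
  have k1 := h₁.lintegral_incr_le hcd2 hh (sh h₂.meas) (sh h₃.meas) l2' l3'
  have k2 := h₂.lintegral_incr_le hcd2 hh h₁.meas.enorm (sh h₃.meas) h₁.l6_le l3'
  have k3 := h₃.lintegral_incr_le hcd2 hh h₁.meas.enorm h₂.meas.enorm h₁.l6_le h₂.l6_le
  calc _ ≤ ∫⁻ t in A, (‖incr h b₁ t‖ₑ * (‖b₂ (t + h)‖ₑ * ‖b₃ (t + h)‖ₑ) +
        (‖incr h b₂ t‖ₑ * (‖b₁ t‖ₑ * ‖b₃ (t + h)‖ₑ) +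
          ‖incr h b₃ t‖ₑ * (‖b₁ t‖ₑ * ‖b₂ t‖ₑ))) := by
        refine lintegral_mono fun t => ?_
        have e : incr h (fun t => b₁ t * (starRingEnd ℂ) (b₂ t) * b₃ t) t =
            incr h b₁ t * ((starRingEnd ℂ) (b₂ (t + h)) * b₃ (t + h)) +
            ((starRingEnd ℂ) (incr h b₂ t) * (b₁ t * b₃ (t + h)) +
              incr h b₃ t * (b₁ t * (starRingEnd ℂ) (b₂ t))) := by
          simp only [incr, map_sub]; ring
        rw [e]
        refine (enorm_add_le _ _).trans (add_le_add ?_ ((enorm_add_le _ _).trans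
          (add_le_add ?_ ?_))) <;> simp only [enorm_mul, enorm_conj, le_refl]
    _ ≤ 2 * (ENNReal.ofReal (√h) * (M₁ * M₂ * M₃)) + (2 * (ENNReal.ofReal (√h) * (M₂ * M₁ * M₃)) +
        2 * (ENNReal.ofReal (√h) * (M₃ * M₁ * M₂))) := by
        rw [lintegral_add_left, lintegral_add_left]
        · exact add_le_add k1 (add_le_add k2 k3)
        · exact (measurable_incr h₂.meas h).enorm.mul (h₁.meas.enorm.mul (sh h₃.meas))
        · exact (measurable_incr h₁.meas h).enorm.mul ((sh h₂.meas).mul (sh h₃.meas))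
    _ = _ := by ring

/-- Trilinear oscillatory integrals of functions with the regularity of `H^{1/2}` gain the square
root of the frequency. -/
theorem enorm_osc_tri_le (h₁ : HalfReg c d b₁ M₁) (h₂ : HalfReg c d b₂ M₂)
    (h₃ : HalfReg c d b₃ M₃) (hcd2 : d - c ≤ 2) (φ : ℝ) {x y : ℝ}
    (hx : c ≤ x) (hxy : x ≤ y) (hy : y ≤ d) :
    ‖osc φ (fun t => b₁ t * (starRingEnd ℂ) (b₂ t) * b₃ t) x y‖ₑ ≤
      15 * (ENNReal.ofReal (bracket φ ^ (-(1 / 2) : ℝ)) * (M₁ * M₂ * M₃)) := by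
  set F : ℝ → ℂ := fun t => b₁ t * (starRingEnd ℂ) (b₂ t) * b₃ t with hF
  have mF : Measurable F :=
    (h₁.meas.mul (Complex.continuous_conj.measurable.comp h₂.meas)).mul h₃.meas
  -- Boundedness is used only qualitatively, for integrability; no supremum enters the estimate.
  have sF : supNorm F ≠ ∞ := by
    refine ne_top_of_le_ne_top ?_ (supNorm_mul_le _ _)
    refine ENNReal.mul_ne_top (ne_top_of_le_ne_top ?_ (supNorm_mul_le _ _)) h₃.bdd
    rw [supNorm_conj]
    exact ENNReal.mul_ne_top h₁.bdd h₂.bdd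
  have hshort {a b h : ℝ} (hab : a ≤ b) (hh : b - a ≤ h) :
      ‖osc φ F a b‖ₑ ≤ ENNReal.ofReal (√h) * (M₁ * M₂ * M₃) := by
    rw [osc, intervalIntegral.integral_of_le hab]
    refine (enorm_integral_le_lintegral_enorm _).trans ?_
    simp_rw [enorm_exp_mul]
    exact setLIntegral_tri_le h₁ h₂ h₃ hh
  have hbp := bracket_pos φ
  suffices H : ∃ h : ℝ, 0 < h ∧ √h ≤ 3 * bracket φ ^ (-(1 / 2) : ℝ) ∧
      ‖osc φ F x y‖ₑ ≤ 5 * (ENNReal.ofReal (√h) * (M₁ * M₂ * M₃)) by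
    obtain ⟨h, hh, hb, hle⟩ := H
    calc _ ≤ 5 * (ENNReal.ofReal (√h) * (M₁ * M₂ * M₃)) := hle
      _ ≤ 5 * (ENNReal.ofReal (3 * bracket φ ^ (-(1 / 2) : ℝ)) * (M₁ * M₂ * M₃)) := by gcongr
      _ = 5 * 3 * (ENNReal.ofReal (bracket φ ^ (-(1 / 2) : ℝ)) * (M₁ * M₂ * M₃)) := by
        rw [ENNReal.ofReal_mul (by norm_num), ENNReal.ofReal_ofNat]; ring
      _ = _ := by norm_num
  have five (z : ℝ≥0∞) : z ≤ 5 * z := le_mul_of_one_le_left zero_le (by norm_num)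
  have hsq {r : ℝ} (hr : r * bracket φ ≤ 9) (hr0 : 0 ≤ r) :
      √r ≤ 3 * bracket φ ^ (-(1 / 2) : ℝ) := by
    rw [Real.sqrt_le_left (by positivity), mul_pow, ← Real.rpow_natCast (bracket φ ^ _),
      ← Real.rpow_mul hbp.le]
    norm_num
    rw [Real.rpow_neg_one, ← div_eq_mul_inv, le_div_iff₀ hbp]
    exact hr
  rcases lt_or_ge |φ| 2 with hφ | hφ
  · refine ⟨2, by norm_num, hsq (by linarith [bracket_le φ]) (by norm_num), ?_⟩
    exact (hshort hxy (by linarith)).trans (five _)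
  · set h := Real.pi / |φ| with hh
    have hφ0 : 0 < |φ| := by linarith
    have hh0 : 0 < h := by positivity
    have hφh : |φ| * h = Real.pi := by rw [hh]; field_simp
    refine ⟨h, hh0, hsq ?_ hh0.le, ?_⟩
    · rw [hh, div_mul_eq_mul_div, div_le_iff₀ hφ0]
      nlinarith [bracket_le φ, Real.pi_lt_four, Real.pi_pos]
    rcases le_or_gt (y - x) h with hle | hlt
    · exact (hshort hxy hle).trans (five _)
    · set P := ENNReal.ofReal (√h) * (M₁ * M₂ * M₃) with hP
      -- The shift is applied on [x, y - h], so that every point used stays in [c, d], where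
      -- increments are controlled. Adding twice the integral over [y - h, y] recovers the whole
      -- interval and turns the last boundary term around.
      have e1 := two_mul_osc mF sF hφh x (y - h)
      rw [sub_add_cancel] at e1
      have e2 := osc_sub_osc mF sF φ x (y - h) y
      have e3 : 2 * osc φ F x y = (-∫ s in x..(y - h),
          Complex.exp (Complex.I * (s * φ : ℝ)) * incr h F s) +
          osc φ F x (x + h) + osc φ F (y - h) y := by linear_combination e1 + 2 * e2
      have k1 : ‖∫ s in x..(y - h), Complex.exp (Complex.I * (s * φ : ℝ)) * incr h F s‖ₑ ≤
          6 * P := by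
        rw [intervalIntegral.integral_of_le (by linarith)]
        refine (enorm_integral_le_lintegral_enorm _).trans ?_
        simp_rw [enorm_exp_mul]
        refine le_trans (lintegral_mono_set fun t ht => ?_)
          (setLIntegral_incr_tri_le h₁ h₂ h₃ hcd2 hh0)
        exact ⟨⟨by linarith [ht.1], by linarith [ht.2]⟩, by linarith [ht.1], by linarith [ht.2]⟩
      have k2 : 2 * ‖osc φ F x y‖ₑ ≤ 2 * (5 * P) := by
        have e4 : (2 : ℝ≥0∞) * ‖osc φ F x y‖ₑ = ‖2 * osc φ F x y‖ₑ := by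
          rw [enorm_mul, ← ofReal_norm (2 : ℂ)]; simp
        rw [e4, e3]
        refine (enorm_add_le _ _).trans (le_trans (b := 6 * P + P + P) (add_le_add ((enorm_add_le _ _).trans
          (add_le_add ?_ (hshort (by linarith) (by linarith : x + h - x ≤ h))))
          (hshort (by linarith) (by linarith : y - (y - h) ≤ h))) ?_)
        · rw [enorm_neg]; exact k1
        · calc 6 * P + P + P = 8 * P := by ring
            _ ≤ 10 * P := by gcongr; norm_num
            _ = _ := by ring
      exact (ENNReal.mul_le_mul_iff_right (by norm_num) (by norm_num)).1 k2

end

/-! ### H^{1/2} in time: Sobolev embedding and increments -/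

/-- The `L²` norm with weight `⟨x⟩^{1/2}`. -/
def hw (γ : ℝ → ℂ) : ℝ≥0∞ := l2 fun x => ENNReal.ofReal (bracket x ^ (1 / 2 : ℝ)) * ‖γ x‖ₑ

lemma hw_mono {γ δ : ℝ → ℂ} (h : ∀ x, ‖γ x‖ₑ ≤ ‖δ x‖ₑ) : hw γ ≤ hw δ :=
  l2_mono fun x => mul_le_mul' le_rfl (h x)

lemma hw_sq (γ : ℝ → ℂ) :
    hw γ ^ (2 : ℝ) = ∫⁻ x, (ENNReal.ofReal (bracket x ^ (1 / 2 : ℝ)) * ‖γ x‖ₑ) ^ (2 : ℝ) := by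
  rw [hw, l2, ← ENNReal.rpow_mul]; norm_num

lemma weight_sq (x : ℝ) (z : ℝ≥0∞) : (ENNReal.ofReal (bracket x ^ (1 / 2 : ℝ)) * z) ^ (2 : ℝ) =
    ENNReal.ofReal (bracket x) * z ^ (2 : ℝ) := by
  rw [ENNReal.mul_rpow_of_nonneg _ _ (by norm_num), ENNReal.ofReal_rpow_of_nonneg
    (Real.rpow_nonneg (bracket_pos x).le _) (by norm_num), ← Real.rpow_mul (bracket_pos x).le]
  norm_num

lemma l2_le_hw (γ : ℝ → ℂ) : l2 (fun x => ‖γ x‖ₑ) ≤ hw γ := by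
  refine l2_mono fun x => ?_
  calc ‖γ x‖ₑ = 1 * ‖γ x‖ₑ := (one_mul _).symm
    _ ≤ _ := by
      gcongr
      rw [ENNReal.one_le_ofReal]
      exact Real.one_le_rpow (one_le_bracket x) (by norm_num)

lemma memLp_of_hw {γ : ℝ → ℂ} (hm : Measurable γ) (h : hw γ ≠ ∞) : MemLp γ 2 volume :=
  ⟨hm.aestronglyMeasurable, by
    rw [← l2_enorm]; exact (l2_le_hw γ).trans_lt (lt_top_iff_ne_top.2 h)⟩

/-- The dyadic frequency annulus of size `2^j`. -/
def annulus (j : ℕ) : Set ℝ := {x | 2 ^ j ≤ bracket x ∧ bracket x < 2 ^ (j + 1)}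

lemma measurableSet_annulus (j : ℕ) : MeasurableSet (annulus j) :=
  (measurableSet_le measurable_const measurable_bracket).inter
    (measurableSet_lt measurable_bracket measurable_const)

lemma iUnion_annulus : ⋃ j, annulus j = Set.univ := by
  refine Set.eq_univ_of_forall fun x => ?_
  obtain ⟨j, hj⟩ := exists_nat_pow_near (one_le_bracket x) (one_lt_two : (1 : ℝ) < 2)
  exact Set.mem_iUnion.2 ⟨j, hj⟩

lemma pairwise_disjoint_annulus : Pairwise (Function.onFun Disjoint annulus) := by
  intro i j hij
  rw [Function.onFun, Set.disjoint_left]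
  rintro x ⟨h1, h2⟩ ⟨h3, h4⟩
  rcases lt_or_gt_of_ne hij with h | h
  · have : (2 : ℝ) ^ (i + 1) ≤ 2 ^ j := pow_le_pow_right₀ (by norm_num) h
    linarith
  · have : (2 : ℝ) ^ (j + 1) ≤ 2 ^ i := pow_le_pow_right₀ (by norm_num) h
    linarith

lemma volume_annulus_le (j : ℕ) : volume (annulus j) ≤ 4 * 2 ^ j := by
  have : annulus j ⊆ Set.Icc (-2 ^ (j + 1)) (2 ^ (j + 1)) := fun x hx =>
    abs_le.1 ((abs_le_bracket x).trans hx.2.le)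
  refine (measure_mono this).trans ?_
  rw [Real.volume_Icc]
  have : (2 ^ (j + 1) - -2 ^ (j + 1) : ℝ) = 4 * 2 ^ j := by ring
  rw [this, ENNReal.ofReal_mul (by norm_num), ENNReal.ofReal_pow (by norm_num)]
  simp

/-- Interpolation of two bounds for one dyadic piece: the supremum is at most 2H uniformly in j
(Cauchy–Schwarz on an annulus of measure at most 4·2^j), and the L² norm is at most 3·2^{-j/2} H
(Plancherel). The sixth power is then at most (2H)⁴ · 9 · 2^{-j} H². -/
lemma l6_ft_annulus_le {γ : ℝ → ℂ} (hm : Measurable γ) (hi : Integrable γ) (h : hw γ ≠ ∞) (j : ℕ) :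
    l6 (fun x => ‖ft ((annulus j).indicator γ) x‖ₑ) ≤
      3 * ((2 : ℝ≥0∞) ^ (-(1 / 6) : ℝ)) ^ j * hw γ := by
  set δ := (annulus j).indicator γ with hδ
  have mD := measurableSet_annulus j
  have hmδ : Measurable δ := hm.indicator mD
  have hiδ : Integrable δ := hi.indicator mD
  have h2δ : MemLp δ 2 volume := (memLp_of_hw hm h).indicator mD
  set H := hw γ with hH
  set a : ℝ≥0∞ := 2 ^ j with ha
  have ha0 : a ≠ 0 := by simp [ha]
  have hat : a ≠ ∞ := by simp [ha]
  set B := ∫⁻ x, ‖δ x‖ₑ ^ (2 : ℝ) with hB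
  have hB2 : a * B ≤ H ^ (2 : ℝ) := by
    rw [hH, hw_sq, hB, ← lintegral_const_mul _ (hmδ.enorm.pow_const _)]
    refine lintegral_mono fun x => ?_
    by_cases hx : x ∈ annulus j
    · rw [weight_sq, hδ, Set.indicator_of_mem hx]
      gcongr
      rw [ha, show (2 : ℝ≥0∞) ^ j = ENNReal.ofReal (2 ^ j) by
        rw [ENNReal.ofReal_pow (by norm_num)]; simp]
      exact ENNReal.ofReal_le_ofReal hx.1
    · rw [hδ, Set.indicator_of_notMem hx]; simp
  have hB3 : B ≤ a⁻¹ * H ^ (2 : ℝ) := by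
    rwa [← ENNReal.div_eq_inv_mul, ENNReal.le_div_iff_mul_le (Or.inl ha0) (Or.inl hat), mul_comm]
  have hS (x : ℝ) : ‖ft δ x‖ₑ ≤ 2 * H := by
    have h1 : ‖ft δ x‖ₑ ≤ ∫⁻ t, (annulus j).indicator (fun _ => 1) t * ‖δ t‖ₑ := by
      refine (enorm_integral_le_lintegral_enorm _).trans (lintegral_mono fun t => ?_)
      rw [enorm_exp_mul]
      by_cases ht : t ∈ annulus j
      · rw [Set.indicator_of_mem ht, one_mul]
      · rw [hδ, Set.indicator_of_notMem ht]; simp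
    have h2 : l2 ((annulus j).indicator fun _ => 1) ≤ (4 * a) ^ (1 / (2 : ℝ)) := by
      unfold l2
      gcongr
      refine le_trans (le_of_eq ?_) (volume_annulus_le j)
      rw [← setLIntegral_one, ← lintegral_indicator mD]
      refine lintegral_congr fun t => ?_
      by_cases ht : t ∈ annulus j <;> simp [ht]
    refine h1.trans ((lintegral_mul_le_l2 (measurable_const.indicator mD) hmδ.enorm).trans ?_)
    calc _ ≤ (4 * a) ^ (1 / (2 : ℝ)) * B ^ (1 / (2 : ℝ)) := mul_le_mul' h2 le_rfl
      _ = (4 * (a * B)) ^ (1 / (2 : ℝ)) := by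
        rw [← ENNReal.mul_rpow_of_nonneg _ _ (by norm_num), mul_assoc]
      _ ≤ ((2 * H) ^ (2 : ℝ)) ^ (1 / (2 : ℝ)) := by
        gcongr
        rw [ENNReal.mul_rpow_of_nonneg _ _ (by norm_num)]
        gcongr
        rw [ENNReal.rpow_two]; norm_num
      _ = 2 * H := by rw [← ENNReal.rpow_mul]; norm_num
  have hL2 : ∫⁻ x, ‖ft δ x‖ₑ ^ (2 : ℝ) ≤ 9 * (a⁻¹ * H ^ (2 : ℝ)) := by
    have h1 := l2_ft_le hiδ h2δ
    rw [← l2_enorm] at h1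
    have h2 : l2 (fun x => ‖ft δ x‖ₑ) ^ (2 : ℝ) ≤ (3 * l2 fun x => ‖δ x‖ₑ) ^ (2 : ℝ) := by gcongr
    rw [ENNReal.mul_rpow_of_nonneg _ _ (by norm_num), l2, l2, ← ENNReal.rpow_mul,
      ← ENNReal.rpow_mul, ENNReal.rpow_two 3] at h2
    norm_num at h2
    refine le_trans (le_of_eq ?_) (h2.trans (mul_le_mul' le_rfl (le_trans (le_of_eq ?_) hB3)))
    · simp
    · simp [hB]
  have hL6 : ∫⁻ x, ‖ft δ x‖ₑ ^ (6 : ℝ) ≤ (3 * (a⁻¹) ^ (1 / (6 : ℝ)) * H) ^ (6 : ℝ) := by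
    calc ∫⁻ x, ‖ft δ x‖ₑ ^ (6 : ℝ) ≤ ∫⁻ x, (2 * H) ^ (4 : ℝ) * ‖ft δ x‖ₑ ^ (2 : ℝ) := by
          refine lintegral_mono fun x => ?_
          rw [show (6 : ℝ) = 4 + 2 by norm_num, ENNReal.rpow_add_of_nonneg _ _ (by norm_num)
            (by norm_num)]
          gcongr
          exact hS x
      _ = (2 * H) ^ (4 : ℝ) * ∫⁻ x, ‖ft δ x‖ₑ ^ (2 : ℝ) :=
          lintegral_const_mul _ ((continuous_ft hiδ).measurable.enorm.pow_const _)
      _ ≤ (2 * H) ^ (4 : ℝ) * (9 * (a⁻¹ * H ^ (2 : ℝ))) := by gcongr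
      _ = 144 * (a⁻¹ * H ^ (6 : ℝ)) := by
          rw [ENNReal.mul_rpow_of_nonneg _ _ (by norm_num), show (6 : ℝ) = 4 + 2 by norm_num,
            ENNReal.rpow_add_of_nonneg _ _ (by norm_num) (by norm_num)]
          have : (2 : ℝ≥0∞) ^ (4 : ℝ) = 16 := by
            rw [show (4 : ℝ) = ((4 : ℕ) : ℝ) by norm_num, ENNReal.rpow_natCast]; norm_num
          rw [this]; ring
      _ ≤ 3 ^ 6 * (a⁻¹ * H ^ (6 : ℝ)) := by gcongr; norm_num
      _ = _ := by
          rw [ENNReal.mul_rpow_of_nonneg _ _ (by norm_num),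
            ENNReal.mul_rpow_of_nonneg _ _ (by norm_num), ← ENNReal.rpow_mul, mul_assoc,
            show (3 : ℝ≥0∞) ^ (6 : ℝ) = 3 ^ 6 by
              rw [show (6 : ℝ) = ((6 : ℕ) : ℝ) by norm_num, ENNReal.rpow_natCast]]
          norm_num
  have hr : (a⁻¹) ^ (1 / (6 : ℝ)) = ((2 : ℝ≥0∞) ^ (-(1 / 6) : ℝ)) ^ j := by
    rw [ha, ← ENNReal.rpow_natCast, ← ENNReal.rpow_natCast, ← ENNReal.rpow_neg, ← ENNReal.rpow_mul,
      ← ENNReal.rpow_mul]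
    congr 1; ring
  rw [← hr, l6, one_div, ENNReal.rpow_inv_le_iff (by norm_num)]
  simpa only [one_div] using hL6

/-- The Sobolev embedding `H^{1/2}(ℝ) ⊂ L⁶(ℝ)`. -/
theorem exists_l6_ft_le : ∃ K : ℝ≥0, ∀ γ : ℝ → ℂ, Measurable γ → Integrable γ → hw γ ≠ ∞ →
    l6 (fun x => ‖ft γ x‖ₑ) ≤ K * hw γ := by
  have hr : (2 : ℝ≥0∞) ^ (-(1 / 6) : ℝ) < 1 :=
    ENNReal.rpow_lt_one_of_one_lt_of_neg (by norm_num) (by norm_num)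
  have hfin : 3 * (1 - (2 : ℝ≥0∞) ^ (-(1 / 6) : ℝ))⁻¹ ≠ ∞ := by
    refine ENNReal.mul_ne_top (by norm_num) (ENNReal.inv_ne_top.2 ?_)
    exact (tsub_pos_of_lt hr).ne'
  refine ⟨(3 * (1 - (2 : ℝ≥0∞) ^ (-(1 / 6) : ℝ))⁻¹).toNNReal, fun γ hm hi h => ?_⟩
  rw [ENNReal.coe_toNNReal hfin]
  -- The dyadic pieces are summed by the triangle inequality in L⁶; the factor 2^{-j/6} makes the
  -- series geometric.
  have hsum (x : ℝ) : ft γ x = ∑' j, ft ((annulus j).indicator γ) x := by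
    have hE : Integrable fun t : ℝ => Complex.exp (Complex.I * (t * x : ℝ)) * γ t :=
      hi.bdd_mul (c := 1) (by fun_prop) (ae_of_all _ fun t => by rw [norm_exp_I_mul])
    have h1 := hasSum_integral_iUnion (μ := volume) (f := fun t : ℝ =>
      Complex.exp (Complex.I * (t * x : ℝ)) * γ t) measurableSet_annulus pairwise_disjoint_annulus
      hE.integrableOn
    rw [iUnion_annulus, setIntegral_univ] at h1
    rw [ft, ← h1.tsum_eq]
    refine tsum_congr fun j => ?_
    rw [ft, ← integral_indicator (measurableSet_annulus j)]
    refine integral_congr_ae (ae_of_all _ fun t => ?_)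
    by_cases ht : t ∈ annulus j <;> simp [ht]
  have mj (j : ℕ) : Measurable fun x => ‖ft ((annulus j).indicator γ) x‖ₑ :=
    (continuous_ft (hi.indicator (measurableSet_annulus j))).measurable.enorm
  calc l6 (fun x => ‖ft γ x‖ₑ)
      ≤ l6 fun x => ∑' j, ‖ft ((annulus j).indicator γ) x‖ₑ := by
        unfold l6
        gcongr with x
        simp only [hsum x]
        exact enorm_tsum_le_tsum_enorm
    _ ≤ ∑' j, l6 fun x => ‖ft ((annulus j).indicator γ) x‖ₑ :=
        lintegral_Lp_tsum_le (by norm_num) _ fun j => (mj j).aemeasurable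
    _ ≤ ∑' j, 3 * ((2 : ℝ≥0∞) ^ (-(1 / 6) : ℝ)) ^ j * hw γ :=
        ENNReal.tsum_le_tsum fun j => l6_ft_annulus_le hm hi h j
    _ = _ := by rw [ENNReal.tsum_mul_right, ENNReal.tsum_mul_left, ENNReal.tsum_geometric]

/-- The product of the bounds |x| and 2; this power of x is the one that the weight ⟨x⟩^{1/2} can
pay for. -/
lemma norm_exp_sub_one_sq_le (x : ℝ) : ‖Complex.exp (Complex.I * x) - 1‖ ^ 2 ≤ 2 * |x| := by
  have h1 : ‖Complex.exp (Complex.I * x) - 1‖ ≤ |x| := Real.norm_exp_I_mul_ofReal_sub_one_le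
  have h2 : ‖Complex.exp (Complex.I * x) - 1‖ ≤ 2 := by
    refine (norm_sub_le _ _).trans ?_
    rw [mul_comm, Complex.norm_exp_ofReal_mul_I]; norm_num
  nlinarith [norm_nonneg (Complex.exp (Complex.I * x) - 1), abs_nonneg x]

/-- Increments of an element of `H^{1/2}(ℝ)`. -/
theorem eLpNorm_incr_ft_le {γ : ℝ → ℂ} (hm : Measurable γ) (hi : Integrable γ) (hγ : hw γ ≠ ∞)
    {h : ℝ} (hh : 0 < h) :
    eLpNorm (incr h (ft γ)) 2 volume ≤ ENNReal.ofReal (√h) * (6 * hw γ) := by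
  set δ : ℝ → ℂ := fun t => (Complex.exp (Complex.I * (h * t : ℝ)) - 1) * γ t with hδ
  have hmod (x : ℝ) : Integrable fun t : ℝ => Complex.exp (Complex.I * (t * x : ℝ)) * γ t :=
    hi.bdd_mul (c := 1) (by fun_prop) (ae_of_all _ fun t => by rw [norm_exp_I_mul])
  have e : incr h (ft γ) = ft δ := by
    funext x
    rw [incr, ft, ft, ft, ← integral_sub (hmod _) (hmod _)]
    refine integral_congr_ae (ae_of_all _ fun t => ?_)
    simp only [hδ]
    have : Complex.exp (Complex.I * (t * (x + h) : ℝ)) = Complex.exp (Complex.I * (t * x : ℝ)) *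
        Complex.exp (Complex.I * (h * t : ℝ)) := by
      rw [← Complex.exp_add]; congr 1; push_cast; ring
    rw [this]; ring
  have hmδ : Measurable δ := by
    refine Measurable.mul ?_ hm
    fun_prop
  have hiδ : Integrable δ := hi.bdd_mul (c := 2) (by fun_prop) (ae_of_all _ fun t => by
    refine (norm_sub_le _ _).trans ?_
    rw [mul_comm Complex.I, Complex.norm_exp_ofReal_mul_I]; norm_num)
  have h2 : l2 (fun x => ‖δ x‖ₑ) ≤ ENNReal.ofReal (√(2 * h)) * hw γ := by
    have hwm : Measurable fun x => ENNReal.ofReal (bracket x ^ (1 / 2 : ℝ)) * ‖γ x‖ₑ :=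
      measurable_weight.mul hm.enorm
    rw [hw, ← l2_const_mul _ hwm]
    refine l2_mono fun x => ?_
    rw [← mul_assoc, hδ, enorm_mul]
    gcongr
    rw [← ENNReal.ofReal_mul (Real.sqrt_nonneg _), ← ofReal_norm]
    refine ENNReal.ofReal_le_ofReal ?_
    rw [← Real.sqrt_eq_rpow, ← Real.sqrt_mul (by positivity)]
    refine Real.le_sqrt_of_sq_le ((norm_exp_sub_one_sq_le _).trans ?_)
    rw [abs_mul, abs_of_pos hh]
    nlinarith [abs_le_bracket x]
  have hδ2 : MemLp δ 2 volume := ⟨hmδ.aestronglyMeasurable, by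
    rw [← l2_enorm]; exact h2.trans_lt (lt_top_iff_ne_top.2 (by finiteness))⟩
  rw [e, ← l2_enorm]
  refine (l2_ft_le hiδ hδ2).trans ?_
  rw [← l2_enorm]
  calc 3 * l2 (fun x => ‖δ x‖ₑ) ≤ 3 * (ENNReal.ofReal (2 * √h) * hw γ) := by
        gcongr
        refine h2.trans ?_
        gcongr
        rw [Real.sqrt_mul (by norm_num)]
        gcongr
        rw [Real.sqrt_le_left (by norm_num)]; norm_num
    _ = _ := by rw [ENNReal.ofReal_mul (by norm_num), ENNReal.ofReal_ofNat]; ring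

lemma l6_enorm (f : ℝ → ℂ) : l6 (fun x => ‖f x‖ₑ) = eLpNorm f 6 volume := by
  rw [eLpNorm_eq_lintegral_rpow_enorm_toReal (by norm_num) (by norm_num), l6]
  norm_num

/-- Fatou: bounds that are uniform along an approximating sequence pass to the a.e. limit on S. -/
lemma eLpNorm_indicator_le_of_tendsto {S : Set ℝ} (hS : MeasurableSet S) {q : ℝ≥0∞}
    {G : ℕ → ℝ → ℂ} {F : ℝ → ℂ} (hG : ∀ k, AEStronglyMeasurable (G k) volume)
    (hlim : ∀ᵐ t, t ∈ S → Tendsto (fun k => G k t) atTop (𝓝 (F t))) {M : ℝ≥0∞}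
    (hM : ∀ k, eLpNorm (G k) q volume ≤ M) : eLpNorm (S.indicator F) q volume ≤ M := by
  refine (Lp.eLpNorm_lim_le_liminf_eLpNorm (f := fun k => S.indicator (G k))
    (fun k => (hG k).indicator hS) _ ?_).trans ?_
  · filter_upwards [hlim] with t ht
    by_cases h : t ∈ S
    · simpa [h] using ht h
    · simp [h]
  · refine liminf_le_of_frequently_le' (Frequently.of_forall fun k => ?_)
    exact (eLpNorm_indicator_le _).trans (hM k)

/-- On `[-T, T]`, an element of the restriction space `H^{1/2}` has the regularity `HalfReg`. -/
theorem exists_halfReg : ∃ K : ℝ≥0, ∀ (m T : ℝ) (v g : ℝ → ℂ),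
    ContinuousOn v (Set.Icc (-T) T) → AEStronglyMeasurable g volume →
    hw (fun x => g (x + m)) ≠ ∞ →
    Tendsto (fun A : ℝ => eLpNorm
        (fun t : ℝ => v t - ∫ τ in (-A)..A, Complex.exp (Complex.I * (t * τ : ℝ)) * g τ)
        2 (volume.restrict (Set.Icc (-T) T))) atTop (𝓝 0) →
    HalfReg (-T) T ((Set.Icc (-T) T).indicator
      fun t => Complex.exp (Complex.I * (t * -m : ℝ)) * v t) (K * hw fun x => g (x + m)) := by
  obtain ⟨K, hK⟩ := exists_l6_ft_le
  -- K serves for the L⁶ bound and 6 for the increments.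
  refine ⟨K + 6, fun m T v g hv hg hfin hlim => ?_⟩
  set I := Set.Icc (-T) T with hI
  set g' := hg.mk g with hg'
  have hgm : Measurable g' := hg.stronglyMeasurable_mk.measurable
  have hgg : ∀ᵐ x, g (x + m) = g' (x + m) :=
    (measurePreserving_add_right volume m).quasiMeasurePreserving.ae hg.ae_eq_mk
  have hwg : hw (fun x => g' (x + m)) = hw fun x => g (x + m) := by
    unfold hw l2
    congr 1
    refine lintegral_congr_ae ?_
    filter_upwards [hgg] with x hx
    rw [hx]
  -- Truncation in τ makes the transform an honest Fourier integral of an integrable function; its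
  -- H^{1/2} norm does not exceed that of g.
  set γ : ℕ → ℝ → ℂ := fun A => (Set.Ioc (-(A : ℝ) - m) (A - m)).indicator fun x => g' (x + m)
    with hγ
  have hγm (A : ℕ) : Measurable (γ A) :=
    (hgm.comp (measurable_id.add_const m)).indicator measurableSet_Ioc
  have hγw (A : ℕ) : hw (γ A) ≤ hw fun x => g (x + m) := by
    rw [← hwg]
    exact hw_mono fun x => enorm_indicator_le_enorm_self _ _
  have hγf (A : ℕ) : hw (γ A) ≠ ∞ := ne_top_of_le_ne_top hfin (hγw A)
  have hγi (A : ℕ) : Integrable (γ A) := by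
    have h2 : MemLp (fun x => g' (x + m)) 2 volume :=
      memLp_of_hw (hgm.comp (measurable_id.add_const m)) (by rwa [hwg])
    rw [hγ, integrable_indicator_iff measurableSet_Ioc]
    exact (h2.restrict _).integrable (by norm_num)
  have hft (A : ℕ) (t : ℝ) : ft (γ A) t = Complex.exp (Complex.I * (t * -m : ℝ)) *
      ∫ τ in (-(A : ℝ))..A, Complex.exp (Complex.I * (t * τ : ℝ)) * g τ := by
    have h1 : ∫ τ in (-(A : ℝ))..A, Complex.exp (Complex.I * (t * τ : ℝ)) * g τ =
        ∫ τ in (-(A : ℝ))..A, Complex.exp (Complex.I * (t * τ : ℝ)) * g' τ := by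
      refine intervalIntegral.integral_congr_ae ?_
      filter_upwards [hg.ae_eq_mk] with x hx _
      rw [hx]
    have h2 : ∫ τ in (-(A : ℝ))..A, Complex.exp (Complex.I * (t * τ : ℝ)) * g' τ =
        ∫ x in (-(A : ℝ) - m)..(A - m),
          Complex.exp (Complex.I * (t * (x + m) : ℝ)) * g' (x + m) := by
      rw [intervalIntegral.integral_comp_add_right
        (fun x => Complex.exp (Complex.I * (t * x : ℝ)) * g' x) m]
      simp
    have hA : (-(A : ℝ) - m) ≤ A - m := by
      have : (0 : ℝ) ≤ A := Nat.cast_nonneg A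
      linarith
    rw [h1, h2, intervalIntegral.integral_of_le hA, ← integral_const_mul, ft,
      ← integral_indicator measurableSet_Ioc]
    refine integral_congr_ae (ae_of_all _ fun x => ?_)
    by_cases hx : x ∈ Set.Ioc (-(A : ℝ) - m) (A - m)
    · simp only [hγ, Set.indicator_of_mem hx]
      rw [← mul_assoc, ← Complex.exp_add]
      congr 2
      push_cast; ring
    · simp only [hγ, Set.indicator_of_notMem hx, mul_zero]
  set a : ℝ → ℂ := fun t => Complex.exp (Complex.I * (t * -m : ℝ)) * v t with ha
  have hac : ContinuousOn a I := ContinuousOn.mul (by fun_prop) hv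
  have hconv : Tendsto (fun A : ℕ => eLpNorm (ft (γ A) - a) 2 (volume.restrict I)) atTop (𝓝 0) := by
    refine (hlim.comp tendsto_natCast_atTop_atTop).congr fun A => ?_
    refine eLpNorm_congr_enorm_ae (ae_of_all _ fun t => ?_)
    rw [Pi.sub_apply, hft, ha, ← mul_sub, enorm_exp_mul, ← enorm_neg, neg_sub]
  have hft_m (A : ℕ) : AEStronglyMeasurable (ft (γ A)) volume :=
    (continuous_ft (hγi A)).aestronglyMeasurable
  -- L² convergence on I gives a subsequence converging a.e. there, which is what Fatou needs for
  -- the L⁶ norm and for the increments.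
  obtain ⟨ns, -, hns⟩ := (tendstoInMeasure_of_tendsto_eLpNorm (by norm_num)
    (fun A => (hft_m A).restrict) (hac.aestronglyMeasurable measurableSet_Icc)
    hconv).exists_seq_tendsto_ae
  rw [ae_restrict_iff' measurableSet_Icc] at hns
  have hsh (h : ℝ) : ∀ᵐ t, t + h ∈ I → Tendsto (fun k => ft (γ (ns k)) (t + h)) atTop
      (𝓝 (a (t + h))) :=
    (measurePreserving_add_right volume h).quasiMeasurePreserving.ae hns
  refine ⟨?_, fun t ht => Set.indicator_of_notMem ht _, ?_, ?_, fun h hh => ?_⟩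
  · classical
    have := hac.measurable_piecewise (g := (0 : ℝ → ℂ)) continuous_zero.continuousOn
      measurableSet_Icc
    rwa [Set.piecewise_eq_indicator] at this
  · obtain ⟨C, hC⟩ := isCompact_Icc.exists_bound_of_continuousOn hac
    refine ne_top_of_le_ne_top (b := ENNReal.ofReal C) (by simp) (iSup_le fun t => ?_)
    by_cases ht : t ∈ I
    · rw [Set.indicator_of_mem ht, ← ofReal_norm]
      exact ENNReal.ofReal_le_ofReal (hC t ht)
    · rw [Set.indicator_of_notMem ht]; simp
  · rw [l6_enorm]
    refine eLpNorm_indicator_le_of_tendsto measurableSet_Icc (fun k => hft_m (ns k)) hns fun k => ?_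
    rw [← l6_enorm]
    refine (hK _ (hγm _) (hγi _) (hγf _)).trans (mul_le_mul' ?_ (hγw _))
    push_cast; exact le_self_add
  · set A : Set ℝ := {t | t ∈ I ∧ t + h ∈ I} with hA
    have hAm : MeasurableSet A :=
      measurableSet_Icc.inter (measurableSet_Icc.preimage (measurable_id.add_const h))
    have e : A.indicator (incr h (I.indicator a)) = A.indicator (incr h a) := by
      refine Set.indicator_congr fun t ht => ?_
      simp only [incr]
      rw [Set.indicator_of_mem ht.1, Set.indicator_of_mem ht.2]
    rw [e]
    refine eLpNorm_indicator_le_of_tendsto hAm (G := fun k => incr h (ft (γ (ns k))))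
      (fun k => aesm_incr (continuous_ft (hγi _)).measurable h) ?_ fun k => ?_
    · filter_upwards [hns, hsh h] with t h1 h2 ht
      exact (h2 ht.2).sub (h1 ht.1)
    · refine (eLpNorm_incr_ft_le (hγm _) (hγi _) (hγf _) hh).trans ?_
      gcongr
      · push_cast; exact le_add_self
      · exact hγw _

/-! ### The trilinear map on sequences of functions of time -/

section

section Families

variable {ι : Type*} {φ : ι → ℝ} {f g : ι → ℝ → ℂ} {c d t₀ : ℝ}

/-- The sum of the time norms of a family of integrands, weighted with the gain of the time
integration. -/
def oscTotal (φ : ι → ℝ) (f : ι → ℝ → ℂ) : ℝ≥0∞ :=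
  ∑' i, ENNReal.ofReal (bracket (φ i) ^ (-(1 / 2) : ℝ)) * timeNorm (f i)

lemma supNorm_ne_top_of_oscTotal (h : oscTotal φ f ≠ ∞) (i : ι) : supNorm (f i) ≠ ∞ :=
  ne_top_of_le_ne_top (timeNorm_ne_top_of_tsum h i) (supNorm_le_timeNorm _)

lemma timeNorm_osc_le' (hf : ∀ i, Measurable (f i)) (h : oscTotal φ f ≠ ∞) (hcd2 : d - c ≤ 2)
    (ht₀ : t₀ ∈ Set.Icc c d) (i : ι) :
    timeNorm ((Set.Icc c d).indicator (osc (φ i) (f i) t₀)) ≤ 12 * ENNReal.ofReal (√(d - c)) *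
      (ENNReal.ofReal (bracket (φ i) ^ (-(1 / 2) : ℝ)) * timeNorm (f i)) := by
  refine (timeNorm_osc_le (hf i) (timeNorm_ne_top_of_tsum h i) (ht₀.1.trans ht₀.2) hcd2 ht₀).trans
    (le_of_eq ?_)
  rw [ENNReal.ofReal_mul (Real.sqrt_nonneg _)]; ring

lemma tsum_enorm_osc_ne_top (hf : ∀ i, Measurable (f i)) (h : oscTotal φ f ≠ ∞)
    (hcd2 : d - c ≤ 2) (ht₀ : t₀ ∈ Set.Icc c d) :
    ∑' i, supNorm ((Set.Icc c d).indicator (osc (φ i) (f i) t₀)) ≠ ∞ := by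
  refine ne_top_of_le_ne_top (b := 12 * ENNReal.ofReal (√(d - c)) * oscTotal φ f) (by finiteness) ?_
  rw [oscTotal, ← ENNReal.tsum_mul_left]
  exact ENNReal.tsum_le_tsum fun i =>
    (supNorm_le_timeNorm _).trans (timeNorm_osc_le' hf h hcd2 ht₀ i)

lemma summable_osc (hf : ∀ i, Measurable (f i)) (h : oscTotal φ f ≠ ∞) (hcd2 : d - c ≤ 2)
    (ht₀ : t₀ ∈ Set.Icc c d) {t : ℝ} (ht : t ∈ Set.Icc c d) :
    Summable fun i => osc (φ i) (f i) t₀ t := by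
  refine Summable.of_norm_bounded
    (ENNReal.summable_toReal (tsum_enorm_osc_ne_top hf h hcd2 ht₀)) fun i => ?_
  have h1 := enorm_le_supNorm ((Set.Icc c d).indicator (osc (φ i) (f i) t₀)) t
  rw [Set.indicator_of_mem ht] at h1
  rw [← toReal_enorm]
  exact ENNReal.toReal_mono
    (ENNReal.ne_top_of_tsum_ne_top (tsum_enorm_osc_ne_top hf h hcd2 ht₀) i) h1

lemma continuousOn_tsum_osc (hf : ∀ i, Measurable (f i)) (h : oscTotal φ f ≠ ∞)
    (hcd2 : d - c ≤ 2) (ht₀ : t₀ ∈ Set.Icc c d) :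
    ContinuousOn (fun t => ∑' i, osc (φ i) (f i) t₀ t) (Set.Icc c d) := by
  refine continuousOn_tsum (fun i => (continuous_osc (hf i)
    (supNorm_ne_top_of_oscTotal h i) _ _).continuousOn)
    (ENNReal.summable_toReal (tsum_enorm_osc_ne_top hf h hcd2 ht₀)) fun i t ht => ?_
  have h1 := enorm_le_supNorm ((Set.Icc c d).indicator (osc (φ i) (f i) t₀)) t
  rw [Set.indicator_of_mem ht] at h1
  rw [← toReal_enorm]
  exact ENNReal.toReal_mono
    (ENNReal.ne_top_of_tsum_ne_top (tsum_enorm_osc_ne_top hf h hcd2 ht₀) i) h1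

lemma indicator_tsum_osc (S : Set ℝ) : S.indicator (fun t => ∑' i, osc (φ i) (f i) t₀ t) =
    fun t => ∑' i, S.indicator (osc (φ i) (f i) t₀) t := by
  ext t
  by_cases ht : t ∈ S <;> simp [ht]

lemma measurable_indicator_osc (hf : ∀ i, Measurable (f i)) (h : oscTotal φ f ≠ ∞) (i : ι) :
    Measurable ((Set.Icc c d).indicator (osc (φ i) (f i) t₀)) :=
  (continuous_osc (hf i) (supNorm_ne_top_of_oscTotal h i) _ _).measurable.indicator
    measurableSet_Icc

lemma measurable_indicator_tsum_osc [Countable ι] (hf : ∀ i, Measurable (f i))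
    (h : oscTotal φ f ≠ ∞) :
    Measurable ((Set.Icc c d).indicator fun t => ∑' i, osc (φ i) (f i) t₀ t) := by
  rw [indicator_tsum_osc]
  exact Measurable.tsum fun i => measurable_indicator_osc hf h i

lemma timeNorm_tsum_osc_le [Countable ι] (hf : ∀ i, Measurable (f i)) (h : oscTotal φ f ≠ ∞)
    (hcd2 : d - c ≤ 2) (ht₀ : t₀ ∈ Set.Icc c d) :
    timeNorm ((Set.Icc c d).indicator fun t => ∑' i, osc (φ i) (f i) t₀ t) ≤
      12 * ENNReal.ofReal (√(d - c)) * oscTotal φ f := by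
  rw [indicator_tsum_osc, oscTotal, ← ENNReal.tsum_mul_left]
  exact (timeNorm_tsum_le fun i => measurable_indicator_osc hf h i).trans
    (ENNReal.tsum_le_tsum fun i => timeNorm_osc_le' hf h hcd2 ht₀ i)

lemma osc_sub_fun {ψ : ℝ} {u v : ℝ → ℂ} (hu : Measurable u) (hus : supNorm u ≠ ∞)
    (hv : Measurable v) (hvs : supNorm v ≠ ∞) (x y : ℝ) :
    osc ψ (u - v) x y = osc ψ u x y - osc ψ v x y := by
  rw [osc, osc, osc, ← intervalIntegral.integral_sub (intervalIntegrable_exp_mul hu hus ψ _ _)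
    (intervalIntegrable_exp_mul hv hvs ψ _ _)]
  refine intervalIntegral.integral_congr fun t _ => ?_
  simp only [Pi.sub_apply]; ring

lemma tsum_osc_sub (hf : ∀ i, Measurable (f i)) (hg : ∀ i, Measurable (g i))
    (hF : oscTotal φ f ≠ ∞) (hG : oscTotal φ g ≠ ∞) (hcd2 : d - c ≤ 2)
    (ht₀ : t₀ ∈ Set.Icc c d) {t : ℝ} (ht : t ∈ Set.Icc c d) :
    ∑' i, osc (φ i) (f i) t₀ t - ∑' i, osc (φ i) (g i) t₀ t =
      ∑' i, osc (φ i) (f i - g i) t₀ t := by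
  rw [← (summable_osc hf hF hcd2 ht₀ ht).tsum_sub (summable_osc hg hG hcd2 ht₀ ht)]
  exact tsum_congr fun i => (osc_sub_fun (hf i) (supNorm_ne_top_of_oscTotal hF i) (hg i)
    (supNorm_ne_top_of_oscTotal hG i) _ _).symm

end Families

/-- The summands of the time derivative of the `n`-th coefficient in the interaction
representation, without their oscillating factor. -/
def force (κ : ℂ) (a : ℤ → ℝ → ℂ) (n : ℤ) (k : ℤ × ℤ) (t : ℝ) : ℂ :=
  κ * mult n k * (a k.1 t * (starRingEnd ℂ) (a (k.1 + k.2 - n) t) * a k.2 t)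

/-- The frequency of oscillation of `force`. -/
def freq (n : ℤ) (k : ℤ × ℤ) : ℝ := -(phase n k : ℝ)

variable {κ : ℂ} {a b : ℤ → ℝ → ℂ} {s p : ℝ}

/-- The norm `‖⟨n⟩^s ‖a_n‖‖_{ℓ^p}` of a sequence of functions of time. -/
def seqNorm (s p : ℝ) (a : ℤ → ℝ → ℂ) : ℝ≥0∞ := wl s p fun n => timeNorm (a n)

lemma measurable_force (ha : ∀ n, Measurable (a n)) (n : ℤ) (k : ℤ × ℤ) :
    Measurable (force κ a n k) :=
  measurable_const.mul (((ha _).mul (Complex.continuous_conj.measurable.comp (ha _))).mul (ha _))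

lemma timeNorm_mul_three_le {u v w : ℝ → ℂ} (hu : Measurable u) (hv : Measurable v)
    (hw : Measurable w) : timeNorm (u * (fun t => (starRingEnd ℂ) (v t)) * w) ≤
      timeNorm u * timeNorm v * timeNorm w := by
  have hv' : Measurable fun t => (starRingEnd ℂ) (v t) :=
    Complex.continuous_conj.measurable.comp hv
  refine (timeNorm_mul_le (hu.mul hv') hw).trans (mul_le_mul' ?_ le_rfl)
  refine (timeNorm_mul_le hu hv').trans (mul_le_mul' le_rfl ?_)
  rw [timeNorm_conj]

/-- Telescoping of a difference of trilinear expressions, followed by the algebra property. -/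
lemma timeNorm_force_sub_le (hκ : ‖κ‖ₑ ≤ 1) (ha : ∀ n, Measurable (a n))
    (hb : ∀ n, Measurable (b n)) (n : ℤ) (k : ℤ × ℤ) :
    timeNorm (force κ a n k - force κ b n k) ≤ ENNReal.ofReal |mult n k| *
      (timeNorm (a k.1 - b k.1) * timeNorm (a (k.1 + k.2 - n)) * timeNorm (a k.2) +
      timeNorm (b k.1) * timeNorm (a (k.1 + k.2 - n) - b (k.1 + k.2 - n)) * timeNorm (a k.2) +
      timeNorm (b k.1) * timeNorm (b (k.1 + k.2 - n)) * timeNorm (a k.2 - b k.2)) := by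
  set m := k.1 + k.2 - n with hm
  have mc {v : ℝ → ℂ} (hv : Measurable v) : Measurable fun t => (starRingEnd ℂ) (v t) :=
    Complex.continuous_conj.measurable.comp hv
  have e : force κ a n k - force κ b n k = fun t => (κ * mult n k) *
      (((a k.1 - b k.1) * (fun t => (starRingEnd ℂ) (a m t)) * a k.2 +
        b k.1 * (fun t => (starRingEnd ℂ) ((a m - b m) t)) * a k.2 +
        b k.1 * (fun t => (starRingEnd ℂ) (b m t)) * (a k.2 - b k.2)) t) := by
    ext t
    simp only [force, Pi.sub_apply, Pi.add_apply, Pi.mul_apply, map_sub, ← hm]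
    ring
  rw [e]
  refine (timeNorm_const_mul_le _ _).trans (mul_le_mul' ?_ ?_)
  · rw [enorm_mul, ← ofReal_norm (mult n k : ℂ), Complex.norm_real, Real.norm_eq_abs]
    exact mul_le_of_le_one_left zero_le hκ
  · have m1 : Measurable ((a k.1 - b k.1) * (fun t => (starRingEnd ℂ) (a m t)) * a k.2) :=
      (((ha _).sub (hb _)).mul (mc (ha _))).mul (ha _)
    have m2 : Measurable (b k.1 * (fun t => (starRingEnd ℂ) ((a m - b m) t)) * a k.2) :=
      ((hb _).mul (mc ((ha _).sub (hb _)))).mul (ha _)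
    have m3 : Measurable (b k.1 * (fun t => (starRingEnd ℂ) (b m t)) * (a k.2 - b k.2)) :=
      ((hb _).mul (mc (hb _))).mul ((ha _).sub (hb _))
    refine (timeNorm_add_le (m1.add m2) m3).trans (add_le_add ((timeNorm_add_le m1 m2).trans
      (add_le_add ?_ ?_)) ?_)
    · exact timeNorm_mul_three_le ((ha _).sub (hb _)) (ha _) (ha _)
    · exact timeNorm_mul_three_le (hb _) ((ha _).sub (hb _)) (ha _)
    · exact timeNorm_mul_three_le (hb _) (hb _) ((ha _).sub (hb _))

lemma oscTotal_force_sub_le (hκ : ‖κ‖ₑ ≤ 1) (ha : ∀ n, Measurable (a n))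
    (hb : ∀ n, Measurable (b n)) (n : ℤ) :
    oscTotal (freq n) (fun k => force κ a n k - force κ b n k) ≤
      triSum (fun n => timeNorm (a n - b n)) (fun n => timeNorm (a n)) (fun n => timeNorm (a n)) n +
      triSum (fun n => timeNorm (b n)) (fun n => timeNorm (a n - b n)) (fun n => timeNorm (a n)) n +
      triSum (fun n => timeNorm (b n)) (fun n => timeNorm (b n))
        (fun n => timeNorm (a n - b n)) n := by
  unfold oscTotal triSum
  rw [← ENNReal.tsum_add, ← ENNReal.tsum_add]
  refine ENNReal.tsum_le_tsum fun k => ?_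
  rw [← mul_add, ← mul_add]
  refine (mul_le_mul' le_rfl (timeNorm_force_sub_le hκ ha hb n k)).trans (le_of_eq ?_)
  rw [← mul_assoc, ← ENNReal.ofReal_mul (Real.rpow_nonneg (bracket_pos _).le _), freq, bracket_neg,
    gain, mul_comm (|mult n k|)]

/-- Each of the three telescoped terms is a trilinear sum with one entry a - b and two entries of
norm at most ρ. -/
lemma wl_oscTotal_force_sub_le (hp : 1 ≤ p) (hκ : ‖κ‖ₑ ≤ 1) {K : ℝ≥0}
    (hK : ∀ x y z : ℤ → ℝ≥0∞, wl s p (triSum x y z) ≤ K * (wl s p x * wl s p y * wl s p z))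
    (ha : ∀ n, Measurable (a n)) (hb : ∀ n, Measurable (b n)) {ρ : ℝ≥0∞} (haρ : seqNorm s p a ≤ ρ)
    (hbρ : seqNorm s p b ≤ ρ) :
    wl s p (fun n => oscTotal (freq n) fun k => force κ a n k - force κ b n k) ≤
      3 * K * ρ ^ 2 * seqNorm s p (fun n => a n - b n) := by
  refine (wl_mono hp fun n => oscTotal_force_sub_le hκ ha hb n).trans ?_
  refine (wl_add_le hp _ _).trans ((add_le_add (wl_add_le hp _ _) le_rfl).trans ?_)
  refine (add_le_add (add_le_add (hK _ _ _) (hK _ _ _)) (hK _ _ _)).trans ?_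
  set w := wl s p fun n => timeNorm (a n - b n) with hw
  have e : seqNorm s p (fun n => a n - b n) = w := rfl
  rw [e]
  calc _ ≤ K * (w * ρ * ρ) + K * (ρ * w * ρ) + K * (ρ * ρ * w) := by
        refine add_le_add (add_le_add ?_ ?_) ?_ <;> gcongr <;> assumption
    _ = _ := by ring

lemma force_zero (n : ℤ) (k : ℤ × ℤ) : force κ 0 n k = 0 := by
  ext t; simp [force]

lemma seqNorm_zero (hp : 1 ≤ p) : seqNorm s p 0 = 0 := by
  have : (0 : ℝ) < p := by linarith
  simp [seqNorm, wl, timeNorm_zero, this]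

/-- The difference estimate against the zero sequence. -/
lemma oscTotal_force_ne_top (hp : 1 ≤ p) (hκ : ‖κ‖ₑ ≤ 1) {K : ℝ≥0}
    (hK : ∀ x y z : ℤ → ℝ≥0∞, wl s p (triSum x y z) ≤ K * (wl s p x * wl s p y * wl s p z))
    (ha : ∀ n, Measurable (a n)) (hf : seqNorm s p a ≠ ∞) (n : ℤ) :
    oscTotal (freq n) (force κ a n) ≠ ∞ := by
  have h := wl_oscTotal_force_sub_le (b := 0) hp hκ hK ha (fun _ => measurable_zero) le_rfl
    ((seqNorm_zero hp).le.trans zero_le)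
  simp only [force_zero, sub_zero, Pi.zero_apply] at h
  refine (lt_top_of_wl hp (h.trans_lt ?_) n).ne
  exact lt_top_iff_ne_top.2 (by finiteness)

lemma oscTotal_force_sub_ne_top (hp : 1 ≤ p) (hκ : ‖κ‖ₑ ≤ 1) {K : ℝ≥0}
    (hK : ∀ x y z : ℤ → ℝ≥0∞, wl s p (triSum x y z) ≤ K * (wl s p x * wl s p y * wl s p z))
    (ha : ∀ n, Measurable (a n)) (hf : seqNorm s p a ≠ ∞) (hb : ∀ n, Measurable (b n))
    (hg : seqNorm s p b ≠ ∞) (n : ℤ) :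
    oscTotal (freq n) (fun k => force κ a n k - force κ b n k) ≠ ∞ := by
  have h1 := oscTotal_force_ne_top hp hκ hK ha hf n
  have h2 := oscTotal_force_ne_top hp hκ hK hb hg n
  refine ne_top_of_le_ne_top (ENNReal.add_ne_top.2 ⟨h1, h2⟩) ?_
  unfold oscTotal
  rw [← ENNReal.tsum_add]
  refine ENNReal.tsum_le_tsum fun k => ?_
  rw [← mul_add]
  exact mul_le_mul' le_rfl (timeNorm_sub_le (measurable_force ha n k) (measurable_force hb n k))

/-- The Duhamel integral in the interaction representation. -/
def duhamel (κ : ℂ) (a : ℤ → ℝ → ℂ) (n : ℤ) (t₀ t : ℝ) : ℂ :=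
  ∑' k, osc (freq n k) (force κ a n k) t₀ t

lemma seqNorm_add_le (hp : 1 ≤ p) (ha : ∀ n, Measurable (a n)) (hb : ∀ n, Measurable (b n)) :
    seqNorm s p (fun n => a n + b n) ≤ seqNorm s p a + seqNorm s p b :=
  (wl_mono hp fun n => timeNorm_add_le (ha n) (hb n)).trans (wl_add_le hp _ _)

lemma seqNorm_indicator_le (hp : 1 ≤ p) (ha : ∀ n, Measurable (a n)) (c d : ℝ) :
    seqNorm s p (fun n => (Set.Icc c d).indicator (a n)) ≤ 3 * seqNorm s p a := by
  rw [seqNorm, seqNorm, ← wl_const_mul hp]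
  exact wl_mono hp fun n => timeNorm_indicator_le (ha n) c d

/-- The Duhamel integral is a contraction on short intervals. -/
theorem seqNorm_duhamel_sub_le (hp : 1 ≤ p) (hκ : ‖κ‖ₑ ≤ 1) {K : ℝ≥0}
    (hK : ∀ x y z : ℤ → ℝ≥0∞, wl s p (triSum x y z) ≤ K * (wl s p x * wl s p y * wl s p z))
    (ha : ∀ n, Measurable (a n)) (hb : ∀ n, Measurable (b n)) {ρ : ℝ≥0∞} (hρ : ρ ≠ ∞)
    (haρ : seqNorm s p a ≤ ρ) (hbρ : seqNorm s p b ≤ ρ) {c d t₀ : ℝ} (hcd2 : d - c ≤ 2)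
    (ht₀ : t₀ ∈ Set.Icc c d) :
    seqNorm s p (fun n => (Set.Icc c d).indicator fun t =>
        duhamel κ a n t₀ t - duhamel κ b n t₀ t) ≤
      36 * ENNReal.ofReal (√(d - c)) * K * ρ ^ 2 * seqNorm s p (fun n => a n - b n) := by
  have hfa := ne_top_of_le_ne_top hρ haρ
  have hfb := ne_top_of_le_ne_top hρ hbρ
  have e (n : ℤ) : (Set.Icc c d).indicator (fun t => duhamel κ a n t₀ t - duhamel κ b n t₀ t) =
      (Set.Icc c d).indicator fun t =>
        ∑' k, osc (freq n k) (force κ a n k - force κ b n k) t₀ t := by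
    refine Set.indicator_congr fun t ht => ?_
    exact tsum_osc_sub (measurable_force ha n) (measurable_force hb n)
      (oscTotal_force_ne_top hp hκ hK ha hfa n) (oscTotal_force_ne_top hp hκ hK hb hfb n) hcd2 ht₀ ht
  have h1 (n : ℤ) : timeNorm ((Set.Icc c d).indicator fun t =>
      duhamel κ a n t₀ t - duhamel κ b n t₀ t) ≤ 12 * ENNReal.ofReal (√(d - c)) *
      oscTotal (freq n) fun k => force κ a n k - force κ b n k := by
    rw [e]
    exact timeNorm_tsum_osc_le (fun k => (measurable_force ha n k).sub (measurable_force hb n k))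
      (oscTotal_force_sub_ne_top hp hκ hK ha hfa hb hfb n) hcd2 ht₀
  refine (wl_mono hp h1).trans ?_
  rw [wl_const_mul hp]
  calc _ ≤ 12 * ENNReal.ofReal (√(d - c)) *
        (3 * K * ρ ^ 2 * seqNorm s p (fun n => a n - b n)) :=
        mul_le_mul' le_rfl (wl_oscTotal_force_sub_le hp hκ hK ha hb haρ hbρ)
    _ = _ := by ring

end

/-! ### Picard iteration -/

section

variable {κ : ℂ} {a b : ℤ → ℝ → ℂ} {c e : ℤ → ℂ} {s p T : ℝ}

/-- The Picard map on `[-T, T]`. -/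
def picard (κ : ℂ) (T : ℝ) (c : ℤ → ℂ) (a : ℤ → ℝ → ℂ) (n : ℤ) : ℝ → ℂ :=
  (Set.Icc (-T) T).indicator fun t => c n + duhamel κ a n 0 t

/-- The Picard iterates, starting from zero. -/
def iter (κ : ℂ) (T : ℝ) (c : ℤ → ℂ) : ℕ → ℤ → ℝ → ℂ
  | 0 => 0
  | j + 1 => picard κ T c (iter κ T c j)

/-- The limit of the Picard iterates. -/
def flowLimit (κ : ℂ) (T : ℝ) (c : ℤ → ℂ) (n : ℤ) (t : ℝ) : ℂ :=
  ∑' j, (iter κ T c (j + 1) n t - iter κ T c j n t)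

/-- The norm of the sequence of Fourier coefficients of the datum. -/
def dataNorm (s p : ℝ) (c : ℤ → ℂ) : ℝ≥0∞ := wl s p fun n => ‖c n‖ₑ

/-- The setting of the contraction argument: the trilinear estimate holds with constant `K`, and
`T` is small with respect to the size `ρ` of the ball. -/
structure Setting (κ : ℂ) (s p T : ℝ) (K : ℝ≥0) (ρ : ℝ≥0∞) : Prop where
  hs : 1 / 2 ≤ s
  hp : 1 ≤ p
  hsp : 3 / 4 - s < 1 / p
  hκ : ‖κ‖ₑ ≤ 1
  hK : ∀ x y z : ℤ → ℝ≥0∞, wl s p (triSum x y z) ≤ K * (wl s p x * wl s p y * wl s p z)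
  T_pos : 0 < T
  T_le : T ≤ 1
  ρ_ne_top : ρ ≠ ∞
  small : 36 * ENNReal.ofReal (√(T - -T)) * K * ρ ^ 2 ≤ 1 / 2

variable {K : ℝ≥0} {ρ : ℝ≥0∞}

lemma measurable_picard (S : Setting κ s p T K ρ) (ha : ∀ n, Measurable (a n))
    (hf : seqNorm s p a ≠ ∞) (n : ℤ) : Measurable (picard κ T c a n) := by
  have h : picard κ T c a n = (Set.Icc (-T) T).indicator (fun _ => c n) +
      (Set.Icc (-T) T).indicator (fun t => duhamel κ a n 0 t) :=
    Set.indicator_add _ _ _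
  rw [h]
  exact (measurable_const.indicator measurableSet_Icc).add (measurable_indicator_tsum_osc
    (measurable_force ha n) (oscTotal_force_ne_top S.hp S.hκ S.hK ha hf n))

/-- The factor 3 is the price of restricting constants sharply to [-T, T]. Two different data are
allowed, so that the same estimate gives invariance of the ball, contraction and Lipschitz
dependence. -/
lemma seqNorm_picard_sub_le (S : Setting κ s p T K ρ) (ha : ∀ n, Measurable (a n))
    (hb : ∀ n, Measurable (b n)) (haρ : seqNorm s p a ≤ ρ) (hbρ : seqNorm s p b ≤ ρ) :
    seqNorm s p (fun n => picard κ T c a n - picard κ T e b n) ≤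
      3 * dataNorm s p (fun n => c n - e n) + 1 / 2 * seqNorm s p (fun n => a n - b n) := by
  have hfa := ne_top_of_le_ne_top S.ρ_ne_top haρ
  have hfb := ne_top_of_le_ne_top S.ρ_ne_top hbρ
  set I := Set.Icc (-T) T with hI
  have h0 : (0 : ℝ) ∈ I := ⟨by linarith [S.T_pos], S.T_pos.le⟩
  have h2 : T - -T ≤ 2 := by linarith [S.T_le]
  have m1 (n : ℤ) : Measurable (I.indicator fun _ => c n - e n) :=
    measurable_const.indicator measurableSet_Icc
  have m2 (n : ℤ) : Measurable (I.indicator fun t => duhamel κ a n 0 t - duhamel κ b n 0 t) := by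
    have h : I.indicator (fun t => duhamel κ a n 0 t - duhamel κ b n 0 t) =
      I.indicator (fun t => duhamel κ a n 0 t) - I.indicator (fun t => duhamel κ b n 0 t) :=
      Set.indicator_sub _ _ _
    rw [h]
    exact (measurable_indicator_tsum_osc (measurable_force ha n)
      (oscTotal_force_ne_top S.hp S.hκ S.hK ha hfa n)).sub (measurable_indicator_tsum_osc
      (measurable_force hb n) (oscTotal_force_ne_top S.hp S.hκ S.hK hb hfb n))
  have e1 : (fun n => picard κ T c a n - picard κ T e b n) = fun n =>
      I.indicator (fun _ => c n - e n) +
        I.indicator fun t => duhamel κ a n 0 t - duhamel κ b n 0 t := by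
    funext n t
    by_cases ht : t ∈ I
    · simp only [picard, Pi.sub_apply, Pi.add_apply, ← hI, Set.indicator_of_mem ht]; ring
    · simp [picard, ← hI, ht]
  rw [e1]
  refine (seqNorm_add_le S.hp m1 m2).trans (add_le_add ?_ ?_)
  · rw [dataNorm, ← wl_const_mul S.hp]
    exact wl_mono S.hp fun n => timeNorm_const_indicator_le _ _ _
  · exact (seqNorm_duhamel_sub_le S.hp S.hκ S.hK ha hb S.ρ_ne_top haρ hbρ h2 h0).trans
      (mul_le_mul' S.small le_rfl)

lemma duhamel_zero (n : ℤ) (t₀ t : ℝ) : duhamel κ 0 n t₀ t = 0 := by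
  simp [duhamel, force_zero, osc]

lemma picard_zero (S : Setting κ s p T K ρ) :
    seqNorm s p (picard κ T c 0) ≤ 3 * dataNorm s p c := by
  rw [dataNorm, ← wl_const_mul S.hp]
  refine wl_mono S.hp fun n => ?_
  have : picard κ T c 0 n = (Set.Icc (-T) T).indicator fun _ => c n := by
    simp [picard, duhamel_zero]
  rw [this]
  exact timeNorm_const_indicator_le _ _ _

lemma dataNorm_sub_self (hp : 1 ≤ p) : dataNorm s p (fun n => c n - c n) = 0 := by
  have : (0 : ℝ) < p := by linarith
  simp [dataNorm, wl, this]

lemma seqNorm_sub_zero : seqNorm s p (fun n => a n - (0 : ℤ → ℝ → ℂ) n) = seqNorm s p a := by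
  simp

lemma half_mul_six (x : ℝ≥0∞) : 1 / 2 * (6 * x) = 3 * x := by
  rw [← mul_assoc, one_div, show (6 : ℝ≥0∞) = 2 * 3 by norm_num, ← mul_assoc,
    ENNReal.inv_mul_cancel (by norm_num) (by norm_num), one_mul]

/-- Comparison with the image of zero, of norm at most 3 times that of the datum: the radius 6 is
reproduced because 6/2 + 3 = 6. -/
lemma iter_spec (S : Setting κ s p T K ρ) (hc : 6 * dataNorm s p c ≤ ρ) (j : ℕ) :
    (∀ n, Measurable (iter κ T c j n)) ∧ seqNorm s p (iter κ T c j) ≤ 6 * dataNorm s p c := by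
  induction j with
  | zero => exact ⟨fun _ => measurable_zero, (seqNorm_zero S.hp).le.trans zero_le⟩
  | succ j ih =>
    have hf := ne_top_of_le_ne_top S.ρ_ne_top (ih.2.trans hc)
    refine ⟨fun n => measurable_picard S ih.1 hf n, ?_⟩
    have z0 : seqNorm s p 0 ≤ ρ := (seqNorm_zero S.hp).le.trans zero_le
    have h1 := seqNorm_picard_sub_le (c := c) (e := c) S ih.1 (b := 0) (fun _ => measurable_zero)
      (ih.2.trans hc) z0
    rw [dataNorm_sub_self S.hp, mul_zero, zero_add, seqNorm_sub_zero] at h1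
    have m0 : ∀ n, Measurable (picard κ T c 0 n) := fun n => measurable_picard S
      (fun _ => measurable_zero) (ne_top_of_le_ne_top S.ρ_ne_top z0) n
    have m1 := fun n => measurable_picard (c := c) S ih.1 hf n
    have e1 : iter κ T c (j + 1) = fun n => (picard κ T c (iter κ T c j) n - picard κ T c 0 n) +
        picard κ T c 0 n := by
      funext n; simp [iter]
    rw [e1]
    refine (seqNorm_add_le S.hp (fun n => (m1 n).sub (m0 n)) m0).trans
      ((add_le_add h1 (picard_zero S)).trans ?_)
    calc _ ≤ 1 / 2 * (6 * dataNorm s p c) + 3 * dataNorm s p c := by gcongr; exact ih.2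
      _ = _ := by rw [half_mul_six]; ring

lemma seqNorm_iter_succ_sub (S : Setting κ s p T K ρ) (hc : 6 * dataNorm s p c ≤ ρ) (j : ℕ) :
    seqNorm s p (fun n => iter κ T c (j + 1) n - iter κ T c j n) ≤
      (1 / 2) ^ j * (3 * dataNorm s p c) := by
  induction j with
  | zero =>
    rw [pow_zero, one_mul]
    exact seqNorm_sub_zero.le.trans (picard_zero S)
  | succ j ih =>
    have h1 := iter_spec S hc j
    have h2 := iter_spec S hc (j + 1)
    have h3 := seqNorm_picard_sub_le (c := c) (e := c) S h2.1 h1.1 (h2.2.trans hc) (h1.2.trans hc)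
    rw [dataNorm_sub_self S.hp, mul_zero, zero_add] at h3
    refine h3.trans ?_
    rw [pow_succ']
    calc _ ≤ 1 / 2 * ((1 / 2) ^ j * (3 * dataNorm s p c)) := by gcongr
      _ = _ := by ring

lemma tsum_half_pow (J : ℕ) (x : ℝ≥0∞) :
    ∑' j, (1 / 2 : ℝ≥0∞) ^ (j + J) * (3 * x) = (1 / 2) ^ J * (6 * x) := by
  have h : (1 - 1 / 2 : ℝ≥0∞)⁻¹ = 2 := by simp
  rw [ENNReal.tsum_mul_right]
  simp_rw [pow_add]
  rw [ENNReal.tsum_mul_right, ENNReal.tsum_geometric, h]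
  ring

lemma summable_iter_sub (S : Setting κ s p T K ρ) (hc : 6 * dataNorm s p c ≤ ρ) (n : ℤ) (t : ℝ) :
    Summable fun j => iter κ T c (j + 1) n t - iter κ T c j n t := by
  have hfin : ∑' j, wt (-s) n * ((1 / 2 : ℝ≥0∞) ^ (j + 0) * (3 * dataNorm s p c)) ≠ ∞ := by
    rw [ENNReal.tsum_mul_left, tsum_half_pow]
    refine ENNReal.mul_ne_top (wt_ne_top _ _) (ENNReal.mul_ne_top (by finiteness) ?_)
    exact ne_top_of_le_ne_top S.ρ_ne_top hc
  refine Summable.of_norm_bounded (ENNReal.summable_toReal hfin) fun j => ?_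
  rw [← toReal_enorm]
  refine ENNReal.toReal_mono (ENNReal.ne_top_of_tsum_ne_top hfin j) ?_
  refine (enorm_le_timeNorm (iter κ T c (j + 1) n - iter κ T c j n) t).trans ?_
  refine (le_wl' (s := s) S.hp (fun n => timeNorm (iter κ T c (j + 1) n - iter κ T c j n)) n).trans ?_
  gcongr
  exact seqNorm_iter_succ_sub S hc j

lemma flowLimit_sub_iter (S : Setting κ s p T K ρ) (hc : 6 * dataNorm s p c ≤ ρ) (J : ℕ) (n : ℤ) :
    flowLimit κ T c n - iter κ T c J n =
      fun t => ∑' j, (iter κ T c (j + J + 1) n - iter κ T c (j + J) n) t := by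
  funext t
  have h1 := (summable_iter_sub S hc n t).sum_add_tsum_nat_add J
  rw [Finset.sum_range_sub (fun j => iter κ T c j n t)] at h1
  rw [Pi.sub_apply, flowLimit, ← h1]
  simp [iter]

lemma measurable_flowLimit (S : Setting κ s p T K ρ) (hc : 6 * dataNorm s p c ≤ ρ) (n : ℤ) :
    Measurable (flowLimit κ T c n) :=
  Measurable.tsum fun j => ((iter_spec S hc (j + 1)).1 n).sub ((iter_spec S hc j).1 n)

lemma seqNorm_flowLimit_sub_iter (S : Setting κ s p T K ρ) (hc : 6 * dataNorm s p c ≤ ρ) (J : ℕ) :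
    seqNorm s p (fun n => flowLimit κ T c n - iter κ T c J n) ≤
      (1 / 2) ^ J * (6 * dataNorm s p c) := by
  rw [← tsum_half_pow]
  refine le_trans ?_ (ENNReal.tsum_le_tsum fun j => seqNorm_iter_succ_sub S hc (j + J))
  refine le_trans (wl_mono S.hp fun n => ?_) (wl_tsum_le S.hp _)
  simp only [flowLimit_sub_iter S hc]
  exact timeNorm_tsum_le fun j =>
    ((iter_spec S hc (j + J + 1)).1 n).sub ((iter_spec S hc (j + J)).1 n)

lemma seqNorm_flowLimit_le (S : Setting κ s p T K ρ) (hc : 6 * dataNorm s p c ≤ ρ) :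
    seqNorm s p (flowLimit κ T c) ≤ 6 * dataNorm s p c := by
  have h := seqNorm_flowLimit_sub_iter S hc 0
  rw [pow_zero, one_mul] at h
  exact seqNorm_sub_zero.symm.le.trans h

/-- The limit of the Picard iterates solves the integral equation. -/
theorem picard_flowLimit (S : Setting κ s p T K ρ) (hc : 6 * dataNorm s p c ≤ ρ) :
    picard κ T c (flowLimit κ T c) = flowLimit κ T c := by
  set A := flowLimit κ T c with hA
  have mA := measurable_flowLimit S hc
  have hAρ := (seqNorm_flowLimit_le S hc).trans hc
  have mP := fun n => measurable_picard (c := c) S mA (ne_top_of_le_ne_top S.ρ_ne_top hAρ) n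
  -- The defect of the limit is bounded by this quantity for every J, hence it is zero.
  have hbd (J : ℕ) : seqNorm s p (fun n => picard κ T c A n - A n) ≤
      (1 / 2) ^ J * (6 * dataNorm s p c) := by
    have hJ := iter_spec S hc J
    have hJ1 := iter_spec S hc (J + 1)
    have h1 := seqNorm_picard_sub_le (c := c) (e := c) S mA hJ.1 hAρ (hJ.2.trans hc)
    rw [dataNorm_sub_self S.hp, mul_zero, zero_add] at h1
    have e1 : (fun n => picard κ T c A n - A n) = fun n =>
        (picard κ T c A n - picard κ T c (iter κ T c J) n) + (iter κ T c (J + 1) n - A n) := by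
      funext n; simp [iter]
    have h2 : seqNorm s p (fun n => iter κ T c (J + 1) n - A n) ≤
        seqNorm s p (fun n => A n - iter κ T c (J + 1) n) := by
      refine wl_mono S.hp fun n => ?_
      simpa using timeNorm_neg (A n - iter κ T c (J + 1) n)
    rw [e1]
    refine (seqNorm_add_le S.hp (fun n => (mP n).sub (hJ1.1 n)) fun n => (hJ1.1 n).sub (mA n)).trans ?_
    have h3 := seqNorm_flowLimit_sub_iter S hc J
    have h4 := seqNorm_flowLimit_sub_iter S hc (J + 1)
    refine (add_le_add (h1.trans (mul_le_mul' le_rfl h3)) (h2.trans h4)).trans (le_of_eq ?_)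
    have e : (1 / 2 : ℝ≥0∞) * ((1 / 2) ^ J * (6 * dataNorm s p c)) =
        (1 / 2) ^ J * (3 * dataNorm s p c) := by
      rw [← half_mul_six]; ring
    have e2 : (1 / 2 : ℝ≥0∞) ^ (J + 1) * (6 * dataNorm s p c) =
        (1 / 2) ^ J * (3 * dataNorm s p c) := by
      rw [← half_mul_six]; ring
    rw [e, e2]
    ring
  have h0 : seqNorm s p (fun n => picard κ T c A n - A n) = 0 := by
    refine le_antisymm (ge_of_tendsto' (x := atTop) ?_ hbd) zero_le
    have h5 : Tendsto (fun J : ℕ => (1 / 2 : ℝ≥0∞) ^ J) atTop (𝓝 0) :=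
      ENNReal.tendsto_pow_atTop_nhds_zero_of_lt_one (by simp)
    have h6 : 6 * dataNorm s p c ≠ ∞ := ne_top_of_le_ne_top S.ρ_ne_top hc
    simpa using ENNReal.Tendsto.mul_const h5 (Or.inr h6)
  funext n
  exact sub_eq_zero.1 (eq_zero_of_timeNorm (eq_zero_of_wl S.hp h0 n))

/-- Lipschitz dependence of solutions of the integral equation on the datum. -/
theorem seqNorm_sub_le_of_picard (S : Setting κ s p T K ρ) (ha : ∀ n, Measurable (a n))
    (hb : ∀ n, Measurable (b n)) (haρ : seqNorm s p a ≤ ρ) (hbρ : seqNorm s p b ≤ ρ)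
    (hac : picard κ T c a = a) (hbe : picard κ T e b = b) :
    seqNorm s p (fun n => a n - b n) ≤ 6 * dataNorm s p (fun n => c n - e n) := by
  have h := seqNorm_picard_sub_le (c := c) (e := e) S ha hb haρ hbρ
  rw [hac, hbe] at h
  set w := seqNorm s p (fun n => a n - b n) with hw
  -- Finiteness allows the term w/2 to be absorbed.
  have hfin : w ≠ ∞ := by
    refine ne_top_of_le_ne_top (ENNReal.add_ne_top.2 ⟨S.ρ_ne_top, S.ρ_ne_top⟩) ?_
    refine le_trans ((wl_mono S.hp fun n => timeNorm_sub_le (ha n) (hb n)).trans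
      (wl_add_le S.hp _ _)) (add_le_add haρ hbρ)
  have h2 : 1 / 2 * w + 1 / 2 * w = w := by
    rw [← add_mul, one_div, ENNReal.inv_two_add_inv_two, one_mul]
  have h3 : 1 / 2 * w ≤ 3 * dataNorm s p (fun n => c n - e n) := by
    have h4 : 1 / 2 * w + 1 / 2 * w ≤ 3 * dataNorm s p (fun n => c n - e n) + 1 / 2 * w := by
      rwa [h2]
    exact (ENNReal.add_le_add_iff_right (by finiteness)).1 h4
  calc w = 1 / 2 * w + 1 / 2 * w := h2.symm
    _ ≤ 3 * dataNorm s p (fun n => c n - e n) + 3 * dataNorm s p (fun n => c n - e n) := by gcongr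
    _ = _ := by ring

end

/-! ### Uniqueness for the integral equation -/

section

variable {κ : ℂ} {a b : ℤ → ℝ → ℂ} {s p T : ℝ} {K : ℝ≥0}

lemma osc_congr {ψ : ℝ} {f g : ℝ → ℂ} {c d x y : ℝ} (hx : x ∈ Set.Icc c d) (hy : y ∈ Set.Icc c d)
    (h : ∀ t ∈ Set.Icc c d, f t = g t) : osc ψ f x y = osc ψ g x y := by
  refine intervalIntegral.integral_congr fun t ht => ?_
  rw [h t ((Set.uIcc_subset_Icc hx hy) ht)]

lemma force_indicator {c d : ℝ} (n : ℤ) (k : ℤ × ℤ) {t : ℝ} (ht : t ∈ Set.Icc c d) :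
    force κ (fun n => (Set.Icc c d).indicator (a n)) n k t = force κ a n k t := by
  simp only [force, Set.indicator_of_mem ht]

lemma duhamel_indicator {c d x y : ℝ} (hx : x ∈ Set.Icc c d) (hy : y ∈ Set.Icc c d) (n : ℤ) :
    duhamel κ (fun n => (Set.Icc c d).indicator (a n)) n x y = duhamel κ a n x y :=
  tsum_congr fun k => osc_congr hx hy fun _ ht => force_indicator n k ht

/-- Two solutions of the integral equation that agree at one point of a short interval agree on
this interval. -/
lemma eqOn_short (hp : 1 ≤ p) (hκ : ‖κ‖ₑ ≤ 1)
    (hK : ∀ x y z : ℤ → ℝ≥0∞, wl s p (triSum x y z) ≤ K * (wl s p x * wl s p y * wl s p z))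
    (ha : ∀ n, Measurable (a n)) (hb : ∀ n, Measurable (b n)) {ρ : ℝ≥0∞} (hρ : ρ ≠ ∞)
    (haρ : seqNorm s p a ≤ ρ) (hbρ : seqNorm s p b ≤ ρ) {c d t₀ : ℝ} (hcd2 : d - c ≤ 2)
    (ht₀ : t₀ ∈ Set.Icc c d) (hsmall : 36 * ENNReal.ofReal (√(d - c)) * K * (3 * ρ) ^ 2 ≤ 1 / 2)
    (ha' : ∀ t ∈ Set.Icc c d, ∀ n, a n t = a n t₀ + duhamel κ a n t₀ t)
    (hb' : ∀ t ∈ Set.Icc c d, ∀ n, b n t = b n t₀ + duhamel κ b n t₀ t)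
    (h₀ : ∀ n, a n t₀ = b n t₀) : ∀ t ∈ Set.Icc c d, ∀ n, a n t = b n t := by
  set J := Set.Icc c d with hJ
  set a' : ℤ → ℝ → ℂ := fun n => J.indicator (a n) with hadef
  set b' : ℤ → ℝ → ℂ := fun n => J.indicator (b n) with hbdef
  have ma (n : ℤ) : Measurable (a' n) := (ha n).indicator measurableSet_Icc
  have mb (n : ℤ) : Measurable (b' n) := (hb n).indicator measurableSet_Icc
  -- Restriction to the subinterval costs the factor 3 of a sharp cut-off, hence 3ρ in the smallness
  -- condition.
  have na : seqNorm s p a' ≤ 3 * ρ := (seqNorm_indicator_le hp ha c d).trans (by gcongr)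
  have nb : seqNorm s p b' ≤ 3 * ρ := (seqNorm_indicator_le hp hb c d).trans (by gcongr)
  have h3 : 3 * ρ ≠ ∞ := by finiteness
  have h1 := seqNorm_duhamel_sub_le hp hκ hK ma mb h3 na nb hcd2 ht₀
  have e : (fun n => J.indicator fun t => duhamel κ a' n t₀ t - duhamel κ b' n t₀ t) =
      fun n => a' n - b' n := by
    funext n t
    by_cases ht : t ∈ J
    · simp only [Pi.sub_apply, hadef, hbdef, Set.indicator_of_mem ht]
      rw [duhamel_indicator ht₀ ht, duhamel_indicator ht₀ ht, ha' t ht, hb' t ht, h₀]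
      ring
    · simp [hadef, hbdef, ht]
  rw [e] at h1
  set w := seqNorm s p (fun n => a' n - b' n) with hw
  have hfin : w ≠ ∞ := by
    refine ne_top_of_le_ne_top (ENNReal.add_ne_top.2 ⟨h3, h3⟩) ?_
    exact le_trans ((wl_mono hp fun n => timeNorm_sub_le (ma n) (mb n)).trans
      (wl_add_le hp _ _)) (add_le_add na nb)
  -- The difference satisfies w ≤ w/2 with w finite.
  have hw0 : w = 0 := by
    by_contra h0
    have h2 : w ≤ 1 / 2 * w := h1.trans (mul_le_mul' hsmall le_rfl)
    have h4 : 1 / 2 * w < 1 * w := ENNReal.mul_lt_mul_left h0 hfin (by simp)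
    rw [one_mul] at h4
    exact absurd h2 (not_le.2 h4)
  intro t ht n
  have h5 := congrFun (eq_zero_of_timeNorm (eq_zero_of_wl hp hw0 n)) t
  simp only [Pi.sub_apply, hadef, hbdef, Set.indicator_of_mem ht, Pi.zero_apply] at h5
  exact sub_eq_zero.1 h5

lemma duhamel_sub_duhamel (hp : 1 ≤ p) (hκ : ‖κ‖ₑ ≤ 1)
    (hK : ∀ x y z : ℤ → ℝ≥0∞, wl s p (triSum x y z) ≤ K * (wl s p x * wl s p y * wl s p z))
    (ha : ∀ n, Measurable (a n)) (hf : seqNorm s p a ≠ ∞) {c d t₀ t₁ t : ℝ} (hcd2 : d - c ≤ 2)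
    (h₀ : t₀ ∈ Set.Icc c d) (h₁ : t₁ ∈ Set.Icc c d) (ht : t ∈ Set.Icc c d) (n : ℤ) :
    duhamel κ a n t₀ t - duhamel κ a n t₀ t₁ = duhamel κ a n t₁ t := by
  have hO := oscTotal_force_ne_top hp hκ hK ha hf n
  have hm := measurable_force (κ := κ) ha n
  rw [duhamel, duhamel, ← (summable_osc hm hO hcd2 h₀ ht).tsum_sub (summable_osc hm hO hcd2 h₀ h₁)]
  exact tsum_congr fun k => osc_sub_osc (hm k) (supNorm_ne_top_of_oscTotal hO k) _ _ _ _

/-- Uniqueness for the integral equation. -/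
theorem eqOn_of_integral_eq (hp : 1 ≤ p) (hκ : ‖κ‖ₑ ≤ 1)
    (hK : ∀ x y z : ℤ → ℝ≥0∞, wl s p (triSum x y z) ≤ K * (wl s p x * wl s p y * wl s p z))
    (hT : 0 < T) (hT1 : T ≤ 1) (ha : ∀ n, Measurable (a n)) (hb : ∀ n, Measurable (b n))
    (hfa : seqNorm s p a ≠ ∞) (hfb : seqNorm s p b ≠ ∞) {c : ℤ → ℂ}
    (ha' : ∀ t ∈ Set.Icc (-T) T, ∀ n, a n t = c n + duhamel κ a n 0 t)
    (hb' : ∀ t ∈ Set.Icc (-T) T, ∀ n, b n t = c n + duhamel κ b n 0 t) :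
    ∀ t ∈ Set.Icc (-T) T, ∀ n, a n t = b n t := by
  set ρ := seqNorm s p a + seqNorm s p b with hρdef
  have hρ : ρ ≠ ∞ := ENNReal.add_ne_top.2 ⟨hfa, hfb⟩
  have h2T : T - -T ≤ 2 := by linarith
  have h0 : (0 : ℝ) ∈ Set.Icc (-T) T := ⟨by linarith, hT.le⟩
  -- The two solutions may be large; the step length ε is adapted to their size, not to that of the
  -- datum.
  obtain ⟨ε, hε, hsmall⟩ : ∃ ε : ℝ, 0 < ε ∧ 36 * ENNReal.ofReal (√ε) * K * (3 * ρ) ^ 2 ≤ 1 / 2 := by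
    have h1 : Tendsto (fun ε : ℝ => 36 * ENNReal.ofReal (√ε) * K * (3 * ρ) ^ 2) (𝓝[>] 0) (𝓝 0) := by
      have h2 : Tendsto (fun ε : ℝ => ENNReal.ofReal (√ε)) (𝓝[>] 0) (𝓝 0) := by
        have : Continuous fun ε : ℝ => ENNReal.ofReal (√ε) :=
          ENNReal.continuous_ofReal.comp Real.continuous_sqrt
        simpa using (this.tendsto 0).mono_left nhdsWithin_le_nhds
      have h3 : 36 * K * (3 * ρ) ^ 2 ≠ ∞ := by finiteness
      have h4 := ENNReal.Tendsto.const_mul h2 (Or.inr h3)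
      rw [mul_zero] at h4
      refine h4.congr fun ε => ?_
      ring
    have h5 := (h1.eventually_lt_const (by simp : (0 : ℝ≥0∞) < 1 / 2)).and self_mem_nhdsWithin
    obtain ⟨ε, h6, h7⟩ := h5.exists
    exact ⟨ε, h7, h6.le⟩
  -- The integral equation can be restarted at any time t₀ of [-T, T].
  have shift {a : ℤ → ℝ → ℂ} (ha : ∀ n, Measurable (a n)) (hfa : seqNorm s p a ≠ ∞)
      (ha' : ∀ t ∈ Set.Icc (-T) T, ∀ n, a n t = c n + duhamel κ a n 0 t) {t₀ t : ℝ}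
      (ht₀ : t₀ ∈ Set.Icc (-T) T) (ht : t ∈ Set.Icc (-T) T) (n : ℤ) :
      a n t = a n t₀ + duhamel κ a n t₀ t := by
    rw [ha' t ht, ha' t₀ ht₀, ← duhamel_sub_duhamel hp hκ hK ha hfa h2T h0 ht₀ ht]; ring
  have short {c d t₀ : ℝ} (hcd : c ≤ d) (hc : -T ≤ c) (hd : d ≤ T) (hε : d - c ≤ ε)
      (ht₀ : t₀ ∈ Set.Icc c d) (h : ∀ n, a n t₀ = b n t₀) :
      ∀ t ∈ Set.Icc c d, ∀ n, a n t = b n t := by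
    have hsub {t : ℝ} (ht : t ∈ Set.Icc c d) : t ∈ Set.Icc (-T) T :=
      ⟨hc.trans ht.1, ht.2.trans hd⟩
    refine eqOn_short hp hκ hK ha hb hρ le_self_add le_add_self (by linarith) ht₀ ?_
      (fun t ht => shift ha hfa ha' (hsub ht₀) (hsub ht))
      (fun t ht => shift hb hfb hb' (hsub ht₀) (hsub ht)) h
    refine le_trans ?_ hsmall
    gcongr
  have base (n : ℤ) : a n 0 = b n 0 := by
    rw [ha' 0 h0, hb' 0 h0]
    simp [duhamel, osc]
  -- Agreement spreads outward from 0 by one step of length ε in both directions.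
  have steps (k : ℕ) : ∀ t ∈ Set.Icc (-T) T, |t| ≤ k * ε → ∀ n, a n t = b n t := by
    induction k with
    | zero =>
      intro t _ h
      have : t = 0 := by
        rw [Nat.cast_zero, zero_mul] at h
        exact abs_eq_zero.1 (le_antisymm h (abs_nonneg t))
      rw [this]; exact base
    | succ k ih =>
      intro t ht h
      push_cast at h
      rcases le_or_gt |t| (k * ε) with h1 | h1
      · exact ih t ht h1
      have hk : 0 ≤ k * ε := by positivity
      rcases le_total 0 t with h2 | h2
      · rw [abs_of_nonneg h2] at h h1
        refine short (c := k * ε) (d := t) (t₀ := k * ε) h1.le (by linarith) ht.2 (by linarith)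
          ⟨le_rfl, h1.le⟩ (ih _ ⟨by linarith, by linarith [ht.2]⟩ ?_) t ⟨h1.le, le_rfl⟩
        rw [abs_of_nonneg hk]
      · rw [abs_of_nonpos h2] at h h1
        refine short (c := t) (d := -(k * ε)) (t₀ := -(k * ε)) (by linarith) ht.1 (by linarith)
          (by linarith) ⟨by linarith, le_rfl⟩ (ih _ ⟨by linarith [ht.1], by linarith⟩ ?_) t
          ⟨le_rfl, by linarith⟩
        rw [abs_neg, abs_of_nonneg hk]
  intro t ht
  obtain ⟨k, hk⟩ := exists_nat_ge (|t| / ε)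
  exact steps k t ht (by rwa [div_le_iff₀ hε] at hk)

end

/-! ### Fourier coefficients of the nonlinearity -/

section

/-- The mean of a complex function over a period. -/
def cmean (h : ℝ → ℂ) : ℂ := ((2 * Real.pi)⁻¹ : ℝ) * ∫ x in (0 : ℝ)..(2 * Real.pi), h x

/-- The character `e^{imx}`. -/
def chi (m : ℤ) (x : ℝ) : ℂ := Complex.exp (Complex.I * (m * x : ℝ))

lemma continuous_chi (m : ℤ) : Continuous (chi m) := by unfold chi; fun_prop

lemma chi_mul (m n : ℤ) (x : ℝ) : chi m x * chi n x = chi (m + n) x := by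
  rw [chi, chi, chi, ← Complex.exp_add]; congr 1; push_cast; ring

lemma conj_chi (m : ℤ) (x : ℝ) : (starRingEnd ℂ) (chi m x) = chi (-m) x := by
  rw [chi, chi, ← Complex.exp_conj]; congr 1
  rw [map_mul, Complex.conj_I, Complex.conj_ofReal]; push_cast; ring

lemma hasDerivAt_chi (m : ℤ) (x : ℝ) : HasDerivAt (chi m) (Complex.I * m * chi m x) x := by
  have h1 : HasDerivAt (fun y : ℝ => Complex.I * ((m * y : ℝ) : ℂ)) (Complex.I * m) x := by
    have h2 : HasDerivAt (fun y : ℝ => ((m * y : ℝ) : ℂ)) ((m * 1 : ℝ) : ℂ) x :=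
      ((hasDerivAt_id x).const_mul (m : ℝ)).ofReal_comp
    simpa using h2.const_mul Complex.I
  have := h1.cexp
  rwa [mul_comm] at this

lemma cmean_chi (m : ℤ) : cmean (chi m) = if m = 0 then 1 else 0 := by
  have hpi : (Real.pi : ℂ) ≠ 0 := by exact_mod_cast Real.pi_ne_zero
  split_ifs with h
  · subst h
    simp [cmean, chi]
    field_simp
  · have h1 : ∀ x ∈ Set.uIcc 0 (2 * Real.pi),
        HasDerivAt (fun x => (Complex.I * m)⁻¹ * chi m x) (chi m x) x := fun x _ => by
      have h2 := (hasDerivAt_chi m x).const_mul (Complex.I * m)⁻¹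
      have hm : Complex.I * m ≠ 0 := mul_ne_zero Complex.I_ne_zero (by exact_mod_cast h)
      rwa [← mul_assoc, inv_mul_cancel₀ hm, one_mul] at h2
    rw [cmean, intervalIntegral.integral_eq_sub_of_hasDerivAt h1
      ((continuous_chi m).intervalIntegrable _ _)]
    have h3 : chi m (2 * Real.pi) = chi m 0 := by
      have h4 : Complex.exp (m * (2 * Real.pi * Complex.I)) = 1 := Complex.exp_int_mul_two_pi_mul_I m
      rw [chi, chi, mul_zero, Complex.ofReal_zero, mul_zero, Complex.exp_zero, ← h4]
      congr 1; push_cast; ring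
    rw [h3, sub_self, mul_zero]

lemma cmean_sum {ι : Type*} (A : Finset ι) (α : ι → ℂ) (q : ι → ℤ) :
    cmean (fun x => ∑ i ∈ A, α i * chi (q i) x) = ∑ i ∈ A, if q i = 0 then α i else 0 := by
  have h : ∫ x in (0 : ℝ)..(2 * Real.pi), ∑ i ∈ A, α i * chi (q i) x =
      ∑ i ∈ A, ∫ x in (0 : ℝ)..(2 * Real.pi), α i * chi (q i) x :=
    intervalIntegral.integral_finsetSum fun i _ =>
      (continuous_const.mul (continuous_chi _)).intervalIntegrable _ _
  simp only [cmean]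
  rw [h, Finset.mul_sum]
  refine Finset.sum_congr rfl fun i _ => ?_
  rw [intervalIntegral.integral_const_mul]
  have := cmean_chi (q i)
  unfold cmean at this
  calc _ = α i * (((2 * Real.pi)⁻¹ : ℝ) * ∫ x in (0 : ℝ)..(2 * Real.pi), chi (q i) x) := by ring
    _ = _ := by rw [this]; split_ifs <;> simp

lemma cmean_add {f g : ℝ → ℂ} (hf : Continuous f) (hg : Continuous g) :
    cmean (fun x => f x + g x) = cmean f + cmean g := by
  unfold cmean
  rw [intervalIntegral.integral_add (hf.intervalIntegrable _ _) (hg.intervalIntegrable _ _), mul_add]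

lemma mean_re {F : ℝ → ℂ} (hF : Continuous F) : mean (fun x => (F x).re) = (cmean F).re := by
  have h := Complex.reCLM.intervalIntegral_comp_comm (hF.intervalIntegrable (μ := volume) 0
    (2 * Real.pi))
  rw [mean, cmean, Complex.re_ofReal_mul]
  congr 1

lemma mean_im {F : ℝ → ℂ} (hF : Continuous F) : mean (fun x => (F x).im) = (cmean F).im := by
  have h := Complex.imCLM.intervalIntegral_comp_comm (hF.intervalIntegrable (μ := volume) 0
    (2 * Real.pi))
  rw [mean, cmean, Complex.im_ofReal_mul]
  congr 1

section

variable (S : Finset ℤ) (c : ℤ → ℂ)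

/-- A trigonometric polynomial. -/
def trig (x : ℝ) : ℂ := ∑ m ∈ S, c m * chi m x

lemma continuous_trig : Continuous (trig S c) :=
  continuous_finsetSum _ fun m _ => continuous_const.mul (continuous_chi m)

lemma deriv_trig : deriv (trig S c) = trig S fun m => Complex.I * m * c m := by
  funext x
  have h : HasDerivAt (trig S c) (∑ m ∈ S, c m * (Complex.I * m * chi m x)) x :=
    HasDerivAt.fun_sum fun m _ => (hasDerivAt_chi m x).const_mul (c m)
  rw [h.deriv, trig]
  exact Finset.sum_congr rfl fun m _ => by ring

lemma conj_trig_mul_trig (d : ℤ → ℂ) (x : ℝ) : (starRingEnd ℂ) (trig S c x) * trig S d x =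
    ∑ k ∈ S ×ˢ S, (starRingEnd ℂ) (c k.1) * d k.2 * chi (k.2 - k.1) x := by
  rw [trig, trig, map_sum, Finset.sum_mul_sum, Finset.sum_product]
  refine Finset.sum_congr rfl fun m _ => Finset.sum_congr rfl fun n _ => ?_
  rw [map_mul, conj_chi, sub_eq_add_neg, add_comm n, ← chi_mul]; ring

lemma cmean_conj_trig_mul_trig (d : ℤ → ℂ) :
    cmean (fun x => (starRingEnd ℂ) (trig S c x) * trig S d x) =
      ∑ m ∈ S, (starRingEnd ℂ) (c m) * d m := by
  simp_rw [conj_trig_mul_trig]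
  rw [cmean_sum, Finset.sum_product]
  refine Finset.sum_congr rfl fun m hm => ?_
  simp only [sub_eq_zero]
  rw [Finset.sum_ite_eq' S m, if_pos hm]

lemma continuous_conj_trig_mul_trig (d : ℤ → ℂ) :
    Continuous fun x => (starRingEnd ℂ) (trig S c x) * trig S d x :=
  (Complex.continuous_conj.comp (continuous_trig S c)).mul (continuous_trig S d)

lemma mean_normSq_trig : ((mean fun x => ‖trig S c x‖ ^ 2 : ℝ) : ℂ) =
    ∑ m ∈ S, c m * (starRingEnd ℂ) (c m) := by
  have e (x : ℝ) : ‖trig S c x‖ ^ 2 = ((starRingEnd ℂ) (trig S c x) * trig S c x).re := by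
    rw [mul_comm, Complex.mul_conj, Complex.ofReal_re, Complex.normSq_eq_norm_sq]
  simp_rw [e]
  rw [mean_re (continuous_conj_trig_mul_trig S c c),
    cmean_conj_trig_mul_trig, Complex.re_sum, Complex.ofReal_sum]
  refine Finset.sum_congr rfl fun m _ => ?_
  rw [mul_comm, Complex.mul_conj, Complex.ofReal_re]

lemma mean_im_trig :
    ((mean fun x => ((starRingEnd ℂ) (trig S c x) * deriv (trig S c) x).im : ℝ) : ℂ) =
    ∑ m ∈ S, m * (c m * (starRingEnd ℂ) (c m)) := by
  rw [deriv_trig, mean_im (continuous_conj_trig_mul_trig S c _), cmean_conj_trig_mul_trig, Complex.im_sum, Complex.ofReal_sum]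
  refine Finset.sum_congr rfl fun m _ => ?_
  have e : (starRingEnd ℂ) (c m) * (Complex.I * m * c m) =
      Complex.I * ((m * Complex.normSq (c m) : ℝ) : ℂ) := by
    push_cast
    rw [← Complex.mul_conj]; ring
  rw [e, Complex.I_mul_im, Complex.ofReal_re, Complex.mul_conj]
  push_cast; rfl

lemma cmean_trig_mul_chi (n : ℤ) :
    cmean (fun x => trig S c x * chi (-n) x) = if n ∈ S then c n else 0 := by
  have e (x : ℝ) : trig S c x * chi (-n) x = ∑ m ∈ S, c m * chi (m - n) x := by
    rw [trig, Finset.sum_mul]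
    exact Finset.sum_congr rfl fun m _ => by rw [mul_assoc, chi_mul, sub_eq_add_neg]
  simp_rw [e]
  rw [cmean_sum]
  simp only [sub_eq_zero]
  exact Finset.sum_ite_eq' S n c

lemma cmean_cubic (n : ℤ) :
    cmean (fun x => trig S c x * (starRingEnd ℂ) (trig S c x) * deriv (trig S c) x * chi (-n) x) =
      Complex.I * ∑ k ∈ S ×ˢ S, if k.1 + k.2 - n ∈ S then
        k.2 * (c k.1 * (starRingEnd ℂ) (c (k.1 + k.2 - n)) * c k.2) else 0 := by
  have e (x : ℝ) : trig S c x * (starRingEnd ℂ) (trig S c x) * deriv (trig S c) x * chi (-n) x =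
      ∑ q ∈ (S ×ˢ S) ×ˢ S, (Complex.I * (q.1.2 * (c q.1.1 * (starRingEnd ℂ) (c q.2) * c q.1.2))) *
        chi (q.1.1 + q.1.2 - n - q.2) x := by
    rw [deriv_trig, Finset.sum_product, Finset.sum_product]
    have e1 : trig S c x * (starRingEnd ℂ) (trig S c x) *
        trig S (fun m => Complex.I * m * c m) x * chi (-n) x =
        trig S c x * trig S (fun m => Complex.I * m * c m) x *
          (starRingEnd ℂ) (trig S c x) * chi (-n) x := by ring
    rw [e1]
    simp only [trig, map_sum]
    rw [Finset.sum_mul_sum, Finset.sum_mul, Finset.sum_mul]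
    refine Finset.sum_congr rfl fun i _ => ?_
    rw [Finset.sum_mul, Finset.sum_mul]
    refine Finset.sum_congr rfl fun j _ => ?_
    rw [Finset.mul_sum, Finset.sum_mul]
    refine Finset.sum_congr rfl fun m _ => ?_
    rw [map_mul, conj_chi, show i + j - n - m = i + j + -n + -m by ring, ← chi_mul, ← chi_mul,
      ← chi_mul]
    ring
  simp_rw [e]
  rw [cmean_sum, Finset.sum_product, Finset.mul_sum]
  refine Finset.sum_congr rfl fun k _ => ?_
  simp only [sub_eq_zero]
  rw [Finset.sum_ite_eq S (k.1 + k.2 - n)]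
  split_ifs <;> simp

/-- The Fourier coefficients of the nonlinearity at a trigonometric polynomial. -/
theorem cmean_nonlinearity (n : ℤ) :
    cmean (fun x => nonlinearity (trig S c) x * chi (-n) x) =
      Complex.I * ∑ k ∈ (S ×ˢ S).filter fun k => k.1 + k.2 - n ∈ S,
        mult n k * (c k.1 * (starRingEnd ℂ) (c (k.1 + k.2 - n)) * c k.2) := by
  set M : ℂ := ∑ m ∈ S, c m * (starRingEnd ℂ) (c m) with hM
  set P : ℂ := ∑ m ∈ S, m * (c m * (starRingEnd ℂ) (c m)) with hP
  have hc := continuous_trig S c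
  have hd : Continuous (deriv (trig S c)) := by rw [deriv_trig]; exact continuous_trig _ _
  -- The two renormalizing terms act diagonally: together they contribute -i(nM + P) c_n, where M is
  -- the mean of |u|² and P that of Im(ū ∂ₓu).
  have e (x : ℝ) : nonlinearity (trig S c) x * chi (-n) x =
      trig S c x * (starRingEnd ℂ) (trig S c x) * deriv (trig S c) x * chi (-n) x +
      trig S (fun m => -(M * (Complex.I * m * c m)) - Complex.I * P * c m) x * chi (-n) x := by
    have e1 : ((‖trig S c x‖ ^ 2 : ℝ) : ℂ) = trig S c x * (starRingEnd ℂ) (trig S c x) := by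
      rw [Complex.mul_conj, Complex.normSq_eq_norm_sq]
    have e2 : trig S (fun m => -(M * (Complex.I * m * c m)) - Complex.I * P * c m) x =
        -(M * deriv (trig S c) x) - Complex.I * P * trig S c x := by
      rw [deriv_trig]
      simp only [trig, Finset.mul_sum, ← Finset.sum_neg_distrib, ← Finset.sum_sub_distrib]
      exact Finset.sum_congr rfl fun m _ => by ring
    rw [e2, nonlinearity, mean_normSq_trig, mean_im_trig, e1]
    ring
  have h1 : Continuous fun x =>
      trig S c x * (starRingEnd ℂ) (trig S c x) * deriv (trig S c) x * chi (-n) x :=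
    ((hc.mul (Complex.continuous_conj.comp hc)).mul hd).mul (continuous_chi _)
  have h2 : Continuous fun x =>
      trig S (fun m => -(M * (Complex.I * m * c m)) - Complex.I * P * c m) x * chi (-n) x :=
    (continuous_trig _ _).mul (continuous_chi _)
  simp_rw [e]
  rw [cmean_add h1 h2, cmean_cubic, cmean_trig_mul_chi]
  set C : ℤ × ℤ → ℂ := fun k => c k.1 * (starRingEnd ℂ) (c (k.1 + k.2 - n)) * c k.2 with hC
  -- The derivative may fall on either of the two unconjugated factors, so k₂ can be symmetrized to
  -- (k₁ + k₂)/2.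
  have hswap : ∑ k ∈ S ×ˢ S, (if k.1 + k.2 - n ∈ S then k.2 * C k else 0) =
      ∑ k ∈ S ×ˢ S, (if k.1 + k.2 - n ∈ S then k.1 * C k else 0) := by
    rw [Finset.sum_product, Finset.sum_comm, Finset.sum_product]
    refine Finset.sum_congr rfl fun i _ => Finset.sum_congr rfl fun j _ => ?_
    simp only [hC, add_comm j i]
    split_ifs
    · ring
    · rfl
  -- On the line k₁ = n one has n₂ = k₂, and the sum of (n + k₂)|c_{k₂}|² c_n is exactly (nM + P)
  -- c_n.
  have hline : ∑ k ∈ S ×ˢ S, (if k.1 + k.2 - n ∈ S then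
        (if k.1 = n then ((n : ℂ) + k.2) * C k else 0) else 0) =
      if n ∈ S then (n * M + P) * c n else 0 := by
    rw [Finset.sum_product]
    have h1 (i j : ℤ) : (if i + j - n ∈ S then
        (if i = n then ((n : ℂ) + j) * C (i, j) else 0) else 0) =
        if i = n then (if j ∈ S then ((n : ℂ) + j) * C (n, j) else 0) else 0 := by
      by_cases h : i = n
      · subst h; simp
      · simp [h]
    simp only [h1]
    rw [Finset.sum_comm]
    simp only [Finset.sum_ite_eq']
    split_ifs with hn
    · rw [hM, hP, Finset.mul_sum, ← Finset.sum_add_distrib, Finset.sum_mul]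
      refine Finset.sum_congr rfl fun j hj => ?_
      simp only [hC, add_sub_cancel_left]
      ring
    · simp
  have hline' : ∑ k ∈ S ×ˢ S, (if k.1 + k.2 - n ∈ S then
        (if k.2 = n then ((n : ℂ) + k.1) * C k else 0) else 0) =
      if n ∈ S then (n * M + P) * c n else 0 := by
    rw [← hline, Finset.sum_product, Finset.sum_comm, Finset.sum_product]
    refine Finset.sum_congr rfl fun i _ => Finset.sum_congr rfl fun j _ => ?_
    simp only [hC, add_comm j i]
    split_ifs
    · ring
    · rfl
    · rfl
  -- Each line is subtracted once, so the point (n, n) is subtracted twice: 2n - 2n - 2n = -2n,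
  -- which explains the value -n of the multiplier there.
  have hmult (k : ℤ × ℤ) : 2 * ((mult n k : ℝ) : ℂ) * C k = k.2 * C k + k.1 * C k -
      (if k.1 = n then ((n : ℂ) + k.2) * C k else 0) -
      (if k.2 = n then ((n : ℂ) + k.1) * C k else 0) := by
    unfold mult
    by_cases h1 : k.1 = n <;> by_cases h2 : k.2 = n <;> simp [h1, h2] <;> ring
  have hsum : 2 * ∑ k ∈ (S ×ˢ S).filter (fun k => k.1 + k.2 - n ∈ S), (mult n k : ℂ) * C k =
      2 * ∑ k ∈ S ×ˢ S, (if k.1 + k.2 - n ∈ S then k.2 * C k else 0) -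
      2 * if n ∈ S then (n * M + P) * c n else 0 := by
    have h3 : 2 * ∑ k ∈ S ×ˢ S, (if k.1 + k.2 - n ∈ S then (k.2 : ℂ) * C k else 0) =
        ∑ k ∈ S ×ˢ S, (if k.1 + k.2 - n ∈ S then (k.2 : ℂ) * C k else 0) +
        ∑ k ∈ S ×ˢ S, (if k.1 + k.2 - n ∈ S then (k.1 : ℂ) * C k else 0) := by
      rw [← hswap]; ring
    have h4 : 2 * (if n ∈ S then (n * M + P) * c n else 0) =
        ∑ k ∈ S ×ˢ S, (if k.1 + k.2 - n ∈ S then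
          (if k.1 = n then ((n : ℂ) + k.2) * C k else 0) else 0) +
        ∑ k ∈ S ×ˢ S, (if k.1 + k.2 - n ∈ S then
          (if k.2 = n then ((n : ℂ) + k.1) * C k else 0) else 0) := by
      rw [hline, hline']; ring
    rw [h3, h4, Finset.sum_filter, Finset.mul_sum, ← Finset.sum_add_distrib,
      ← Finset.sum_add_distrib, ← Finset.sum_sub_distrib]
    refine Finset.sum_congr rfl fun k _ => ?_
    by_cases h : k.1 + k.2 - n ∈ S
    · simp only [h, if_true]
      rw [← mul_assoc, hmult]; ring
    · simp [h]
  have hfin : ∑ k ∈ (S ×ˢ S).filter (fun k => k.1 + k.2 - n ∈ S), (mult n k : ℂ) * C k =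
      ∑ k ∈ S ×ˢ S, (if k.1 + k.2 - n ∈ S then k.2 * C k else 0) -
      if n ∈ S then (n * M + P) * c n else 0 := by
    have := hsum
    rw [← mul_sub] at this
    exact mul_left_cancel₀ (by norm_num) this
  rw [hfin, mul_sub]
  split_ifs
  · ring
  · ring

end

/-- The pairs of frequencies in the `n`-th coefficient of the nonlinearity at `P_{≤N} f`. -/
def pairs (N : ℕ) (n : ℤ) : Finset (ℤ × ℤ) :=
  ((Finset.Icc (-(N : ℤ)) N) ×ˢ (Finset.Icc (-(N : ℤ)) N)).filter
    fun k => k.1 + k.2 - n ∈ Finset.Icc (-(N : ℤ)) N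

theorem nonlinearityCoeff_eq (N : ℕ) (f : L2Torus) (n : ℤ) :
    nonlinearityCoeff N f n = Complex.I * ∑ k ∈ pairs N n,
      mult n k * (coeff f k.1 * (starRingEnd ℂ) (coeff f (k.1 + k.2 - n)) * coeff f k.2) := by
  rw [pairs, ← cmean_nonlinearity, nonlinearityCoeff, cmean]
  congr 1
  refine intervalIntegral.integral_congr fun x _ => ?_
  change nonlinearity (trig _ (coeff f)) x * _ = _
  congr 1
  rw [chi, ← mul_neg]
  congr 2
  push_cast; ring

/-- The frequency truncations exhaust ℤ², so the limit in N is a sum over all pairs as soon as this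
sum converges unconditionally. -/
lemma tendsto_pairs (n : ℤ) : Tendsto (fun N => pairs N n) atTop atTop := by
  refine tendsto_atTop_finset_of_monotone (fun N M h k hk => ?_) fun k => ?_
  · simp only [pairs, Finset.mem_filter, Finset.mem_product, Finset.mem_Icc] at hk ⊢
    have : (N : ℤ) ≤ M := by exact_mod_cast h
    omega
  · refine ⟨k.1.natAbs + k.2.natAbs + n.natAbs, ?_⟩
    simp only [pairs, Finset.mem_filter, Finset.mem_product, Finset.mem_Icc]
    have h1 := abs_le.1 (le_refl |k.1|)
    have h2 := abs_le.1 (le_refl |k.2|)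
    have h3 := abs_le.1 (le_refl |n|)
    push_cast
    omega

end

/-! ### Interaction representation of functions on the circle -/

section

variable {s p : ℝ}

lemma coeff_eq_repr (f : L2Torus) (n : ℤ) : coeff f n = fourierBasis.repr f n :=
  (fourierBasis_repr f n).symm

lemma coeff_sub (f g : L2Torus) (n : ℤ) : coeff (f - g) n = coeff f n - coeff g n := by
  simp only [coeff_eq_repr, map_sub]; rfl

lemma eq_of_coeff_eq {f g : L2Torus} (h : ∀ n, coeff f n = coeff g n) : f = g := by
  apply fourierBasis.repr.injective
  ext n
  simpa only [coeff_eq_repr] using h n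

lemma flNorm_eq (f : L2Torus) : flNorm s p f = dataNorm s p (coeff f) := by
  unfold flNorm dataNorm wl wt
  simp_rw [ENNReal.ofReal_mul (Real.rpow_nonneg (bracket_pos _).le s), ofReal_norm]

lemma summable_rpow_of_dataNorm (hp : 1 ≤ p) {c : ℤ → ℂ} (h : dataNorm s p c ≠ ∞) :
    Summable fun n : ℤ => (bracket n ^ s * ‖c n‖) ^ p := by
  have hp0 : 0 < p := by linarith
  have h1 : ∑' n : ℤ, (wt s n * ‖c n‖ₑ) ^ p ≠ ∞ := by
    intro h2
    apply h
    rw [dataNorm, wl, h2, ENNReal.top_rpow_of_pos (by positivity)]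
  refine (ENNReal.summable_toReal h1).congr fun n => ?_
  rw [← ENNReal.toReal_rpow, ENNReal.toReal_mul, wt, toReal_enorm,
    ENNReal.toReal_ofReal (Real.rpow_nonneg (bracket_pos _).le s)]

/-- This puts the Fourier–Lebesgue space inside L², so that a sequence of finite norm defines a
function. For p ≤ 2 the coefficients are bounded and ℓ^p suffices. For p > 2 either |c_n|² is at
most the n-th term of the norm, or it is at most ⟨n⟩^{-κ}, with κ = 2sp/(p - 2). -/
lemma summable_sq_of_dataNorm (hs : 1 / 2 ≤ s) (hp : 1 ≤ p) (hsp : 3 / 4 - s < 1 / p)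
    {c : ℤ → ℂ} (h : dataNorm s p c ≠ ∞) : Summable fun n : ℤ => ‖c n‖ ^ 2 := by
  have hsum := summable_rpow_of_dataNorm hp h
  have hw (n : ℤ) : 1 ≤ bracket n ^ s := Real.one_le_rpow (one_le_bracket _) (by linarith)
  rcases le_or_gt p 2 with hp2 | hp2
  · set B := (dataNorm s p c).toReal with hB
    have hbd (n : ℤ) : ‖c n‖ ≤ B := by
      have h1 := le_wl (s := s) hp (fun n => ‖c n‖ₑ) n
      have h2 : ‖c n‖ₑ ≤ dataNorm s p c := by
        refine le_trans ?_ h1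
        refine le_mul_of_one_le_left zero_le ?_
        rw [wt, ENNReal.one_le_ofReal]
        exact hw n
      rw [← toReal_enorm]
      exact ENNReal.toReal_mono h h2
    refine Summable.of_nonneg_of_le (fun n => by positivity) (fun n => ?_)
      (hsum.mul_left (B ^ (2 - p)))
    have hx := norm_nonneg (c n)
    calc ‖c n‖ ^ 2 = ‖c n‖ ^ (2 - p) * ‖c n‖ ^ p := by
          rw [← Real.rpow_add_of_nonneg hx (by linarith) (by linarith), sub_add_cancel,
            Real.rpow_two]
      _ ≤ B ^ (2 - p) * (bracket n ^ s * ‖c n‖) ^ p := by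
          gcongr
          · exact hbd n
          · exact le_mul_of_one_le_left hx (hw n)
  · set κ := 2 * s * p / (p - 2) with hκ
    have hp20 : 0 < p - 2 := by linarith
    -- From (3/4 - s) p < 1 one gets 2sp > 3p/2 - 2 > p - 2.
    have hκ1 : 1 < κ := by
      rw [hκ, lt_div_iff₀ hp20]
      have h1 : (3 / 4 - s) * p < 1 := by rwa [lt_div_iff₀ (by linarith)] at hsp
      nlinarith
    have hs2 : Summable fun n : ℤ => bracket n ^ (-κ) := by
      refine Summable.of_nonneg_of_le (fun n => Real.rpow_nonneg (bracket_pos _).le _)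
        (fun n => ?_) ((summable_brk_rpow hκ1).mul_left (2 ^ κ))
      have h2 : brk n / 2 ≤ bracket n := by
        have := le_two_bracket n
        unfold brk
        linarith
      have hb0 : 0 < brk n := by unfold brk; positivity
      calc bracket n ^ (-κ) ≤ (brk n / 2) ^ (-κ) :=
            Real.rpow_le_rpow_of_nonpos (by positivity) h2 (by linarith)
        _ = _ := by
            rw [Real.div_rpow hb0.le (by norm_num), Real.rpow_neg (by norm_num : (0 : ℝ) ≤ 2),
              div_inv_eq_mul, mul_comm]
    refine Summable.of_nonneg_of_le (fun n => by positivity) (fun n => ?_) (hsum.add hs2)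
    have hx := norm_nonneg (c n)
    have hb := bracket_pos n
    rcases le_or_gt (‖c n‖ ^ 2) ((bracket n ^ s * ‖c n‖) ^ p) with h1 | h1
    · exact h1.trans (le_add_of_nonneg_right (Real.rpow_nonneg hb.le _))
    · refine le_trans ?_ (le_add_of_nonneg_left (Real.rpow_nonneg (by positivity) _))
      have hx0 : 0 < ‖c n‖ := by
        rcases hx.eq_or_lt with h0 | h0
        · rw [← h0] at h1
          simp [(by linarith : p ≠ 0)] at h1
        · exact h0
      have h2 : ‖c n‖ ^ (p - 2) ≤ bracket n ^ (-(s * p)) := by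
        rw [Real.mul_rpow (by positivity) hx, ← Real.rpow_mul hb.le] at h1
        rw [Real.rpow_sub hx0, Real.rpow_two, Real.rpow_neg hb.le, div_le_iff₀ (by positivity),
          inv_mul_eq_div, le_div_iff₀ (Real.rpow_pos_of_pos hb _), mul_comm]
        exact h1.le
      have h3 := Real.rpow_le_rpow (Real.rpow_nonneg hx _) h2
        (by positivity : 0 ≤ 2 / (p - 2))
      rw [← Real.rpow_mul hx, ← Real.rpow_mul hb.le, mul_div_cancel₀ _ hp20.ne', Real.rpow_two] at h3
      refine h3.trans (le_of_eq ?_)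
      congr 1
      rw [hκ]; ring

/-- The square-integrable function with prescribed Fourier coefficients. -/
def ofCoeff (c : ℤ → ℂ) : L2Torus :=
  open Classical in if h : Memℓp c 2 then fourierBasis.repr.symm ⟨c, h⟩ else 0

lemma coeff_ofCoeff (hs : 1 / 2 ≤ s) (hp : 1 ≤ p) (hsp : 3 / 4 - s < 1 / p)
    {c : ℤ → ℂ} (h : dataNorm s p c ≠ ∞) (n : ℤ) : coeff (ofCoeff c) n = c n := by
  have hm : Memℓp c 2 := memℓp_gen (by
    simpa using summable_sq_of_dataNorm hs hp hsp h)
  rw [ofCoeff, dif_pos hm, coeff_eq_repr, LinearIsometryEquiv.apply_symm_apply]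

/-- The Fourier coefficients of `u` on `[-T, T]` in the interaction representation. -/
def interaction (T : ℝ) (u : ℝ → L2Torus) (n : ℤ) : ℝ → ℂ :=
  (Set.Icc (-T) T).indicator fun t => Complex.exp (Complex.I * (t * -(n : ℝ) ^ 3 : ℝ)) * coeff (u t) n

lemma exp_mul_exp_neg (t x : ℝ) : Complex.exp (Complex.I * (t * x : ℝ)) *
    Complex.exp (Complex.I * (t * -x : ℝ)) = 1 := by
  rw [← Complex.exp_add, ← Complex.exp_zero]; congr 1; push_cast; ring

lemma coeff_eq_exp_mul {T : ℝ} {u : ℝ → L2Torus} {t : ℝ} (ht : t ∈ Set.Icc (-T) T) (n : ℤ) :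
    coeff (u t) n = Complex.exp (Complex.I * (t * (n : ℝ) ^ 3 : ℝ)) * interaction T u n t := by
  rw [interaction, Set.indicator_of_mem ht, ← mul_assoc, exp_mul_exp_neg, one_mul]

/-- The factorization of n³ - k₁³ + n₂³ - k₂³: the four free evolutions combine into a single
oscillation with frequency minus the phase. -/
lemma exp_freq (n : ℤ) (k : ℤ × ℤ) (t : ℝ) (x y z : ℂ) :
    Complex.exp (Complex.I * (t * -(n : ℝ) ^ 3 : ℝ)) *
      ((Complex.exp (Complex.I * (t * (k.1 : ℝ) ^ 3 : ℝ)) * x) *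
        (starRingEnd ℂ) (Complex.exp (Complex.I * (t * ((k.1 + k.2 - n : ℤ) : ℝ) ^ 3 : ℝ)) * y) *
        (Complex.exp (Complex.I * (t * (k.2 : ℝ) ^ 3 : ℝ)) * z)) =
      Complex.exp (Complex.I * (t * freq n k : ℝ)) * (x * (starRingEnd ℂ) y * z) := by
  have h1 : (starRingEnd ℂ) (Complex.exp (Complex.I * (t * ((k.1 + k.2 - n : ℤ) : ℝ) ^ 3 : ℝ))) =
      Complex.exp (Complex.I * (t * -((k.1 + k.2 - n : ℤ) : ℝ) ^ 3 : ℝ)) := by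
    rw [← Complex.exp_conj, map_mul, Complex.conj_I, Complex.conj_ofReal]
    congr 1; push_cast; ring
  have h2 : Complex.exp (Complex.I * (t * freq n k : ℝ)) =
      Complex.exp (Complex.I * (t * -(n : ℝ) ^ 3 : ℝ)) *
      Complex.exp (Complex.I * (t * (k.1 : ℝ) ^ 3 : ℝ)) *
      Complex.exp (Complex.I * (t * -((k.1 + k.2 - n : ℤ) : ℝ) ^ 3 : ℝ)) *
      Complex.exp (Complex.I * (t * (k.2 : ℝ) ^ 3 : ℝ)) := by
    rw [← Complex.exp_add, ← Complex.exp_add, ← Complex.exp_add]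
    congr 1
    rw [freq, phase]
    push_cast
    ring
  rw [map_mul, h1, h2]; ring

lemma supNorm_force_ne_top {κ : ℂ} {a : ℤ → ℝ → ℂ} (h : ∀ n, supNorm (a n) ≠ ∞) (n : ℤ)
    (k : ℤ × ℤ) : supNorm (force κ a n k) ≠ ∞ := by
  have h1 : supNorm (force κ a n k) ≤ ‖κ * mult n k‖ₑ *
      (supNorm (a k.1) * supNorm (a (k.1 + k.2 - n)) * supNorm (a k.2)) := by
    refine iSup_le fun t => ?_
    rw [force, enorm_mul, enorm_mul, enorm_mul, enorm_mul, enorm_conj]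
    gcongr <;> exact enorm_le_supNorm _ _
  have := h k.1
  have := h k.2
  have := h (k.1 + k.2 - n)
  exact ne_top_of_le_ne_top (by finiteness) h1

/-- For a truncated function the Duhamel term is a finite partial sum of the series in k, so the
limit in N can be compared with `duhamel`. The factor i comes from ∂ₓ. -/
lemma duhamel_truncated {σ T : ℝ} {u : ℝ → L2Torus} (hm : ∀ n, Measurable (interaction T u n))
    (hb : ∀ n, supNorm (interaction T u n) ≠ ∞) {t : ℝ} (hT : 0 ≤ T) (ht : t ∈ Set.Icc (-T) T)
    (n : ℤ) (N : ℕ) :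
    σ * ∫ t' in (0 : ℝ)..t,
      Complex.exp (Complex.I * ((t - t') * (n : ℝ) ^ 3 : ℝ)) * nonlinearityCoeff N (u t') n =
    Complex.exp (Complex.I * (t * (n : ℝ) ^ 3 : ℝ)) * ∑ k ∈ pairs N n,
      osc (freq n k) (force (Complex.I * σ) (interaction T u) n k) 0 t := by
  have h0 : (0 : ℝ) ∈ Set.Icc (-T) T := ⟨by linarith, hT⟩
  have hi (k : ℤ × ℤ) := intervalIntegrable_exp_mul
    (measurable_force (κ := Complex.I * σ) hm n k) (supNorm_force_ne_top hb n k) (freq n k) 0 t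
  simp only [osc]
  rw [← intervalIntegral.integral_finsetSum fun k _ => hi k, ← intervalIntegral.integral_const_mul,
    ← intervalIntegral.integral_const_mul]
  refine intervalIntegral.integral_congr fun t' ht' => ?_
  have ht'' : t' ∈ Set.Icc (-T) T := (Set.uIcc_subset_Icc h0 ht) ht'
  have h1 : Complex.exp (Complex.I * ((t - t') * (n : ℝ) ^ 3 : ℝ)) =
      Complex.exp (Complex.I * (t * (n : ℝ) ^ 3 : ℝ)) *
        Complex.exp (Complex.I * (t' * -(n : ℝ) ^ 3 : ℝ)) := by
    rw [← Complex.exp_add]; congr 1; push_cast; ring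
  rw [h1, nonlinearityCoeff_eq, mul_assoc, mul_left_comm (σ : ℂ)]
  congr 1
  rw [Finset.mul_sum, Finset.mul_sum, Finset.mul_sum]
  refine Finset.sum_congr rfl fun k _ => ?_
  rw [coeff_eq_exp_mul ht'' k.1, coeff_eq_exp_mul ht'' k.2, coeff_eq_exp_mul ht'' (k.1 + k.2 - n),
    force]
  linear_combination (Complex.I * σ * mult n k) * exp_freq n k t' (interaction T u k.1 t')
    (interaction T u (k.1 + k.2 - n) t') (interaction T u k.2 t')

/-- The Duhamel formula in the interaction representation. -/
theorem isMildSolution_iff {σ T : ℝ} {u₀ : L2Torus} {u : ℝ → L2Torus}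
    (hm : ∀ n, Measurable (interaction T u n)) (hb : ∀ n, supNorm (interaction T u n) ≠ ∞)
    (hT : 0 ≤ T) (hsum : ∀ t ∈ Set.Icc (-T) T, ∀ n, Summable fun k =>
      osc (freq n k) (force (Complex.I * σ) (interaction T u) n k) 0 t) :
    IsMildSolution σ T u₀ u ↔ ∀ t ∈ Set.Icc (-T) T, ∀ n,
      interaction T u n t = coeff u₀ n + duhamel (Complex.I * σ) (interaction T u) n 0 t := by
  refine forall_congr' fun t => forall_congr' fun ht => forall_congr' fun n => ?_
  have h1 : Tendsto (fun N : ℕ =>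
      Complex.exp (Complex.I * (t * (n : ℝ) ^ 3 : ℝ)) * coeff u₀ n +
        σ * ∫ t' in (0 : ℝ)..t,
          Complex.exp (Complex.I * ((t - t') * (n : ℝ) ^ 3 : ℝ)) * nonlinearityCoeff N (u t') n)
      atTop (𝓝 (Complex.exp (Complex.I * (t * (n : ℝ) ^ 3 : ℝ)) *
        (coeff u₀ n + duhamel (Complex.I * σ) (interaction T u) n 0 t))) := by
    simp_rw [duhamel_truncated hm hb hT ht, ← mul_add]
    exact (((hsum t ht n).hasSum.comp (tendsto_pairs n)).const_add _).const_mul _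
  rw [coeff_eq_exp_mul ht]
  constructor
  · intro h
    exact mul_left_cancel₀ (Complex.exp_ne_zero _) (tendsto_nhds_unique h h1)
  · intro h
    rwa [← h] at h1

end

/-! ### A priori regularity of solutions and uniqueness -/

section

variable {σ s p T : ℝ} {u₀ : L2Torus} {u : ℝ → L2Torus}

/-- Continuity in the norm controls each coefficient; together with compactness of [-T, T] it gives
the qualitative boundedness required in `HalfReg`. -/
lemma continuousOn_coeff (hp : 1 ≤ p) (hu : ContinuousFL s p T u) (n : ℤ) :
    ContinuousOn (fun t => coeff (u t) n) (Set.Icc (-T) T) := by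
  intro t₀ ht₀
  have h1 := (hu t₀ ht₀).2
  refine tendsto_iff_edist_tendsto_0.2 ?_
  have h2 : Tendsto (fun t => wt (-s) n * flNorm s p (u t - u t₀)) (𝓝[Set.Icc (-T) T] t₀) (𝓝 0) := by
    simpa using ENNReal.Tendsto.const_mul h1 (Or.inr (wt_ne_top (-s) n))
  refine tendsto_of_tendsto_of_tendsto_of_le_of_le tendsto_const_nhds h2 (fun t => zero_le)
    fun t => ?_
  simp only
  rw [edist_eq_enorm_sub, ← coeff_sub, flNorm_eq]
  exact le_wl' hp (fun n => ‖coeff (u t - u t₀) n‖ₑ) n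

lemma osc_const_mul (ψ : ℝ) (z : ℂ) (f : ℝ → ℂ) (x y : ℝ) :
    osc ψ (fun t => z * f t) x y = z * osc ψ f x y := by
  rw [osc, osc, ← intervalIntegral.integral_const_mul]
  exact intervalIntegral.integral_congr fun t _ => by ring

/-- A solution in the class of the uniqueness statement satisfies the integral equation, and its
coefficients in the interaction representation have finite norm. -/
theorem integral_eq_of_isSolution (hσ : |σ| ≤ 1) (hs : 1 / 2 ≤ s) (hp : 1 ≤ p)
    (hsp : 3 / 4 - s < 1 / p) (hT : 0 < T) (hT1 : T ≤ 1) (hu : IsSolution σ s p T u₀ u) :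
    (∀ n, Measurable (interaction T u n)) ∧ seqNorm s p (interaction T u) ≠ ∞ ∧
      ∀ t ∈ Set.Icc (-T) T, ∀ n, interaction T u n t =
        coeff u₀ n + duhamel (Complex.I * σ) (interaction T u) n 0 t := by
  set κ : ℂ := Complex.I * σ with hκ
  have hκ1 : ‖κ‖ₑ ≤ 1 := by
    rw [hκ, enorm_mul, ← ofReal_norm, Complex.norm_I, ← ofReal_norm, Complex.norm_real,
      Real.norm_eq_abs, ENNReal.ofReal_one, one_mul, ENNReal.ofReal_le_one]
    exact hσ
  obtain ⟨K, hK⟩ := wl_triSum_le hs hp hsp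
  obtain ⟨K', hK'⟩ := exists_halfReg
  set a := interaction T u with ha
  have h0 : (0 : ℝ) ∈ Set.Icc (-T) T := ⟨by linarith, hT.le⟩
  have hd : dataNorm s p (coeff u₀) ≠ ∞ := by
    have := (hu.continuousFL 0 h0).1
    rw [hu.initial, flNorm_eq] at this
    exact this.ne
  -- Any extension of finite norm will do; the infimum need not be attained.
  obtain ⟨g, hg⟩ := iInf_lt_iff.1 hu.xNorm_lt_top
  obtain ⟨hgE, hgX⟩ := iInf_lt_iff.1 hg
  have hXe : xNorm s (1 / 2) p 2 g = wl s p fun n => hw fun x => g n (x + (n : ℝ) ^ 3) :=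
    xNorm_eq_wl g
  rw [hXe] at hgX
  set M : ℤ → ℝ≥0∞ := fun n => K' * hw fun x => g n (x + (n : ℝ) ^ 3) with hM
  have hMfin : wl s p M ≠ ∞ := by
    rw [hM, wl_const_mul hp]
    exact ENNReal.mul_ne_top (by simp) hgX.ne
  have hR (n : ℤ) : HalfReg (-T) T (a n) (M n) :=
    hK' ((n : ℝ) ^ 3) T (fun t => coeff (u t) n) (g n) (continuousOn_coeff hp hu.continuousFL n)
      (hgE n).1 (lt_top_of_wl hp hgX n).ne (hgE n).2
  have hm (n : ℤ) : Measurable (a n) := (hR n).meas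
  have hb (n : ℤ) : supNorm (a n) ≠ ∞ := (hR n).bdd
  -- Each Duhamel integral gains ⟨Φ⟩^{-1/2} at every fixed time, with the H^{1/2} sizes M in place
  -- of the still uncontrolled suprema.
  have hosc (t : ℝ) (ht : t ∈ Set.Icc (-T) T) (n : ℤ) (k : ℤ × ℤ) :
      ‖osc (freq n k) (force κ a n k) 0 t‖ₑ ≤
        15 * (ENNReal.ofReal (gain n k) * (M k.1 * M (k.1 + k.2 - n) * M k.2)) := by
    have e : osc (freq n k) (force κ a n k) 0 t = κ * mult n k * osc (freq n k)
        (fun t => a k.1 t * (starRingEnd ℂ) (a (k.1 + k.2 - n) t) * a k.2 t) 0 t :=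
      osc_const_mul _ _ _ _ _
    have h1 : ‖osc (freq n k) (fun t => a k.1 t * (starRingEnd ℂ) (a (k.1 + k.2 - n) t) * a k.2 t)
        0 t‖ₑ ≤ 15 * (ENNReal.ofReal (bracket (freq n k) ^ (-(1 / 2) : ℝ)) *
          (M k.1 * M (k.1 + k.2 - n) * M k.2)) := by
      rcases le_total 0 t with h | h
      · exact enorm_osc_tri_le (hR _) (hR _) (hR _) (by linarith) _ h0.1 h ht.2
      · rw [osc_symm, enorm_neg]
        exact enorm_osc_tri_le (hR _) (hR _) (hR _) (by linarith) _ ht.1 h h0.2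
    rw [e, enorm_mul, enorm_mul]
    have h2 : ‖κ‖ₑ * ‖((mult n k : ℝ) : ℂ)‖ₑ ≤ ENNReal.ofReal |mult n k| := by
      rw [← ofReal_norm (mult n k : ℂ), Complex.norm_real, Real.norm_eq_abs]
      exact mul_le_of_le_one_left zero_le hκ1
    refine (mul_le_mul' h2 h1).trans (le_of_eq ?_)
    rw [gain, ENNReal.ofReal_mul (abs_nonneg _), freq, bracket_neg]
    ring
  have htot (t : ℝ) (ht : t ∈ Set.Icc (-T) T) (n : ℤ) :
      ∑' k, ‖osc (freq n k) (force κ a n k) 0 t‖ₑ ≤ 15 * triSum M M M n := by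
    rw [triSum, ← ENNReal.tsum_mul_left]
    exact ENNReal.tsum_le_tsum fun k => hosc t ht n k
  have htri : wl s p (triSum M M M) ≠ ∞ := ne_top_of_le_ne_top (by finiteness) (hK M M M)
  have hsum (t : ℝ) (ht : t ∈ Set.Icc (-T) T) (n : ℤ) :
      Summable fun k => osc (freq n k) (force κ a n k) 0 t := by
    have h1 : ∑' k, ‖osc (freq n k) (force κ a n k) 0 t‖ₑ ≠ ∞ := by
      refine ne_top_of_le_ne_top (ENNReal.mul_ne_top (by norm_num) ?_) (htot t ht n)
      exact (lt_top_of_wl hp (lt_top_iff_ne_top.2 htri) n).ne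
    refine Summable.of_norm_bounded (ENNReal.summable_toReal h1) fun k => ?_
    rw [toReal_enorm]
  have hint := (isMildSolution_iff hm hb hT.le hsum).1 hu.duhamel
  refine ⟨hm, ?_, hint⟩
  -- The equation itself now bounds the supremum of a_n, since the trilinear sum of M is finite in
  -- the weighted norm.
  set D : ℤ → ℝ≥0∞ := fun n => ‖coeff u₀ n‖ₑ + 15 * triSum M M M n with hD
  have hsup (n : ℤ) : supNorm (a n) ≤ D n := by
    refine iSup_le fun t => ?_
    by_cases ht : t ∈ Set.Icc (-T) T
    · have hat : a n t = coeff u₀ n + duhamel κ a n 0 t := hint t ht n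
      rw [hat]
      exact (enorm_add_le _ _).trans (add_le_add le_rfl
        (enorm_tsum_le_tsum_enorm.trans (htot t ht n)))
    · rw [(hR n).supp t ht]; simp
  -- Inside the interval the increments come from H^{1/2}; the jumps at ±T cost twice the supremum
  -- just obtained.
  have htime (n : ℤ) : timeNorm (a n) ≤ 3 * D n + M n := by
    have h1 := besov_le_of_support (hm n) (hR n).supp (hR n).incr_le
    calc timeNorm (a n) ≤ supNorm (a n) + (M n + 2 * supNorm (a n)) := add_le_add le_rfl h1
      _ ≤ D n + (M n + 2 * D n) := by gcongr <;> exact hsup n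
      _ = _ := by ring
  refine ne_top_of_le_ne_top ?_ ((wl_mono hp htime).trans (wl_add_le hp _ _))
  have hDfin : wl s p D ≠ ∞ := by
    refine ne_top_of_le_ne_top ?_ (wl_add_le hp _ _)
    rw [wl_const_mul hp]
    exact ENNReal.add_ne_top.2 ⟨hd, ENNReal.mul_ne_top (by norm_num) htri⟩
  rw [wl_const_mul hp]
  finiteness

/-- Uniqueness of solutions. -/
theorem eq_of_isSolution (hσ : |σ| ≤ 1) (hs : 1 / 2 ≤ s) (hp : 1 ≤ p)
    (hsp : 3 / 4 - s < 1 / p) (hT : 0 < T) (hT1 : T ≤ 1) {v : ℝ → L2Torus}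
    (hu : IsSolution σ s p T u₀ u) (hv : IsSolution σ s p T u₀ v) :
    ∀ t ∈ Set.Icc (-T) T, u t = v t := by
  have hκ1 : ‖Complex.I * (σ : ℂ)‖ₑ ≤ 1 := by
    rw [enorm_mul, ← ofReal_norm, Complex.norm_I, ← ofReal_norm, Complex.norm_real,
      Real.norm_eq_abs, ENNReal.ofReal_one, one_mul, ENNReal.ofReal_le_one]
    exact hσ
  obtain ⟨K, hK⟩ := wl_triSum_le hs hp hsp
  obtain ⟨h1, h2, h3⟩ := integral_eq_of_isSolution hσ hs hp hsp hT hT1 hu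
  obtain ⟨k1, k2, k3⟩ := integral_eq_of_isSolution hσ hs hp hsp hT hT1 hv
  intro t ht
  refine eq_of_coeff_eq fun n => ?_
  rw [coeff_eq_exp_mul ht, coeff_eq_exp_mul ht,
    eqOn_of_integral_eq hp hκ1 hK hT hT1 h1 k1 h2 k2 h3 k3 t ht n]

end

/-! ### The solution map -/

section

variable {σ s p T : ℝ} {K : ℝ≥0} {ρ : ℝ≥0∞} {u₀ v₀ : L2Torus}

/-- The solution map. -/
def flow (σ T : ℝ) (u₀ : L2Torus) (t : ℝ) : L2Torus :=
  ofCoeff fun n => Complex.exp (Complex.I * (t * (n : ℝ) ^ 3 : ℝ)) *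
    flowLimit (Complex.I * σ) T (coeff u₀) n t

lemma xNormOn_le_zNormOn (u : ℝ → L2Torus) : xNormOn s p T u ≤ zNormOn s p T u :=
  iInf₂_mono fun _ _ => le_self_add

lemma dataNorm_le_seqNorm (hp : 1 ≤ p) (a : ℤ → ℝ → ℂ) (t : ℝ) :
    dataNorm s p (fun n => a n t) ≤ seqNorm s p a :=
  wl_mono hp fun n => enorm_le_timeNorm (a n) t

lemma dataNorm_exp_mul (t : ℝ) (c : ℤ → ℂ) :
    dataNorm s p (fun n => Complex.exp (Complex.I * (t * (n : ℝ) ^ 3 : ℝ)) * c n) =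
      dataNorm s p c := by
  unfold dataNorm
  simp_rw [enorm_exp_mul]

lemma six_mul_dataNorm_le (h₀ : 6 * flNorm s p u₀ ≤ ρ) : 6 * dataNorm s p (coeff u₀) ≤ ρ := by
  rwa [flNorm_eq] at h₀

lemma seqNorm_flow_le (S : Setting (Complex.I * σ) s p T K ρ) (h₀ : 6 * flNorm s p u₀ ≤ ρ) :
    seqNorm s p (flowLimit (Complex.I * σ) T (coeff u₀)) ≤ ρ :=
  (seqNorm_flowLimit_le S (six_mul_dataNorm_le h₀)).trans (six_mul_dataNorm_le h₀)

lemma coeff_flow (S : Setting (Complex.I * σ) s p T K ρ) (h₀ : 6 * flNorm s p u₀ ≤ ρ)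
    (t : ℝ) (n : ℤ) : coeff (flow σ T u₀ t) n =
    Complex.exp (Complex.I * (t * (n : ℝ) ^ 3 : ℝ)) *
      flowLimit (Complex.I * σ) T (coeff u₀) n t := by
  refine coeff_ofCoeff S.hs S.hp S.hsp ?_ n
  rw [dataNorm_exp_mul]
  exact ne_top_of_le_ne_top S.ρ_ne_top
    ((dataNorm_le_seqNorm S.hp _ t).trans (seqNorm_flow_le S h₀))

lemma flowLimit_eq (S : Setting (Complex.I * σ) s p T K ρ) (h₀ : 6 * flNorm s p u₀ ≤ ρ) {t : ℝ}
    (ht : t ∈ Set.Icc (-T) T) (n : ℤ) : flowLimit (Complex.I * σ) T (coeff u₀) n t =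
      coeff u₀ n + duhamel (Complex.I * σ) (flowLimit (Complex.I * σ) T (coeff u₀)) n 0 t := by
  have h := congrFun (congrFun (picard_flowLimit S (six_mul_dataNorm_le h₀)) n) t
  rw [picard, Set.indicator_of_mem ht] at h
  exact h.symm

lemma flowLimit_eq_zero (S : Setting (Complex.I * σ) s p T K ρ) (h₀ : 6 * flNorm s p u₀ ≤ ρ)
    {t : ℝ} (ht : t ∉ Set.Icc (-T) T) (n : ℤ) :
    flowLimit (Complex.I * σ) T (coeff u₀) n t = 0 := by
  have h := congrFun (congrFun (picard_flowLimit S (six_mul_dataNorm_le h₀)) n) t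
  rw [picard, Set.indicator_of_notMem ht] at h
  exact h.symm

/-- The fixed point is zero outside [-T, T], like the truncated representation, so the two sequences
agree at all times. -/
lemma interaction_flow (S : Setting (Complex.I * σ) s p T K ρ) (h₀ : 6 * flNorm s p u₀ ≤ ρ) :
    interaction T (flow σ T u₀) = flowLimit (Complex.I * σ) T (coeff u₀) := by
  funext n t
  by_cases ht : t ∈ Set.Icc (-T) T
  · rw [interaction, Set.indicator_of_mem ht, coeff_flow S h₀, ← mul_assoc,
      mul_comm (Complex.exp _), exp_mul_exp_neg, one_mul]
  · rw [interaction, Set.indicator_of_notMem ht, flowLimit_eq_zero S h₀ ht]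

lemma force_flow_eq_zero (S : Setting (Complex.I * σ) s p T K ρ) (h₀ : 6 * flNorm s p u₀ ≤ ρ)
    (n : ℤ) (k : ℤ × ℤ) {t : ℝ} (ht : t ∉ Set.Icc (-1 : ℝ) 1) :
    force (Complex.I * σ) (flowLimit (Complex.I * σ) T (coeff u₀)) n k t = 0 := by
  have h : t ∉ Set.Icc (-T) T := fun h => ht ⟨by linarith [h.1, S.T_le], by linarith [h.2, S.T_le]⟩
  simp [force, flowLimit_eq_zero S h₀ h]

lemma continuousOn_flowLimit (S : Setting (Complex.I * σ) s p T K ρ)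
    (h₀ : 6 * flNorm s p u₀ ≤ ρ) (n : ℤ) :
    ContinuousOn (flowLimit (Complex.I * σ) T (coeff u₀) n) (Set.Icc (-T) T) := by
  set a := flowLimit (Complex.I * σ) T (coeff u₀) with ha
  have hm := measurable_flowLimit S (six_mul_dataNorm_le h₀)
  have hO := oscTotal_force_ne_top S.hp S.hκ S.hK hm
    (ne_top_of_le_ne_top S.ρ_ne_top (seqNorm_flow_le S h₀)) n
  have h1 : ContinuousOn (fun t => coeff u₀ n + duhamel (Complex.I * σ) a n 0 t)
      (Set.Icc (-T) T) := continuousOn_const.add (continuousOn_tsum_osc (measurable_force hm n) hO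
        (by linarith [S.T_le]) ⟨by linarith [S.T_pos], S.T_pos.le⟩)
  exact h1.congr fun t ht => flowLimit_eq S h₀ ht n

lemma flNorm_flow (S : Setting (Complex.I * σ) s p T K ρ) (h₀ : 6 * flNorm s p u₀ ≤ ρ) (t : ℝ) :
    flNorm s p (flow σ T u₀ t) =
      dataNorm s p fun n => flowLimit (Complex.I * σ) T (coeff u₀) n t := by
  rw [flNorm_eq, ← dataNorm_exp_mul t (fun n => flowLimit (Complex.I * σ) T (coeff u₀) n t)]
  congr 1
  exact funext fun n => coeff_flow S h₀ t n

/-- The flow is continuous in time. -/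
theorem continuousFL_flow (S : Setting (Complex.I * σ) s p T K ρ) (h₀ : 6 * flNorm s p u₀ ≤ ρ) :
    ContinuousFL s p T (flow σ T u₀) := by
  set a := flowLimit (Complex.I * σ) T (coeff u₀) with ha
  have hp0 : 0 < p := by linarith [S.hp]
  have hfin : seqNorm s p a ≠ ∞ := ne_top_of_le_ne_top S.ρ_ne_top (seqNorm_flow_le S h₀)
  intro t₀ ht₀
  refine ⟨?_, ?_⟩
  · rw [flNorm_flow S h₀]
    exact (dataNorm_le_seqNorm S.hp a t₀).trans_lt (lt_top_iff_ne_top.2 hfin)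
  set d : ℝ → ℤ → ℝ≥0∞ := fun t n => (wt s n * ‖coeff (flow σ T u₀ t - flow σ T u₀ t₀) n‖ₑ) ^ p
    with hd
  -- The time norm is a majorant independent of t, so convergence of each coefficient passes to the
  -- ℓ^p norm by dominated convergence for the counting measure.
  have hbound (t : ℝ) (n : ℤ) : d t n ≤ (wt s n * (2 * timeNorm (a n))) ^ p := by
    refine ENNReal.rpow_le_rpow (mul_le_mul' le_rfl ?_) hp0.le
    rw [coeff_sub, coeff_flow S h₀, coeff_flow S h₀, two_mul]
    refine enorm_sub_le.trans (add_le_add ?_ ?_) <;>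
    · rw [enorm_exp_mul]; exact enorm_le_timeNorm (a n) _
  have hlim (n : ℤ) : Tendsto (fun t => d t n) (𝓝[Set.Icc (-T) T] t₀) (𝓝 0) := by
    have h1 : ContinuousOn (fun t => coeff (flow σ T u₀ t) n) (Set.Icc (-T) T) := by
      simp_rw [coeff_flow S h₀]
      exact ContinuousOn.mul (by fun_prop) (continuousOn_flowLimit S h₀ n)
    have h2 : Tendsto (fun t => ‖coeff (flow σ T u₀ t - flow σ T u₀ t₀) n‖ₑ)
        (𝓝[Set.Icc (-T) T] t₀) (𝓝 0) := by
      simp_rw [coeff_sub, ← edist_eq_enorm_sub]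
      exact tendsto_iff_edist_tendsto_0.1 (h1 t₀ ht₀)
    have h3 := ENNReal.Tendsto.const_mul h2 (Or.inr (wt_ne_top s n))
    have h4 := h3.ennrpow_const p
    rwa [mul_zero, ENNReal.zero_rpow_of_pos hp0] at h4
  have hsum : ∑' n, (wt s n * (2 * timeNorm (a n))) ^ p ≠ ∞ := by
    intro h
    have h1 : wl s p (fun n => 2 * timeNorm (a n)) = ∞ := by
      rw [wl, h, ENNReal.top_rpow_of_pos (by positivity)]
    rw [wl_const_mul S.hp] at h1
    exact ENNReal.mul_ne_top (by norm_num) hfin h1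
  have h1 : Tendsto (fun t => ∑' n, d t n) (𝓝[Set.Icc (-T) T] t₀) (𝓝 0) := by
    simp_rw [← lintegral_count] at hsum ⊢
    have h2 := tendsto_lintegral_filter_of_dominated_convergence (μ := Measure.count)
      (F := d) (f := fun _ => 0) (l := 𝓝[Set.Icc (-T) T] t₀)
      (fun n => (wt s n * (2 * timeNorm (a n))) ^ p)
      (Eventually.of_forall fun t => measurable_of_countable _)
      (Eventually.of_forall fun t => ae_of_all _ fun n => hbound t n) hsum
      (ae_of_all _ fun n => hlim n)
    simpa using h2
  have h2 := h1.ennrpow_const (1 / p)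
  rw [ENNReal.zero_rpow_of_pos (by positivity)] at h2
  refine h2.congr fun t => ?_
  rw [flNorm_eq]; rfl

lemma oscTotal_flow_le (S : Setting (Complex.I * σ) s p T K ρ) (h₀ : 6 * flNorm s p u₀ ≤ ρ) :
    wl s p (fun n => oscTotal (freq n) (force (Complex.I * σ)
      (flowLimit (Complex.I * σ) T (coeff u₀)) n)) ≤ 3 * K * ρ ^ 2 * ρ := by
  have h := wl_oscTotal_force_sub_le (b := 0) S.hp S.hκ S.hK
    (measurable_flowLimit S (six_mul_dataNorm_le h₀)) (fun _ => measurable_zero)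
    (seqNorm_flow_le S h₀) ((seqNorm_zero S.hp).le.trans zero_le)
  simp only [force_zero, sub_zero, Pi.zero_apply] at h
  exact h.trans (mul_le_mul' le_rfl (seqNorm_flow_le S h₀))

/-- The Duhamel formula presents each coefficient as a constant plus a series of oscillating
primitives, the form required by `zNormOn_le`; the integrands vanish outside [-1, 1] because T ≤ 1.
-/
theorem zNormOn_flow_lt_top (S : Setting (Complex.I * σ) s p T K ρ)
    (h₀ : 6 * flNorm s p u₀ ≤ ρ) : zNormOn s p T (flow σ T u₀) < ∞ := by
  set a := flowLimit (Complex.I * σ) T (coeff u₀) with ha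
  have hm := measurable_flowLimit S (six_mul_dataNorm_le h₀)
  have h1 := zNormOn_le (s := s) S.hp S.T_le (φ := freq) (c := coeff u₀)
    (f := force (Complex.I * σ) a) (u := flow σ T u₀) (fun n k => measurable_force hm n k)
    (fun n k t ht => force_flow_eq_zero S h₀ n k ht) fun t ht n => by
      rw [coeff_flow S h₀, flowLimit_eq S h₀ ht n]; rfl
  refine h1.trans_lt (ENNReal.mul_lt_top (by norm_num) ((wl_add_le S.hp _ _).trans_lt ?_))
  refine ENNReal.add_lt_top.2 ⟨?_, (oscTotal_flow_le S h₀).trans_lt ?_⟩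
  · have h2 := ne_top_of_le_ne_top S.ρ_ne_top (six_mul_dataNorm_le h₀)
    refine lt_top_iff_ne_top.2 (ne_top_of_le_ne_top h2 ?_)
    exact le_mul_of_one_le_left zero_le (by norm_num)
  · have := S.ρ_ne_top
    exact lt_top_iff_ne_top.2 (by finiteness)

/-- The flow consists of solutions. -/
theorem isSolution_flow (S : Setting (Complex.I * σ) s p T K ρ) (h₀ : 6 * flNorm s p u₀ ≤ ρ) :
    IsSolution σ s p T u₀ (flow σ T u₀) := by
  have hm := measurable_flowLimit S (six_mul_dataNorm_le h₀)
  have hfin : seqNorm s p (flowLimit (Complex.I * σ) T (coeff u₀)) ≠ ∞ :=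
    ne_top_of_le_ne_top S.ρ_ne_top (seqNorm_flow_le S h₀)
  have h0 : (0 : ℝ) ∈ Set.Icc (-T) T := ⟨by linarith [S.T_pos], S.T_pos.le⟩
  refine ⟨continuousFL_flow S h₀, (xNormOn_le_zNormOn _).trans_lt (zNormOn_flow_lt_top S h₀), ?_, ?_⟩
  · refine eq_of_coeff_eq fun n => ?_
    rw [coeff_flow S h₀, flowLimit_eq S h₀ h0]
    simp [duhamel, osc]
  · refine (isMildSolution_iff ?_ ?_ S.T_pos.le ?_).2 ?_
    · rw [interaction_flow S h₀]; exact hm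
    · rw [interaction_flow S h₀]
      exact fun n => ne_top_of_le_ne_top (lt_top_of_wl S.hp (lt_top_iff_ne_top.2 hfin) n).ne
        (supNorm_le_timeNorm _)
    · rw [interaction_flow S h₀]
      exact fun t ht n => summable_osc (measurable_force hm n)
        (oscTotal_force_ne_top S.hp S.hκ S.hK hm hfin n) (by linarith [S.T_le]) h0 ht
    · rw [interaction_flow S h₀]
      exact fun t ht n => flowLimit_eq S h₀ ht n

lemma seqNorm_flow_sub_le (S : Setting (Complex.I * σ) s p T K ρ) (h₀ : 6 * flNorm s p u₀ ≤ ρ)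
    (h₁ : 6 * flNorm s p v₀ ≤ ρ) :
    seqNorm s p (fun n => flowLimit (Complex.I * σ) T (coeff u₀) n -
      flowLimit (Complex.I * σ) T (coeff v₀) n) ≤ 6 * flNorm s p (u₀ - v₀) := by
  have k₀ := six_mul_dataNorm_le h₀
  have k₁ := six_mul_dataNorm_le h₁
  refine (seqNorm_sub_le_of_picard S (measurable_flowLimit S k₀) (measurable_flowLimit S k₁)
    (seqNorm_flow_le S h₀) (seqNorm_flow_le S h₁) (picard_flowLimit S k₀)
    (picard_flowLimit S k₁)).trans (le_of_eq ?_)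
  rw [flNorm_eq, show coeff (u₀ - v₀) = _ from funext (coeff_sub u₀ v₀)]

/-- Lipschitz dependence of the flow on the datum, uniformly in time. -/
theorem flNorm_flow_sub_le (S : Setting (Complex.I * σ) s p T K ρ) (h₀ : 6 * flNorm s p u₀ ≤ ρ)
    (h₁ : 6 * flNorm s p v₀ ≤ ρ) (t : ℝ) :
    flNorm s p (flow σ T u₀ t - flow σ T v₀ t) ≤ 6 * flNorm s p (u₀ - v₀) := by
  refine le_trans ?_ (seqNorm_flow_sub_le S h₀ h₁)
  refine le_trans (le_of_eq ?_) (dataNorm_le_seqNorm S.hp _ t)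
  rw [flNorm_eq, ← dataNorm_exp_mul t (fun n => (flowLimit (Complex.I * σ) T (coeff u₀) n -
    flowLimit (Complex.I * σ) T (coeff v₀) n) t)]
  congr 1
  funext n
  rw [coeff_sub, coeff_flow S h₀, coeff_flow S h₁, ← mul_sub]
  rfl

/-- Lipschitz dependence of the flow on the datum in the restriction space. -/
theorem zNormOn_flow_sub_le (S : Setting (Complex.I * σ) s p T K ρ) (h₀ : 6 * flNorm s p u₀ ≤ ρ)
    (h₁ : 6 * flNorm s p v₀ ≤ ρ) :
    zNormOn s p T (fun t => flow σ T u₀ t - flow σ T v₀ t) ≤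
      40000 * (1 + 18 * K * ρ ^ 2) * flNorm s p (u₀ - v₀) := by
  set a := flowLimit (Complex.I * σ) T (coeff u₀) with ha
  set b := flowLimit (Complex.I * σ) T (coeff v₀) with hb
  have ma := measurable_flowLimit S (six_mul_dataNorm_le h₀)
  have mb := measurable_flowLimit S (six_mul_dataNorm_le h₁)
  have fa : seqNorm s p a ≠ ∞ := ne_top_of_le_ne_top S.ρ_ne_top (seqNorm_flow_le S h₀)
  have fb : seqNorm s p b ≠ ∞ := ne_top_of_le_ne_top S.ρ_ne_top (seqNorm_flow_le S h₁)
  have h0 : (0 : ℝ) ∈ Set.Icc (-T) T := ⟨by linarith [S.T_pos], S.T_pos.le⟩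
  have h1 := zNormOn_le (s := s) S.hp S.T_le (φ := freq) (c := fun n => coeff (u₀ - v₀) n)
    (f := fun n k => force (Complex.I * σ) a n k - force (Complex.I * σ) b n k)
    (u := fun t => flow σ T u₀ t - flow σ T v₀ t)
    (fun n k => (measurable_force ma n k).sub (measurable_force mb n k))
    (fun n k t ht => by
      rw [Pi.sub_apply, force_flow_eq_zero S h₀ n k ht, force_flow_eq_zero S h₁ n k ht, sub_zero])
    fun t ht n => by
      rw [coeff_sub, coeff_sub, coeff_flow S h₀, coeff_flow S h₁, flowLimit_eq S h₀ ht n,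
        flowLimit_eq S h₁ ht n, ← tsum_osc_sub (measurable_force ma n) (measurable_force mb n)
        (oscTotal_force_ne_top S.hp S.hκ S.hK ma fa n)
        (oscTotal_force_ne_top S.hp S.hκ S.hK mb fb n) (by linarith [S.T_le]) h0 ht]
      simp only [duhamel]
      ring
  refine h1.trans ?_
  rw [mul_assoc]
  refine mul_le_mul' le_rfl ((wl_add_le S.hp _ _).trans ?_)
  have h2 : wl s p (fun n => ‖coeff (u₀ - v₀) n‖ₑ) = flNorm s p (u₀ - v₀) := (flNorm_eq _).symm
  have h3 := wl_oscTotal_force_sub_le S.hp S.hκ S.hK ma mb (seqNorm_flow_le S h₀)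
    (seqNorm_flow_le S h₁)
  have h4 := seqNorm_flow_sub_le S h₀ h₁
  rw [h2]
  -- The data difference enters directly, and again through the forces, with constant 3Kρ² times the
  -- Lipschitz constant 6.
  calc _ ≤ flNorm s p (u₀ - v₀) + 3 * K * ρ ^ 2 * (6 * flNorm s p (u₀ - v₀)) :=
        add_le_add le_rfl (h3.trans (mul_le_mul' le_rfl h4))
    _ = _ := by ring

/-- The time T is chosen after K and ρ: the contraction constant is proportional to √(2T). -/
lemma exists_setting (hσ : |σ| ≤ 1) (hs : 1 / 2 ≤ s) (hp : 1 ≤ p) (hsp : 3 / 4 - s < 1 / p)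
    (hρ : ρ ≠ ∞) : ∃ (T : ℝ) (K : ℝ≥0), Setting (Complex.I * σ) s p T K ρ := by
  obtain ⟨K, hK⟩ := wl_triSum_le hs hp hsp
  have hlim : Tendsto (fun T : ℝ => 36 * ENNReal.ofReal (√(T - -T)) * K * ρ ^ 2) (𝓝[>] 0) (𝓝 0) := by
    have h2 : Tendsto (fun T : ℝ => ENNReal.ofReal (√(T - -T))) (𝓝[>] 0) (𝓝 0) := by
      have : Continuous fun T : ℝ => ENNReal.ofReal (√(T - -T)) :=
        ENNReal.continuous_ofReal.comp (by fun_prop)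
      simpa using (this.tendsto 0).mono_left nhdsWithin_le_nhds
    have h4 := ENNReal.Tendsto.const_mul h2
      (Or.inr (by finiteness : 36 * K * ρ ^ 2 ≠ ∞))
    rw [mul_zero] at h4
    exact h4.congr fun T => by ring
  have h5 : ∀ᶠ T in 𝓝[>] (0 : ℝ), 0 < T := self_mem_nhdsWithin
  have h6 : ∀ᶠ T in 𝓝[>] (0 : ℝ), T ≤ 1 := nhdsWithin_le_nhds (Iic_mem_nhds (by norm_num))
  have h1 := (hlim.eventually_lt_const (by simp : (0 : ℝ≥0∞) < 1 / 2)).and (h5.and h6)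
  obtain ⟨T, h2, h3, h4⟩ := h1.exists
  refine ⟨T, K, hs, hp, hsp, ?_, hK, h3, h4, hρ, h2.le⟩
  rw [enorm_mul, ← ofReal_norm, Complex.norm_I, ← ofReal_norm, Complex.norm_real,
    Real.norm_eq_abs, ENNReal.ofReal_one, one_mul, ENNReal.ofReal_le_one]
  exact hσ

theorem locallyWellPosed (hσ : |σ| ≤ 1) (hs : 1 / 2 ≤ s) (hp : 1 ≤ p) (hsp : 3 / 4 - s < 1 / p) :
    LocallyWellPosed σ s p where
  exists_flow R _ := by
    -- The iteration stays within 6 times the size of the datum, so a ball of data of radius R calls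
    -- for ρ = 6R.
    obtain ⟨T, K, S⟩ := exists_setting (ρ := 6 * ENNReal.ofReal R) hσ hs hp hsp (by finiteness)
    have hfin : 40000 * (1 + 18 * K * (6 * ENNReal.ofReal R) ^ 2) ≠ ∞ := by finiteness
    refine ⟨T, S.T_pos, S.T_le, (40000 * (1 + 18 * K * (6 * ENNReal.ofReal R) ^ 2)).toNNReal,
      flow σ T, fun u₀ hu => ?_, fun u₀ v₀ hu hv => ?_⟩
    · have h₀ : 6 * flNorm s p u₀ ≤ 6 * ENNReal.ofReal R := by gcongr
      exact ⟨isSolution_flow S h₀, zNormOn_flow_lt_top S h₀⟩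
    · have h₀ : 6 * flNorm s p u₀ ≤ 6 * ENNReal.ofReal R := by gcongr
      have h₁ : 6 * flNorm s p v₀ ≤ 6 * ENNReal.ofReal R := by gcongr
      rw [ENNReal.coe_toNNReal hfin]
      refine ⟨zNormOn_flow_sub_le S h₀ h₁, fun t _ => (flNorm_flow_sub_le S h₀ h₁ t).trans ?_⟩
      refine mul_le_mul' ?_ le_rfl
      calc (6 : ℝ≥0∞) ≤ 40000 * 1 := by norm_num
        _ ≤ _ := mul_le_mul' le_rfl le_self_add
  unique T hT hT1 u₀ u v hu hv := eq_of_isSolution hσ hs hp hsp hT hT1 hu hv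

end

end MKdV

end

theorem theorem1p4 (σ s p : ℝ) (hσ : σ = 1 ∨ σ = -1)
    (hsp : (1 / 2 ≤ s ∧ s < 3 / 4 ∧ 1 ≤ p ∧ p < 4 / (3 - 4 * s)) ∨ (3 / 4 ≤ s ∧ 1 ≤ p)) :
    MKdV.LocallyWellPosed σ s p := by
  have h1 : |σ| ≤ 1 := by rcases hσ with rfl | rfl <;> simp
  -- In the first case p < 4/(3 - 4s) is 3/4 - s < 1/p after clearing denominators; in the second
  -- the left side is not positive.
  rcases hsp with ⟨h2, h3, h4, h5⟩ | ⟨h2, h3⟩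
  · refine MKdV.locallyWellPosed h1 h2 h4 ?_
    rw [lt_div_iff₀ (by linarith)] at h5 ⊢
    linarith
  · refine MKdV.locallyWellPosed h1 (by linarith) h3 ?_
    have : 0 < 1 / p := by positivity
    linarith
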